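/- Fix a differentiability class, either $C^r$ with $0\le r\le\infty$, or $PL$. All manifolds below are oriented, Hausdorff, second countable, of dimension $1$ and of this class, and may have a boundary. A \emph{local transformation} of $T$ is an orientation-preserving diffeomorphism (of the given class) between two open subsets of $T$. A \emph{pseudo-group} $(G,T)$ is a set $G$ of local transformations of $T$ that contains the identity of every open subset, is stable under composition (wherever defined) and inversion, and contains every local transformation that belongs to $G$ locally, in a neighbourhood of each point of its domain. For $U\subset T$ open, $G|U$ is the set of the elements of $G$ whose domain and image lie in $U$. The \emph{orbit} $G(t)$ is the set of the $\gamma(t)$, for $\gamma\in G$ defined at $t$; the \emph{isotropy group} $G_t$ is the group of germs at $t$ of the elements of $G$ fixing $t$. $(G,T)$ is \emph{compactly generated} if there is a relatively compact open $U\subset T$ meeting every orbit such that $G|U$ is generated by finitely many elements $\gamma$, each of which is the restriction of some $\bar\gamma\in G$ such that $\mathrm{Dom}(\gamma)$ is relatively compact in $\mathrm{Dom}(\bar\gamma)$. A \emph{Haefliger equivalence} between $(G,T)$ and $(G',T')$ is a pseudo-group $H$ on $T\sqcup T'$ with $H|T=G$ and $H|T'=G'$, each of whose orbits meets both $T$ and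 $T'$. A \emph{positive arc} in $T$ is an orientation-preserving embedding of $[0,1]$; a \emph{positive chain} is a finite nonempty sequence of positive arcs such that the extremity of each but the last lies on the same orbit as the origin of the next; it is a \emph{positive loop} if the extremity of its last arc lies on the same orbit as the origin of its first arc. An orbit is \emph{essential} if it meets no positive loop and no positive chain whose origin and extremity both lie on $\partial T$. It is \emph{commutative} if its isotropy group is commutative. The \emph{essential rank} of $(G,T)$ is the supremum, in $\{0,1,2,\dots,\infty\}$, of the ranks (minimal numbers of generators) of the isotropy groups of the essential orbits (it is $0$ if there are none). A pseudo-group $(\Gamma,\Omega)$ is a \emph{hinge} with \emph{core} $[a,b]$ if $\Omega$ is an interval (open, compact or semi-open), $[a,b]\subset\Omega$ with $a\le b$ is a $\Gamma$-invariant compact interval, and $\Gamma$ is generated by some $\gamma_1,\dots,\gamma_r$ ($r\ge 0$) such that: the domains and images of the $\gamma_i$ are intervals containing $[a,b]$; for all $i,j$, the relations $\gamma_i\gamma_j=\gamma_j\gamma_i$, $\gamma_i^{-1}\gamma_j=\gamma_j\gamma_i^{-1}$ and $\gamma_i^{-1}\gamma_j^{-1}=\gamma_j^{-1}\gamma_i^{-1}$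 hold wherever both composites are defined; and every neighbourhood of $[a,b]$ in $\Omega$ meets every orbit of $\Gamma$. Its \emph{rank} is the smallest possible $r$. \textbf{Proposition.} Let $(G,T)$ be a compactly generated pseudo-group of dimension $1$ in which every essential orbit is commutative. Then $(G,T)$ is Haefliger-equivalent to a pseudo-group $(G',T')$ such that $T'$ splits as a disjoint union of open subsets $$T'=T_0\sqcup\Omega_1\sqcup\dots\sqcup\Omega_\ell\qquad(\ell\ge 0)$$ where \begin{enumerate} \item $T_0$ is a finite (possibly empty) disjoint union of circles and compact intervals; \item each $\Omega_k$ is the domain of a hinge $\Gamma_k\subset G'|\Omega_k$, with a core $[a_k,b_k]$, whose rank is at most the essential rank of $(G,T)$; \item each core $[a_k,b_k]\subset\Omega_k$ is $G'$-saturated, that is, a union of orbits of $G'$; \item for every $1\le k\le\ell$ and $t\in\Omega_k\setminus[a_k,b_k]$, the orbit $G'(t)$ meets $T_0$. \end{enumerate} -/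

import Mathlib

open Set Filter Topology TopologicalSpace
open scoped unitInterval Manifold

universe u

namespace OneDimPseudo

/-! ### Oriented manifolds of dimension one

Oriented 1-manifolds with boundary are modelled on the unit interval: a neighbourhood of `0` is the
model at a left boundary point, a neighbourhood of `1` at a right boundary point. -/

/-- Differentiability classes: `C^r` with `0 ≤ r ≤ ∞`, or piecewise linear. -/
inductive DiffClass where
  | smooth (r : ℕ∞)
  | pl

/-- A partial homeomorphism between open subsets of `[0,1]` is an orientation-preserving
diffeomorphism of the given class. `C^r` is understood up to the boundary; `PL` means affine on some
one-sided neighbourhood, on either side, of every point (the inverse is then `PL` too). -/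
def IsAdmissible (c : DiffClass) (e : OpenPartialHomeomorph I I) : Prop :=
  (∀ x ∈ e.source, ∃ u ∈ 𝓝 x, u ⊆ e.source ∧ StrictMonoOn e u) ∧
  match c with
  | .smooth r =>
      ContDiffOn ℝ r (fun x : ℝ => (e (projIcc 0 1 zero_le_one x) : ℝ))
        ((fun x : I => (x : ℝ)) '' e.source) ∧
      ContDiffOn ℝ r (fun x : ℝ => (e.symm (projIcc 0 1 zero_le_one x) : ℝ))
        ((fun x : I => (x : ℝ)) '' e.target)
  | .pl => ∀ x ∈ e.source,
      (∃ a : ℝ, ∀ᶠ y in 𝓝[≥] x, (e y : ℝ) = e x + a * ((y : ℝ) - x)) ∧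
      (∃ a : ℝ, ∀ᶠ y in 𝓝[≤] x, (e y : ℝ) = e x + a * ((y : ℝ) - x))

/-- `T` is an oriented 1-manifold of class `c`, maybe with boundary: Hausdorff, second countable, and
its changes of charts are orientation-preserving diffeomorphisms of class `c`. -/
structure IsOrientedOneManifold (c : DiffClass) (T : Type*) [TopologicalSpace T]
    [ChartedSpace I T] : Prop where
  t2 : T2Space T
  secondCountable : SecondCountableTopology T
  compatible : ∀ φ ∈ atlas I T, ∀ ψ ∈ atlas I T, IsAdmissible c (φ.symm ≫ₕ ψ)

/-- The boundary `∂T`. -/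
def boundary (T : Type*) [TopologicalSpace T] [ChartedSpace I T] : Set T :=
  {x | chartAt I x x = 0 ∨ chartAt I x x = 1}

/-- Orientation-preserving local transformations of class `c` of an oriented 1-manifold. -/
def IsLocalTransformation (c : DiffClass) {T : Type*} [TopologicalSpace T] [ChartedSpace I T]
    (e : OpenPartialHomeomorph T T) : Prop :=
  ∀ φ ∈ atlas I T, ∀ ψ ∈ atlas I T, IsAdmissible c (φ.symm ≫ₕ e ≫ₕ ψ)

/-! ### Pseudo-groups

A pseudo-group on a space is a `StructureGroupoid` that is `ClosedUnderRestriction`. (Mathlib also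
counts the empty transformation as a member, and a member only matters on its source.) -/

/-- `G` is an (oriented) pseudo-group of class `c` on the oriented 1-manifold `T`. -/
structure IsPseudoGroup (c : DiffClass) {T : Type*} [TopologicalSpace T] [ChartedSpace I T]
    (G : StructureGroupoid T) : Prop where
  restr : ClosedUnderRestriction G
  transformation : ∀ g ∈ G, IsLocalTransformation c g

section Topological

variable {X Y : Type*} [TopologicalSpace X] [TopologicalSpace Y]

/-- `G` is the smallest pseudo-group containing `S`. -/
def IsGeneratedBy (G : StructureGroupoid X) (S : Set (OpenPartialHomeomorph X X)) : Prop :=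
  IsLeast {K : StructureGroupoid X | ClosedUnderRestriction K ∧ ∀ s ∈ S, s ∈ K} G

/-- The orbit `G(t)`. -/
def orbit (G : StructureGroupoid X) (t : X) : Set X :=
  {y | ∃ g ∈ G, t ∈ g.source ∧ g t = y}

/-- Restriction of a pseudo-group `G` on `Y` along an open embedding `f : X → Y`: the local
transformations of `X` that are elements of `G` when `X` is seen as an open subset of `Y`. By the
locality axiom it is enough to require this in a neighbourhood of every point of the source; see
`mem_restrictAlong_iff`. -/
def restrictAlong (G : StructureGroupoid Y) (f : X → Y) (hf : IsOpenEmbedding f) :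
    StructureGroupoid X where
  members := {e | ∀ x ∈ e.source, ∃ g ∈ G, f x ∈ g.source ∧ ∀ᶠ y in 𝓝 x, g (f y) = f (e y)}
  trans' := by
    intro e e' he he' x hx
    rw [OpenPartialHomeomorph.trans_source] at hx
    obtain ⟨g, hg, hxg, hge⟩ := he x hx.1
    obtain ⟨g', hg', hxg', hge'⟩ := he' (e x) hx.2
    refine ⟨g ≫ₕ g', G.trans hg hg', ?_, ?_⟩
    · rw [OpenPartialHomeomorph.trans_source]
      refine ⟨hxg, ?_⟩
      change g (f x) ∈ g'.source
      rw [hge.self_of_nhds]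
      exact hxg'
    · filter_upwards [hge, (e.continuousAt hx.1).eventually hge'] with y h1 h2
      simp [h1, h2]
  symm' := by
    intro e he x hx
    obtain ⟨g, hg, hxg, hge⟩ := he (e.symm x) (e.map_target hx)
    have hc : ContinuousAt e.symm x := e.symm.continuousAt hx
    have key : ∀ᶠ y in 𝓝 x, g (f (e.symm y)) = f y ∧ f (e.symm y) ∈ g.source := by
      have hs : ∀ᶠ w in 𝓝 (e.symm x), f w ∈ g.source :=
        (hf.continuous.continuousAt).eventually (g.open_source.mem_nhds hxg)
      filter_upwards [hc.eventually hge, hc.eventually hs, e.open_target.mem_nhds hx]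
        with y h1 h2 h3
      exact ⟨by rw [h1, e.right_inv h3], h2⟩
    refine ⟨g.symm, G.symm hg, ?_, ?_⟩
    · have := key.self_of_nhds
      rw [← this.1]
      exact g.map_source this.2
    · filter_upwards [key] with y hy
      rw [← hy.1, g.left_inv hy.2]
  id_mem' := fun x _ => ⟨OpenPartialHomeomorph.refl Y, G.id_mem, by simp, by simp⟩
  locality' := by
    intro e h x hx
    obtain ⟨s, hs, hxs, hes⟩ := h x hx
    obtain ⟨g, hg, h1, h2⟩ := hes x (by
      rw [OpenPartialHomeomorph.restr_source, hs.interior_eq]; exact ⟨hx, hxs⟩)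
    exact ⟨g, hg, h1, by simpa using h2⟩
  mem_of_eqOnSource' := by
    intro e e' he h x hx
    obtain ⟨g, hg, h1, h2⟩ := he x (h.1 ▸ hx)
    refine ⟨g, hg, h1, ?_⟩
    filter_upwards [h2, e'.open_source.mem_nhds hx] with y hy hy'
    rw [hy, h.2 hy']

/-- The elements of the restriction along an open embedding `f` are the local transformations of `X`
that become elements of `G` when they are transported by `f`. -/
theorem mem_restrictAlong_iff (G : StructureGroupoid Y) [ClosedUnderRestriction G] (f : X → Y)
    (hf : IsOpenEmbedding f) (e : OpenPartialHomeomorph X X) :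
    e ∈ restrictAlong G f hf ↔
      ∃ g ∈ G, g.source = f '' e.source ∧ ∀ x ∈ e.source, g (f x) = f (e x) := by
  constructor
  · intro he
    rcases isEmpty_or_nonempty X with hX | hX
    · refine ⟨(OpenPartialHomeomorph.refl Y).restr ∅,
        closedUnderRestriction' G.id_mem isOpen_empty, ?_, fun x => isEmptyElim x⟩
      simp [Set.eq_empty_of_isEmpty]
    · let F := hf.toOpenPartialHomeomorph f
      let e' : OpenPartialHomeomorph Y Y := F.symm ≫ₕ e ≫ₕ F
      have hl : ∀ x, F.symm (f x) = x := fun x => F.left_inv (by simp [F])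
      have hval : ∀ x, e' (f x) = f (e x) := by
        intro x
        change f (e (F.symm (f x))) = f (e x)
        rw [hl]
      have hsrc : e'.source = f '' e.source := by
        ext y
        simp only [e', OpenPartialHomeomorph.trans_source, OpenPartialHomeomorph.symm_source,
          mem_inter_iff, mem_preimage, mem_image]
        constructor
        · rintro ⟨h1, h2, -⟩
          refine ⟨_, h2, F.right_inv h1⟩
        · rintro ⟨x, hx, rfl⟩
          refine ⟨by simp [F], by rwa [hl], by simp [F]⟩
      refine ⟨e', ?_, hsrc, fun x _ => hval x⟩
      refine G.locality fun y hy => ?_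
      rw [hsrc] at hy
      obtain ⟨x, hx, rfl⟩ := hy
      obtain ⟨g, hg, hxg, hge⟩ := he x hx
      have hs : ∀ᶠ w in 𝓝 x, f w ∈ g.source :=
        (hf.continuous.continuousAt).eventually (g.open_source.mem_nhds hxg)
      obtain ⟨s, hs1, hs2, hs3⟩ := eventually_nhds_iff.1 (hge.and hs)
      refine ⟨f '' s, hf.isOpenMap s hs2, mem_image_of_mem f hs3, ?_⟩
      refine StructureGroupoid.restr_mem_of_eqOn hg (hf.isOpenMap s hs2) ?_ ?_
      · rintro _ ⟨w, hw, rfl⟩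
        rw [(hs1 w hw).1, hval]
      · rintro _ ⟨-, w, hw, rfl⟩
        exact (hs1 w hw).2
  · rintro ⟨g, hg, h1, h2⟩ x hx
    refine ⟨g, hg, h1 ▸ mem_image_of_mem f hx, ?_⟩
    filter_upwards [e.open_source.mem_nhds hx] with y hy using h2 y hy

/-- The restricted pseudo-group `G|U`. -/
def restrictTo (G : StructureGroupoid X) (U : Opens X) : StructureGroupoid U :=
  restrictAlong G (Subtype.val : U → X) U.isOpenEmbedding'

/-- An open set which meets every orbit. -/
def IsExhaustive (G : StructureGroupoid X) (U : Set X) : Prop :=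
  IsOpen U ∧ ∀ t, (orbit G t ∩ U).Nonempty

/-- `γ`, a local transformation of `U ⊆ X`, is `G`-extendable: it is the restriction of some element
of `G` in whose domain the domain of `γ` is relatively compact. -/
def IsExtendable (G : StructureGroupoid X) {U : Opens X} (γ : OpenPartialHomeomorph U U) : Prop :=
  ∃ g ∈ G, ∃ K : Set X, IsCompact K ∧ Subtype.val '' γ.source ⊆ K ∧ K ⊆ g.source ∧
    ∀ x ∈ γ.source, g (x : X) = (γ x : X)

/-- Compact generation. -/
def IsCompactlyGenerated (G : StructureGroupoid X) : Prop :=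
  ∃ U : Opens X, IsExhaustive G U ∧ IsCompact (closure (U : Set X)) ∧
    ∃ S : Set (OpenPartialHomeomorph U U), S.Finite ∧ (∀ γ ∈ S, IsExtendable G γ) ∧
      IsGeneratedBy (restrictTo G U) S

/-! ### Isotropy groups -/

/-- Elements of `G` fixing `t`. -/
def Stab (G : StructureGroupoid X) (t : X) : Type _ :=
  {g : OpenPartialHomeomorph X X // g ∈ G ∧ t ∈ g.source ∧ g t = t}

/-- Equality of germs at `t`. -/
def stabSetoid (G : StructureGroupoid X) (t : X) : Setoid (Stab G t) where
  r g h := ∀ᶠ y in 𝓝 t, g.1 y = h.1 y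
  iseqv := ⟨fun _ => Eventually.of_forall fun _ => rfl, fun h => h.mono fun _ e => e.symm,
    fun h h' => by filter_upwards [h, h'] with y a b using a.trans b⟩

/-- The isotropy group `G_t`: germs at `t` of the elements of `G` fixing `t`. -/
def Isotropy (G : StructureGroupoid X) (t : X) : Type _ := Quotient (stabSetoid G t)

theorem Stab.tendsto {G : StructureGroupoid X} {t : X} (g : Stab G t) :
    Tendsto g.1 (𝓝 t) (𝓝 t) := by
  have h := g.1.continuousAt g.2.2.1
  rwa [ContinuousAt, g.2.2.2] at h

/-- Composition, `(a * b) x = a (b x)`. -/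
def Stab.mul {G : StructureGroupoid X} {t : X} (a b : Stab G t) : Stab G t :=
  ⟨b.1 ≫ₕ a.1, G.trans b.2.1 a.2.1, by
    rw [OpenPartialHomeomorph.trans_source]
    refine ⟨b.2.2.1, ?_⟩
    change b.1 t ∈ a.1.source
    rw [b.2.2.2]
    exact a.2.2.1, by simp [a.2.2.2, b.2.2.2]⟩

def Stab.inv {G : StructureGroupoid X} {t : X} (a : Stab G t) : Stab G t :=
  ⟨a.1.symm, G.symm a.2.1, by
    have := a.1.map_source a.2.2.1
    rwa [a.2.2.2] at this, by
    have := a.1.left_inv a.2.2.1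
    rwa [a.2.2.2] at this⟩

def Stab.one (G : StructureGroupoid X) (t : X) : Stab G t :=
  ⟨OpenPartialHomeomorph.refl X, G.id_mem, by simp, by simp⟩

instance (G : StructureGroupoid X) (t : X) : Group (Isotropy G t) :=
  letI : Mul (Isotropy G t) := ⟨Quotient.map₂ Stab.mul (by
    intro a a' ha b b' hb
    change ∀ᶠ y in 𝓝 t, a.1 (b.1 y) = a'.1 (b'.1 y)
    filter_upwards [hb, b.tendsto.eventually ha] with y h1 h2
    rw [h2, h1])⟩
  letI : Inv (Isotropy G t) := ⟨Quotient.map Stab.inv (by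
    intro a a' ha
    change ∀ᶠ y in 𝓝 t, a.1.symm y = a'.1.symm y
    have hs : ∀ᶠ w in 𝓝 t, w ∈ a'.1.source := a'.1.open_source.mem_nhds a'.2.2.1
    have ht : ∀ᶠ y in 𝓝 t, y ∈ a.1.target := by
      have := a.1.map_source a.2.2.1
      rw [a.2.2.2] at this
      exact a.1.open_target.mem_nhds this
    have hi := (Stab.inv a).tendsto
    filter_upwards [hi.eventually ha, hi.eventually hs, ht] with y h1 h2 h3
    have h4 : a'.1 (a.1.symm y) = y := h1.symm.trans (a.1.right_inv h3)
    have h5 := a'.1.left_inv h2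
    change a'.1.symm (a'.1 (a.1.symm y)) = a.1.symm y at h5
    rw [h4] at h5
    exact h5.symm)⟩
  letI : One (Isotropy G t) := ⟨Quotient.mk (stabSetoid G t) (Stab.one G t)⟩
  Group.ofLeftAxioms
    (by
      rintro ⟨a⟩ ⟨b⟩ ⟨c⟩
      exact Quotient.sound (s := stabSetoid G t) (Eventually.of_forall fun _ => rfl))
    (by
      rintro ⟨a⟩
      exact Quotient.sound (s := stabSetoid G t) (Eventually.of_forall fun _ => rfl))
    (by
      rintro ⟨a⟩
      refine Quotient.sound (s := stabSetoid G t) ?_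
      change ∀ᶠ y in 𝓝 t, a.1.symm (a.1 y) = y
      filter_upwards [a.1.open_source.mem_nhds a.2.2.1] with y hy
      exact a.1.left_inv hy)

end Topological

/-- The rank of a group: the smallest cardinality of a generating set (`⊤` if there is no finite
one). -/
noncomputable def groupRank (A : Type*) [Group A] : ℕ∞ :=
  ⨅ (S : Finset A) (_ : Subgroup.closure (S : Set A) = ⊤), (S.card : ℕ∞)

/-! ### Haefliger equivalence -/

/-- `(G,T)` and `(G',T')` are Haefliger-equivalent: some pseudo-group on `T ⊔ T'` restricts to `G` on
`T` and to `G'` on `T'`, and each of its orbits meets both `T` and `T'`. -/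
def HaefligerEquivalent (c : DiffClass) {T T' : Type*} [TopologicalSpace T] [ChartedSpace I T]
    [TopologicalSpace T'] [ChartedSpace I T'] (G : StructureGroupoid T)
    (G' : StructureGroupoid T') : Prop :=
  ∃ H : StructureGroupoid (T ⊕ T'), IsPseudoGroup c H ∧
    restrictAlong H Sum.inl IsOpenEmbedding.inl = G ∧
    restrictAlong H Sum.inr IsOpenEmbedding.inr = G' ∧
    ∀ x, (orbit H x ∩ range Sum.inl).Nonempty ∧ (orbit H x ∩ range Sum.inr).Nonempty

/-! ### Essential orbits -/

section Essential

variable {T : Type*} [TopologicalSpace T] [ChartedSpace I T]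

/-- A positive arc: an orientation-preserving embedding of `[0,1]`. -/
structure PositiveArc (T : Type*) [TopologicalSpace T] [ChartedSpace I T] where
  toFun : I → T
  isEmbedding : IsEmbedding toFun
  increasing : ∀ s, ∃ u ∈ 𝓝 s, StrictMonoOn (fun x => chartAt I (toFun s) (toFun x)) u

/-- A positive chain: the extremity of each arc but the last lies on the same orbit as the origin of
the next. -/
structure PositiveChain (G : StructureGroupoid T) where
  n : ℕ
  arc : Fin (n + 1) → PositiveArc T
  chain : ∀ i : Fin n, (arc i.succ).toFun 0 ∈ orbit G ((arc i.castSucc).toFun 1)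

namespace PositiveChain

variable {G : StructureGroupoid T}

def origin (γ : PositiveChain G) : T := (γ.arc 0).toFun 0

def extremity (γ : PositiveChain G) : T := (γ.arc (Fin.last γ.n)).toFun 1

def support (γ : PositiveChain G) : Set T := ⋃ i, range (γ.arc i).toFun

/-- A positive loop. -/
def IsLoop (γ : PositiveChain G) : Prop := γ.origin ∈ orbit G γ.extremity

end PositiveChain

/-- The orbit of `t` is essential: it meets no positive loop, and no positive chain whose both
endpoints lie on `∂T`. -/
def IsEssential (G : StructureGroupoid T) (t : T) : Prop :=
  ∀ γ : PositiveChain G,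
    (γ.IsLoop ∨ (γ.origin ∈ boundary T ∧ γ.extremity ∈ boundary T)) →
      Disjoint (orbit G t) γ.support

/-- The essential rank: the supremum of the ranks of the isotropy groups of the essential orbits. -/
noncomputable def essentialRank (G : StructureGroupoid T) : ℕ∞ :=
  ⨆ (t : T) (_ : IsEssential G t), groupRank (Isotropy G t)

end Essential

/-! ### Hinges -/

section Hinge

variable {X : Type*} [TopologicalSpace X]

/-- `e f = f e` wherever both composites are defined. -/
def CommuteWhereDefined (e f : OpenPartialHomeomorph X X) : Prop :=
  ∀ x ∈ (e ≫ₕ f).source ∩ (f ≫ₕ e).source, f (e x) = e (f x)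

/-- `C` is a compact interval `[a,b]`, `a ≤ b`, in the space `X`, which is itself an interval (of any
kind: open, compact, or semi-open). -/
def IsCompactIntervalInInterval (C : Set X) : Prop :=
  ∃ φ : X → ℝ, IsEmbedding φ ∧ (range φ).OrdConnected ∧
    ∃ a ∈ range φ, ∃ b ∈ range φ, a ≤ b ∧ C = φ ⁻¹' Icc a b

/-- `(Γ, X)` is a hinge with core `C`, as witnessed by the generators `γ`. -/
structure IsHingeSystem (Γ : StructureGroupoid X) (C : Set X) {r : ℕ}
    (γ : Fin r → OpenPartialHomeomorph X X) : Prop where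
  interval : IsCompactIntervalInInterval C
  invariant : ∀ g ∈ Γ, ∀ x ∈ C, x ∈ g.source → g x ∈ C
  generates : IsGeneratedBy Γ (range γ)
  source_interval : ∀ i, IsPreconnected (γ i).source ∧ C ⊆ (γ i).source
  target_interval : ∀ i, IsPreconnected (γ i).target ∧ C ⊆ (γ i).target
  commute : ∀ i j, CommuteWhereDefined (γ i) (γ j) ∧ CommuteWhereDefined (γ i).symm (γ j) ∧
    CommuteWhereDefined (γ i).symm (γ j).symm
  accumulates : ∀ U : Set X, IsOpen U → C ⊆ U → ∀ x, (orbit Γ x ∩ U).Nonempty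

/-- The pseudo-group `(Γ, X)` is a hinge with core `C`. -/
def IsHinge (Γ : StructureGroupoid X) (C : Set X) : Prop :=
  ClosedUnderRestriction Γ ∧
    ∃ (r : ℕ) (γ : Fin r → OpenPartialHomeomorph X X), IsHingeSystem Γ C γ

/-- The rank of a hinge: the smallest possible number of generators. -/
noncomputable def hingeRank (Γ : StructureGroupoid X) (C : Set X) : ℕ∞ :=
  ⨅ (r : ℕ) (_ : ∃ γ : Fin r → OpenPartialHomeomorph X X, IsHingeSystem Γ C γ), (r : ℕ∞)

end Hinge

/-- The open subset `U` is a finite disjoint union of circles and compact intervals. (An oriented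
1-manifold of class `c` homeomorphic to the circle or to `[0,1]` is also diffeomorphic to it.) -/
def IsFiniteUnionOfCirclesAndIntervals {T : Type*} [TopologicalSpace T] (U : Opens T) : Prop :=
  ∃ (m : ℕ) (J : Fin m → Opens T), Pairwise (fun i j => Disjoint (J i : Set T) (J j)) ∧
    (U : Set T) = ⋃ i, (J i : Set T) ∧
    ∀ i, Nonempty (J i ≃ₜ Circle) ∨ Nonempty (J i ≃ₜ I)

end OneDimPseudo

/-!
The spaces to be built are modelled on `(G, T)`: a `GAtlas` on a space `Z` is a family of charts from
`Z` to `T` whose changes of charts belong to `G`, so that every point `x` of `Z` has an orbit `orb x`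
in `T`. An atlas that covers `Z` gives a pseudo-group on `Z`, and if all the orbits of `G` are
represented this pseudo-group is Haefliger-equivalent to `G` (`GAtlas.haefligerEquivalent`). It
therefore suffices to represent the orbits of `G` by finitely many circles, compact intervals and
domains of hinges, with the required incidence relations; `T'` is their disjoint union.

Positive chains are replaced by `G`-intervals (`GInt`), that is, intervals of an ordered line with an
oriented `G`-atlas. `Prec s t` means that a `G`-interval runs from the orbit of `s` to that of `t`;
since `G`-intervals can be glued at a common orbit (`exists_glue`), this relation is transitive. Call
an orbit `Ess` if it does not precede itself and does not meet a `G`-interval on the whole of `[0,1]`.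
Such an orbit is essential (`Ess.isEssential`), so that its isotropy group is commutative; every other
orbit is met by a circle or by a compact interval without `Ess` points (`exists_gcurve`). The `Ess`
orbits form a closed set, and a `G`-interval meets each of them at most once
(`GInt.eq_of_orb_eq_of_ess`).

Compact generation is used through a stability argument (`Ess.exists_stability`): near an `Ess` orbit,
finitely many elements of the isotropy group are such that the saturation of every interval with
endpoints fixed by them is closed. A positive path that starts at such an endpoint and returns
to the saturation has to return through the `Ess` orbit, so common fixed points are themselves on
`Ess` orbits (`Ess.trap_right`, `Ess.trap_left`). Thus generators of the commutative isotropy group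
give near each `Ess` point commuting maps whose common fixed points are exactly the `Ess` points
(`Ess.exists_commutingSystem`), and their number is at most the essential rank.

The set of `Ess` points in a compact exhaustive set being compact, finitely many intervals of this
kind, the local cores, meet all the `Ess` orbits. An end of such an interval is isolated among the
`Ess` points, or interior to them; in the second case the interval is continued by the next one
(`IsCore.glue`). This process stops because the ends so used strictly increase for `Prec`, and it
leaves cores with isolated ends (`CoreFamily.exists_isolated`), which can be cut into cores that meet
disjoint sets of `Ess` orbits (`exists_disjoint_cores`).

Near a core, a point that is not `Ess` is moved by some of the commuting maps. Hence its orbit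
accumulates at the core, which is the last property of a hinge (`CommutingSystem.exists_hinge`), and it
also meets a fixed compact set away from the `Ess` points (`CommutingSystem.exists_fundamental`).
Finitely many circles and compact intervals without `Ess` points meet the orbits of these compact
sets and all the orbits that do not meet the hinges (`exists_decomposition`).
-/

/-! ### Spaces modelled on a pseudo-group -/

namespace OneDimPseudo

section Groupoid

variable {X : Type*} [TopologicalSpace X] {G : StructureGroupoid X}

/-- The sheaf property of a pseudo-group: membership can be checked on germs. -/
theorem mem_of_germs [ClosedUnderRestriction G] {e : OpenPartialHomeomorph X X}
    (h : ∀ x ∈ e.source, ∃ g ∈ G, x ∈ g.source ∧ ∀ᶠ y in 𝓝 x, g y = e y) : e ∈ G := by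
  refine G.locality fun x hx => ?_
  obtain ⟨g, hg, hxg, hge⟩ := h x hx
  obtain ⟨s, hs1, hs2, hs3⟩ :=
    eventually_nhds_iff.1 (hge.and (g.open_source.mem_nhds hxg))
  refine ⟨s, hs2, hs3, StructureGroupoid.restr_mem_of_eqOn hg hs2 (fun y hy => (hs1 y hy).1) ?_⟩
  exact fun y hy => (hs1 y hy.2).2

theorem mem_orbit_self (t : X) : t ∈ orbit G t :=
  ⟨OpenPartialHomeomorph.refl X, G.id_mem, by simp, by simp⟩

theorem mem_orbit_of_mem {g : OpenPartialHomeomorph X X} (hg : g ∈ G) {t : X}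
    (ht : t ∈ g.source) : g t ∈ orbit G t :=
  ⟨g, hg, ht, rfl⟩

theorem mem_orbit_symm {s t : X} (h : s ∈ orbit G t) : t ∈ orbit G s := by
  obtain ⟨g, hg, ht, rfl⟩ := h
  exact ⟨g.symm, G.symm hg, g.map_source ht, g.left_inv ht⟩

theorem mem_orbit_trans {r s t : X} (h : r ∈ orbit G s) (h' : s ∈ orbit G t) :
    r ∈ orbit G t := by
  obtain ⟨g, hg, ht, rfl⟩ := h'
  obtain ⟨g', hg', ht', rfl⟩ := h
  exact ⟨g ≫ₕ g', G.trans hg hg', by simp [ht, ht'], by simp⟩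

theorem orbit_eq {s t : X} (h : s ∈ orbit G t) : orbit G s = orbit G t :=
  Subset.antisymm (fun _ hr => mem_orbit_trans hr h)
    fun _ hr => mem_orbit_trans hr (mem_orbit_symm h)

end Groupoid

variable {T : Type*} [TopologicalSpace T] {G : StructureGroupoid T}

/-- A `G`-atlas on a space `X`: a family of charts from `X` to `T` whose changes of charts belong to
the pseudo-group `G`. The charts need not cover `X`; see `GAtlas.dom`. -/
structure GAtlas (G : StructureGroupoid T) (X : Type*) [TopologicalSpace X] where
  charts : Set (OpenPartialHomeomorph X T)
  compat : ∀ ψ ∈ charts, ∀ ψ' ∈ charts, ψ.symm ≫ₕ ψ' ∈ G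

namespace GAtlas

variable {X Y Z : Type*} [TopologicalSpace X] [TopologicalSpace Y] [TopologicalSpace Z]

/-- Compatibility of charts can be checked on germs. -/
theorem compat_of_germs [ClosedUnderRestriction G] {ψ ψ' : OpenPartialHomeomorph X T}
    (h : ∀ x ∈ ψ.source, x ∈ ψ'.source →
      ∃ g ∈ G, ψ x ∈ g.source ∧ ∀ᶠ y in 𝓝 x, g (ψ y) = ψ' y) : ψ.symm ≫ₕ ψ' ∈ G := by
  refine mem_of_germs fun t ht => ?_
  rw [OpenPartialHomeomorph.trans_source] at ht
  obtain ⟨g, hg, h1, h2⟩ := h (ψ.symm t) (ψ.map_target ht.1) ht.2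
  rw [ψ.right_inv ht.1] at h1
  refine ⟨g, hg, h1, ?_⟩
  filter_upwards [(ψ.symm.continuousAt ht.1).eventually h2, ψ.open_target.mem_nhds ht.1]
    with y hy hy'
  rw [ψ.right_inv hy'] at hy
  simpa using hy

/-- The part of the space that is covered by the charts. -/
def dom (A : GAtlas G X) : Set X := {x | ∃ ψ ∈ A.charts, x ∈ ψ.source}

theorem isOpen_dom (A : GAtlas G X) : IsOpen A.dom := by
  rw [isOpen_iff_mem_nhds]
  rintro x ⟨ψ, hψ, hx⟩
  filter_upwards [ψ.open_source.mem_nhds hx] with y hy using ⟨ψ, hψ, hy⟩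

/-- The `G`-orbit in `T` that corresponds to a point `x` (empty if `x` is not covered). -/
def orb (A : GAtlas G X) (x : X) : Set T := {t | ∃ ψ ∈ A.charts, x ∈ ψ.source ∧ t ∈ orbit G (ψ x)}

theorem orb_eq_orbit (A : GAtlas G X) {ψ : OpenPartialHomeomorph X T} (hψ : ψ ∈ A.charts) {x : X}
    (hx : x ∈ ψ.source) : A.orb x = orbit G (ψ x) := by
  refine Subset.antisymm ?_ fun t ht => ⟨ψ, hψ, hx, ht⟩
  rintro t ⟨ψ', hψ', hx', ht⟩
  refine mem_orbit_trans ht ⟨_, A.compat ψ hψ ψ' hψ', ?_, ?_⟩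
  · simp [hx, hx', ψ.map_source hx]
  · simp [hx]

theorem chart_mem_orb (A : GAtlas G X) {ψ : OpenPartialHomeomorph X T} (hψ : ψ ∈ A.charts) {x : X}
    (hx : x ∈ ψ.source) : ψ x ∈ A.orb x :=
  ⟨ψ, hψ, hx, mem_orbit_self _⟩

theorem mem_dom_iff {A : GAtlas G X} {x : X} : x ∈ A.dom ↔ (A.orb x).Nonempty :=
  ⟨fun ⟨_, hψ, hx⟩ => ⟨_, A.chart_mem_orb hψ hx⟩, fun ⟨_, ψ, hψ, hx, _⟩ => ⟨ψ, hψ, hx⟩⟩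

theorem orb_eq_of_mem {A : GAtlas G X} {x : X} {t : T} (ht : t ∈ A.orb x) :
    A.orb x = orbit G t := by
  obtain ⟨ψ, hψ, hx, ht⟩ := ht
  rw [A.orb_eq_orbit hψ hx, orbit_eq ht]

theorem orb_eq_orb_of_mem {A : GAtlas G X} {B : GAtlas G Y} {x : X} {y : Y} {t : T}
    (ht : t ∈ A.orb x) (ht' : t ∈ B.orb y) : A.orb x = B.orb y := by
  rw [orb_eq_of_mem ht, orb_eq_of_mem ht']

/-- The saturated subset of `T` generated by a set of points. -/
def sat (A : GAtlas G X) (F : Set X) : Set T := {t | ∃ x ∈ F, t ∈ A.orb x}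

/-- The set of the points whose orbit meets `S`. -/
def pre (A : GAtlas G X) (S : Set T) : Set X := {x | ∃ t ∈ A.orb x, t ∈ S}

/-- A union of orbits. -/
def _root_.OneDimPseudo.IsSaturated (G : StructureGroupoid T) (S : Set T) : Prop :=
  ∀ t ∈ S, ∀ s ∈ orbit G t, s ∈ S

theorem isSaturated_sat (A : GAtlas G X) (F : Set X) : IsSaturated G (A.sat F) := by
  rintro t ⟨x, hx, ht⟩ s hs
  exact ⟨x, hx, by rw [orb_eq_of_mem ht]; exact hs⟩

theorem mem_of_mem_pre {A : GAtlas G X} {S : Set T} (hS : IsSaturated G S) {x : X}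
    (hx : x ∈ A.pre S) {t : T} (ht : t ∈ A.orb x) : t ∈ S := by
  obtain ⟨s, hs, hs'⟩ := hx
  rw [orb_eq_of_mem hs] at ht
  exact hS s hs' t ht

theorem isOpen_pre (A : GAtlas G X) {S : Set T} (hS : IsSaturated G S) (hS' : IsOpen S) :
    IsOpen (A.pre S) := by
  rw [isOpen_iff_mem_nhds]
  rintro x ⟨t, ⟨ψ, hψ, hx, ht⟩, htS⟩
  have h1 : ψ x ∈ S := hS t htS _ (mem_orbit_symm ht)
  filter_upwards [ψ.open_source.mem_nhds hx,
    (ψ.continuousAt hx).preimage_mem_nhds (hS'.mem_nhds h1)] with y hy hy'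
  exact ⟨ψ y, A.chart_mem_orb hψ hy, hy'⟩

theorem _root_.OneDimPseudo.IsSaturated.compl {S : Set T} (hS : IsSaturated G S) : IsSaturated G Sᶜ :=
  fun t ht s hs h => ht (hS s h t (mem_orbit_symm hs))

theorem pre_compl (A : GAtlas G X) {S : Set T} (hS : IsSaturated G S) :
    A.pre Sᶜ = A.dom \ A.pre S := by
  ext x
  constructor
  · rintro ⟨t, ht, htS⟩
    exact ⟨mem_dom_iff.2 ⟨t, ht⟩, fun h => htS (mem_of_mem_pre hS h ht)⟩
  · rintro ⟨hx, hx'⟩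
    obtain ⟨t, ht⟩ := mem_dom_iff.1 hx
    exact ⟨t, ht, fun h => hx' ⟨t, ht, h⟩⟩

theorem _root_.OneDimPseudo.isOpen_saturation {W : Set T} (hW : IsOpen W) :
    IsOpen {t | ∃ s ∈ W, t ∈ orbit G s} := by
  rw [isOpen_iff_mem_nhds]
  rintro t ⟨s, hs, ht⟩
  obtain ⟨g, hg, h1, rfl⟩ := mem_orbit_symm ht
  filter_upwards [g.open_source.mem_nhds h1,
    (g.continuousAt h1).preimage_mem_nhds (hW.mem_nhds hs)] with y hy hy'
  exact ⟨g y, hy', mem_orbit_symm (mem_orbit_of_mem hg hy)⟩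

theorem isOpen_sat (A : GAtlas G X) {F : Set X} (hF : IsOpen F) : IsOpen (A.sat F) := by
  have : A.sat F = ⋃ ψ ∈ A.charts, {t | ∃ s ∈ ψ '' (ψ.source ∩ F), t ∈ orbit G s} := by
    ext t
    simp only [sat, orb, mem_ofPred_eq, mem_iUnion, mem_image, exists_prop]
    constructor
    · rintro ⟨x, hx, ψ, hψ, h1, h2⟩
      exact ⟨ψ, hψ, _, ⟨x, ⟨h1, hx⟩, rfl⟩, h2⟩
    · rintro ⟨ψ, hψ, _, ⟨x, ⟨h1, hx⟩, rfl⟩, h2⟩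
      exact ⟨x, hx, ψ, hψ, h1, h2⟩
  rw [this]
  exact isOpen_biUnion fun ψ _ => isOpen_saturation (ψ.isOpen_image_source_inter hF)

/-! ### Germs of maps that belong to the pseudo-group -/

/-- Read in charts at `x` and `f x`, the germ of `f` at `x` belongs to the pseudo-group `G`. -/
def Germ (A : GAtlas G X) (B : GAtlas G Y) (f : X → Y) (x : X) : Prop :=
  ∃ ψ ∈ A.charts, ∃ ψ' ∈ B.charts, ∃ g ∈ G, x ∈ ψ.source ∧ f x ∈ ψ'.source ∧ ψ x ∈ g.source ∧
    ∀ᶠ y in 𝓝 x, f y ∈ ψ'.source ∧ g (ψ y) = ψ' (f y)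

variable {A : GAtlas G X} {B : GAtlas G Y} {C : GAtlas G Z} {f : X → Y} {x : X}

theorem Germ.mem_dom (h : Germ A B f x) : x ∈ A.dom :=
  let ⟨ψ, hψ, _, _, _, _, hx, _⟩ := h; ⟨ψ, hψ, hx⟩

theorem Germ.map_mem_dom (h : Germ A B f x) : f x ∈ B.dom :=
  let ⟨_, _, ψ', hψ', _, _, _, hx, _⟩ := h; ⟨ψ', hψ', hx⟩

theorem Germ.congr (h : Germ A B f x) {f' : X → Y} (hf : f' =ᶠ[𝓝 x] f) : Germ A B f' x := by
  obtain ⟨ψ, hψ, ψ', hψ', g, hg, h1, h2, h3, h4⟩ := h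
  refine ⟨ψ, hψ, ψ', hψ', g, hg, h1, by rwa [hf.self_of_nhds], h3, ?_⟩
  filter_upwards [h4, hf] with y hy hy'
  rwa [hy']

/-- The germ of a map can be read in any pair of charts. -/
theorem Germ.in_charts (h : Germ A B f x) {ψ : OpenPartialHomeomorph X T} (hψ : ψ ∈ A.charts)
    (hx : x ∈ ψ.source) {ψ' : OpenPartialHomeomorph Y T} (hψ' : ψ' ∈ B.charts)
    (hx' : f x ∈ ψ'.source) :
    ∃ g ∈ G, ψ x ∈ g.source ∧ ∀ᶠ y in 𝓝 x, f y ∈ ψ'.source ∧ g (ψ y) = ψ' (f y) := by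
  obtain ⟨χ, hχ, χ', hχ', g, hg, h1, h2, h3, h4⟩ := h
  have e0 : g (χ x) = χ' (f x) := h4.self_of_nhds.2
  have c1 : ∀ᶠ y in 𝓝 x, y ∈ ψ.source ∧ y ∈ χ.source ∧ χ y ∈ g.source :=
    inter_mem (ψ.open_source.mem_nhds hx) (inter_mem (χ.open_source.mem_nhds h1)
      ((χ.continuousAt h1).preimage_mem_nhds (g.open_source.mem_nhds h3)))
  have c2 : ∀ᶠ y in 𝓝 x, g (χ y) ∈ (χ'.symm ≫ₕ ψ').source := by
    have hc : ContinuousAt (fun y => g (χ y)) x :=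
      ContinuousAt.comp (g.continuousAt h3) (χ.continuousAt h1)
    refine hc.preimage_mem_nhds ((χ'.symm ≫ₕ ψ').open_source.mem_nhds ?_)
    simp [e0, h2, hx', χ'.map_source h2]
  refine ⟨(ψ.symm ≫ₕ χ) ≫ₕ g ≫ₕ (χ'.symm ≫ₕ ψ'),
    G.trans (A.compat _ hψ _ hχ) (G.trans hg (B.compat _ hχ' _ hψ')), ?_, ?_⟩
  · simp [hx, h1, h3, e0, h2, hx', ψ.map_source hx, χ'.map_source h2]
  · filter_upwards [c1, c2, h4] with y ⟨hy1, hy2, hy3⟩ hy4 ⟨hy5, hy6⟩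
    rw [hy6] at hy4
    simp only [OpenPartialHomeomorph.trans_source, OpenPartialHomeomorph.symm_source, mem_inter_iff,
      mem_preimage, χ'.left_inv hy5] at hy4
    refine ⟨hy4.2, ?_⟩
    simp [ψ.left_inv hy1, hy6, χ'.left_inv hy5]

theorem germ_id (hx : x ∈ A.dom) : Germ A A id x := by
  obtain ⟨ψ, hψ, hx⟩ := hx
  refine ⟨ψ, hψ, ψ, hψ, OpenPartialHomeomorph.refl T, G.id_mem, hx, hx, by simp, ?_⟩
  filter_upwards [ψ.open_source.mem_nhds hx] with y hy
  exact ⟨hy, by simp⟩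

/-- A map whose germ belongs to `G` is, near the point, a local homeomorphism all of whose germs
belong to `G`. -/
theorem Germ.exists_oph (h : Germ A B f x) : ∃ e : OpenPartialHomeomorph X Y,
    x ∈ e.source ∧ f =ᶠ[𝓝 x] e ∧ ∀ y ∈ e.source, Germ A B e y := by
  obtain ⟨ψ, hψ, ψ', hψ', g, hg, h1, h2, h3, h4⟩ := h
  have e0 : g (ψ x) = ψ' (f x) := h4.self_of_nhds.2
  refine ⟨ψ ≫ₕ g ≫ₕ ψ'.symm, ?_, ?_, ?_⟩
  · simp [h1, h3, e0, ψ'.map_source h2]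
  · filter_upwards [h4] with y hy
    simp [hy.2, ψ'.left_inv hy.1]
  · intro y hy
    have hy' := hy
    simp only [OpenPartialHomeomorph.trans_source, mem_inter_iff, mem_preimage,
      OpenPartialHomeomorph.symm_source] at hy
    refine ⟨ψ, hψ, ψ', hψ', g, hg, hy.1, ?_, hy.2.1, ?_⟩
    · simpa using ψ'.map_target hy.2.2
    · filter_upwards [(ψ ≫ₕ g ≫ₕ ψ'.symm).open_source.mem_nhds hy'] with z hz
      simp only [OpenPartialHomeomorph.trans_source, mem_inter_iff, mem_preimage,
        OpenPartialHomeomorph.symm_source] at hz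
      simp only [OpenPartialHomeomorph.coe_trans, Function.comp_apply]
      exact ⟨ψ'.map_target hz.2.2, (ψ'.right_inv hz.2.2).symm⟩

theorem Germ.continuousAt (h : Germ A B f x) : ContinuousAt f x := by
  obtain ⟨e, h1, h2, -⟩ := h.exists_oph
  exact (e.continuousAt h1).congr h2.symm

theorem Germ.eventually (h : Germ A B f x) : ∀ᶠ y in 𝓝 x, Germ A B f y := by
  obtain ⟨e, h1, h2, h3⟩ := h.exists_oph
  filter_upwards [e.open_source.mem_nhds h1, h2.eventuallyEq_nhds] with y hy hy'
  exact (h3 y hy).congr hy'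

theorem Germ.comp {f' : Y → Z} (h' : Germ B C f' (f x)) (h : Germ A B f x) :
    Germ A C (f' ∘ f) x := by
  have hc := h.continuousAt
  obtain ⟨ψ, hψ, hx⟩ := h.mem_dom
  obtain ⟨ψ', hψ', hx'⟩ := h.map_mem_dom
  obtain ⟨ψ'', hψ'', hx''⟩ := h'.map_mem_dom
  obtain ⟨g, hg, h1, h2⟩ := h.in_charts hψ hx hψ' hx'
  obtain ⟨g', hg', h3, h4⟩ := h'.in_charts hψ' hx' hψ'' hx''
  refine ⟨ψ, hψ, ψ'', hψ'', g ≫ₕ g', G.trans hg hg', hx, hx'', ?_, ?_⟩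
  · have := h2.self_of_nhds.2
    simp [h1, this, h3]
  · filter_upwards [h2, hc.eventually h4] with y hy hy'
    exact ⟨hy'.1, by simp [hy.2, hy'.2]⟩

theorem Germ.orb_eq (h : Germ A B f x) : B.orb (f x) = A.orb x := by
  obtain ⟨ψ, hψ, ψ', hψ', g, hg, h1, h2, h3, h4⟩ := h
  rw [A.orb_eq_orbit hψ h1, B.orb_eq_orbit hψ' h2, ← h4.self_of_nhds.2]
  exact orbit_eq (mem_orbit_of_mem hg h3)

theorem Germ.symm {e : OpenPartialHomeomorph X Y} (hx : x ∈ e.source) (h : Germ A B e x) :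
    Germ B A e.symm (e x) := by
  obtain ⟨ψ, hψ, ψ', hψ', g, hg, h1, h2, h3, h4⟩ := h
  have ht := e.map_source hx
  have hc := e.symm.continuousAt ht
  have e0 := h4.self_of_nhds.2
  refine ⟨ψ', hψ', ψ, hψ, g.symm, G.symm hg, h2, ?_, ?_, ?_⟩
  · rwa [e.left_inv hx]
  · rw [← e0]; exact g.map_source h3
  · have hs : ∀ᶠ y in 𝓝 x, y ∈ ψ.source ∧ ψ y ∈ g.source :=
      inter_mem (ψ.open_source.mem_nhds h1)
        ((ψ.continuousAt h1).preimage_mem_nhds (g.open_source.mem_nhds h3))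
    rw [ContinuousAt, e.left_inv hx] at hc
    filter_upwards [hc.eventually h4, hc.eventually hs, e.open_target.mem_nhds ht]
      with y hy1 hy2 hy3
    rw [e.right_inv hy3] at hy1
    exact ⟨hy2.1, by rw [← hy1.2, g.left_inv hy2.2]⟩

/-- Two points on the same orbit are related by an element of `G`. -/
theorem exists_germ_of_orb_eq {x : X} {y : Y} {t : T} (hx : t ∈ A.orb x) (hy : t ∈ B.orb y) :
    ∃ e : OpenPartialHomeomorph X Y, x ∈ e.source ∧ e x = y ∧ ∀ z ∈ e.source, Germ A B e z := by
  obtain ⟨ψ, hψ, h1, h2⟩ := hx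
  obtain ⟨ψ', hψ', h3, h4⟩ := hy
  obtain ⟨g, hg, h5, h6⟩ := mem_orbit_trans (mem_orbit_symm h4) h2
  have hlim : Tendsto (fun z => g (ψ z)) (𝓝 x) (𝓝 (ψ' y)) := by
    have := (g.continuousAt h5).tendsto.comp (ψ.continuousAt h1).tendsto
    rwa [h6] at this
  have hG : Germ A B (fun z => ψ'.symm (g (ψ z))) x := by
    refine ⟨ψ, hψ, ψ', hψ', g, hg, h1, ?_, h5, ?_⟩
    · simpa only [h6, ψ'.left_inv h3] using h3
    · filter_upwards [hlim (ψ'.open_target.mem_nhds (ψ'.map_source h3))] with z hz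
      exact ⟨ψ'.map_target hz, (ψ'.right_inv hz).symm⟩
  obtain ⟨e, he1, he2, he3⟩ := hG.exists_oph
  refine ⟨e, he1, ?_, he3⟩
  simpa only [h6, ψ'.left_inv h3] using he2.self_of_nhds.symm

end GAtlas

/-! ### Orientation -/

section LocMono

variable {X Y Z : Type*} [TopologicalSpace X] [LinearOrder X] [LinearOrder Y] [LinearOrder Z]

/-- `f` is strictly increasing near `x`. -/
def LocMono (f : X → Y) (x : X) : Prop := ∃ u ∈ 𝓝 x, StrictMonoOn f u

theorem LocMono.congr {f f' : X → Y} {x : X} (h : LocMono f x) (hf : f' =ᶠ[𝓝 x] f) :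
    LocMono f' x := by
  obtain ⟨u, hu, hm⟩ := h
  refine ⟨_, inter_mem hu hf, fun a ha b hb hab => ?_⟩
  rw [show f' a = f a from ha.2, show f' b = f b from hb.2]
  exact hm ha.1 hb.1 hab

theorem LocMono.comp [TopologicalSpace Y] {f : X → Y} {f' : Y → Z} {x : X} (h' : LocMono f' (f x)) (h : LocMono f x)
    (hc : ContinuousAt f x) : LocMono (f' ∘ f) x := by
  obtain ⟨u, hu, hm⟩ := h
  obtain ⟨v, hv, hm'⟩ := h'
  exact ⟨_, inter_mem hu (hc hv), fun a ha b hb hab => hm' ha.2 hb.2 (hm ha.1 hb.1 hab)⟩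

theorem LocMono.of_comp [TopologicalSpace Y] {f : X → Y} {f' : Y → Z} {x : X} (h' : LocMono f' (f x))
    (h : LocMono (f' ∘ f) x) (hc : ContinuousAt f x) : LocMono f x := by
  obtain ⟨u, hu, hm⟩ := h
  obtain ⟨v, hv, hm'⟩ := h'
  exact ⟨_, inter_mem hu (hc hv), fun a ha b hb hab =>
    (hm'.lt_iff_lt ha.2 hb.2).1 (hm ha.1 hb.1 hab)⟩

theorem LocMono.exists_gt {f : X → Y} {x : X} [OrderTopology X] [DenselyOrdered X]
    (h : LocMono f x) (hx : ∃ y, x < y) : ∃ y, f x < y := by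
  obtain ⟨u, hu, hm⟩ := h
  have := nhdsGT_neBot_of_exists_gt hx
  obtain ⟨y, hy1, hy2⟩ := Filter.nonempty_of_mem
    (inter_mem (mem_nhdsWithin_of_mem_nhds hu) (self_mem_nhdsWithin (a := x) (s := Ioi x)))
  exact ⟨f y, hm (mem_of_mem_nhds hu) hy1 hy2⟩

theorem LocMono.exists_lt {f : X → Y} {x : X} [OrderTopology X] [DenselyOrdered X]
    (h : LocMono f x) (hx : ∃ y, y < x) : ∃ y, y < f x := by
  obtain ⟨u, hu, hm⟩ := h
  have := nhdsLT_neBot_of_exists_lt hx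
  obtain ⟨y, hy1, hy2⟩ := Filter.nonempty_of_mem
    (inter_mem (mem_nhdsWithin_of_mem_nhds hu) (self_mem_nhdsWithin (a := x) (s := Iio x)))
  exact ⟨f y, hm hy1 (mem_of_mem_nhds hu) hy2⟩

end LocMono

/-- The changes of charts of `T`, and the elements of `G` read in charts, are locally increasing. -/
class Oriented {T : Type*} [TopologicalSpace T] [ChartedSpace I T] (G : StructureGroupoid T) :
    Prop where
  locMono : ∀ g ∈ G, ∀ φ ∈ atlas I T, ∀ φ' ∈ atlas I T, ∀ x ∈ (φ.symm ≫ₕ g ≫ₕ φ').source,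
    LocMono (φ.symm ≫ₕ g ≫ₕ φ') x

theorem IsPseudoGroup.oriented {c : DiffClass} {T : Type*} [TopologicalSpace T] [ChartedSpace I T]
    {G : StructureGroupoid T} (hG : IsPseudoGroup c G) : Oriented G where
  locMono g hg φ hφ φ' hφ' x hx := by
    obtain ⟨u, hu, -, hm⟩ := (hG.transformation g hg φ hφ φ' hφ').1 x hx
    exact ⟨u, hu, hm⟩

section

variable {T : Type*} [TopologicalSpace T] [ChartedSpace I T] {G : StructureGroupoid T}
  {Z Z' : Type*} [TopologicalSpace Z] [LinearOrder Z] [TopologicalSpace Z'] [LinearOrder Z']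

/-- The local homeomorphism `ψ` into the oriented manifold `T` preserves the orientation at `x`. -/
def PosAt (ψ : OpenPartialHomeomorph Z T) (x : Z) : Prop :=
  ∃ φ ∈ atlas I T, ψ x ∈ φ.source ∧ LocMono (φ ∘ ψ) x

theorem PosAt.locMono_trans [Oriented G] {ψ : OpenPartialHomeomorph Z T} {x : Z} (h : PosAt ψ x)
    (hx : x ∈ ψ.source) {g : OpenPartialHomeomorph T T} (hg : g ∈ G) (hxg : ψ x ∈ g.source)
    {φ : OpenPartialHomeomorph T I} (hφ : φ ∈ atlas I T) (hxφ : g (ψ x) ∈ φ.source) :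
    LocMono (fun y => φ (g (ψ y))) x := by
  obtain ⟨φ', hφ', h1, h2⟩ := h
  have h3 := Oriented.locMono g hg φ' hφ' φ hφ (φ' (ψ x))
    (by simp [h1, hxg, hxφ, φ'.map_source h1])
  have hc : ContinuousAt (φ' ∘ ψ) x := (φ'.continuousAt h1).comp (ψ.continuousAt hx)
  refine (LocMono.comp (f := φ' ∘ ψ) h3 h2 hc).congr ?_
  filter_upwards [(ψ.continuousAt hx).preimage_mem_nhds (φ'.open_source.mem_nhds h1)] with y hy
  simp [φ'.left_inv hy]

theorem PosAt.locMono [Oriented G] {ψ : OpenPartialHomeomorph Z T} {x : Z} (h : PosAt ψ x)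
    (hx : x ∈ ψ.source) {φ : OpenPartialHomeomorph T I} (hφ : φ ∈ atlas I T)
    (hxφ : ψ x ∈ φ.source) : LocMono (φ ∘ ψ) x :=
  h.locMono_trans (G := G) hx G.id_mem (by simp) hφ (by simpa using hxφ)

/-- Preserving the orientation is invariant under composition with elements of `G`. -/
theorem PosAt.of_germ [Oriented G] {ψ ψ' : OpenPartialHomeomorph Z T} {x : Z} (h : PosAt ψ x)
    (hx : x ∈ ψ.source) {g : OpenPartialHomeomorph T T} (hg : g ∈ G) (hxg : ψ x ∈ g.source)
    (hgψ : ∀ᶠ y in 𝓝 x, g (ψ y) = ψ' y) : PosAt ψ' x := by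
  have h0 := hgψ.self_of_nhds
  refine ⟨chartAt I (ψ' x), chart_mem_atlas I _, mem_chart_source I _, ?_⟩
  refine (h.locMono_trans hx hg hxg (chart_mem_atlas I (ψ' x)) ?_).congr ?_
  · rw [h0]; exact mem_chart_source I _
  · filter_upwards [hgψ] with y hy
    simp [hy]

end

/-- A `G`-interval: an oriented `G`-atlas on an interval of the ordered line `Z`. In the sequel `Z`
is `[0,1]`, whose endpoints account for boundary points, or `ℝ`. -/
structure GInt {T : Type*} [TopologicalSpace T] [ChartedSpace I T] (G : StructureGroupoid T)
    (Z : Type*) [TopologicalSpace Z] [LinearOrder Z] extends GAtlas G Z where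
  pos : ∀ ψ ∈ charts, ∀ x ∈ ψ.source, PosAt ψ x
  ordConnected : toGAtlas.dom.OrdConnected

section

variable {T : Type*} [TopologicalSpace T] [ChartedSpace I T] {G : StructureGroupoid T}
  {Z Z' : Type*} [TopologicalSpace Z] [LinearOrder Z] [TopologicalSpace Z'] [LinearOrder Z']

/-- The elements of `G`, read between `G`-intervals, are locally increasing. -/
theorem GAtlas.Germ.locMono [Oriented G] {X : GInt G Z} {Y : GInt G Z'} {f : Z → Z'} {x : Z}
    (h : X.Germ Y.toGAtlas f x) : LocMono f x := by
  obtain ⟨ψ, hψ, ψ', hψ', g, hg, h1, h2, h3, h4⟩ := id h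
  have e0 := h4.self_of_nhds.2
  have hφ := chart_mem_atlas I (ψ' (f x))
  have hs := mem_chart_source I (ψ' (f x))
  have hp := (X.pos ψ hψ x h1).locMono_trans h1 hg h3 hφ (by rw [e0]; exact hs)
  have hp' := (Y.pos ψ' hψ' _ h2).locMono (G := G) h2 hφ hs
  refine hp'.of_comp (hp.congr ?_) h.continuousAt
  filter_upwards [h4] with y hy
  simp [hy.2]

end

theorem exists_ordConnected_nhds {x : I} {W : Set I} (hW : W ∈ 𝓝 x) :
    ∃ V, IsOpen V ∧ V.OrdConnected ∧ x ∈ V ∧ V ⊆ W := by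
  obtain ⟨ε, hε, hb⟩ := Metric.mem_nhds_iff.1 hW
  refine ⟨_, Metric.isOpen_ball, ?_, Metric.mem_ball_self hε, hb⟩
  have : Metric.ball x ε = ((↑) : I → ℝ) ⁻¹' Metric.ball (x : ℝ) ε := rfl
  rw [this]
  exact ((convex_ball (x : ℝ) ε).ordConnected).preimage_mono (Subtype.mono_coe _)

section

variable {T : Type*} [TopologicalSpace T] [ChartedSpace I T] {G : StructureGroupoid T}

/-- The `G`-interval with a single chart. -/
def GInt.ofChart [ClosedUnderRestriction G] (ψ : OpenPartialHomeomorph I T)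
    (hψ : ∀ x ∈ ψ.source, PosAt ψ x) (hc : ψ.source.OrdConnected) : GInt G I where
  charts := {ψ}
  compat := by
    rintro ψ rfl ψ' rfl
    exact GAtlas.compat_of_germs fun x _ _ => ⟨_, G.id_mem, by simp, by simp⟩
  pos := by
    rintro ψ rfl
    exact hψ
  ordConnected := by
    have : {x | ∃ ψ' ∈ ({ψ} : Set _), x ∈ ψ'.source} = ψ.source := by simp
    change {x | ∃ ψ' ∈ ({ψ} : Set _), x ∈ ψ'.source}.OrdConnected
    rwa [this]

/-- The inverse of a chart of `T`, restricted to a small interval, is a `G`-interval. -/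
theorem exists_gint_of_chart [ClosedUnderRestriction G] {φ : OpenPartialHomeomorph T I}
    (hφ : φ ∈ atlas I T) {z : T} (hz : z ∈ φ.source) {W : Set I} (hW : W ∈ 𝓝 (φ z)) :
    ∃ (X : GInt G I) (ψ : OpenPartialHomeomorph I T), X.charts = {ψ} ∧ φ z ∈ ψ.source ∧
      X.dom = ψ.source ∧ ψ.source ⊆ φ.target ∩ W ∧ ∀ x, ψ x = φ.symm x := by
  obtain ⟨V, hV1, hV2, hV3, hV4⟩ := exists_ordConnected_nhds
    (inter_mem (φ.open_target.mem_nhds (φ.map_source hz)) hW)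
  obtain ⟨ψ, hsrc, hval⟩ : ∃ ψ : OpenPartialHomeomorph I T, ψ.source = V ∧ ∀ x, ψ x = φ.symm x :=
    ⟨φ.symm.restrOpen V hV1, by
      rw [OpenPartialHomeomorph.restrOpen_source]
      exact inter_eq_right.2 fun y hy => (hV4 hy).1, fun _ => rfl⟩
  refine ⟨.ofChart ψ (fun x hx => ?_) (hsrc ▸ hV2), ψ, rfl, hsrc ▸ hV3, ?_, hsrc ▸ hV4, hval⟩
  · rw [hsrc] at hx
    have hx' := (hV4 hx).1
    refine ⟨φ, hφ, hval x ▸ φ.map_target hx', V, hV1.mem_nhds hx, fun a ha b hb hab => ?_⟩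
    simpa [hval, φ.right_inv (hV4 ha).1, φ.right_inv (hV4 hb).1] using hab
  · ext x
    simp [GAtlas.dom, GInt.ofChart]

end

/-! ### Pulling back and gluing atlases -/

section

variable {T : Type*} [TopologicalSpace T] {G : StructureGroupoid T}
  {X Y : Type*} [TopologicalSpace X] [TopologicalSpace Y]

/-- Two local homeomorphisms into `T` have germs at `x` that differ by an element of `G`. -/
def GermRel (G : StructureGroupoid T) (ψ ψ' : OpenPartialHomeomorph X T) (x : X) : Prop :=
  ∃ g ∈ G, ψ x ∈ g.source ∧ ∀ᶠ y in 𝓝 x, g (ψ y) = ψ' y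

theorem GermRel.refl (ψ : OpenPartialHomeomorph X T) (x : X) : GermRel G ψ ψ x :=
  ⟨_, G.id_mem, by simp, by simp⟩

theorem GermRel.of_eventuallyEq {ψ ψ' : OpenPartialHomeomorph X T} {x : X}
    (h : ∀ᶠ y in 𝓝 x, ψ y = ψ' y) : GermRel G ψ ψ' x :=
  ⟨_, G.id_mem, by simp, by simpa using h⟩

theorem GermRel.symm {ψ ψ' : OpenPartialHomeomorph X T} {x : X} (h : GermRel G ψ ψ' x)
    (hx : x ∈ ψ.source) : GermRel G ψ' ψ x := by
  obtain ⟨g, hg, h1, h2⟩ := h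
  refine ⟨g.symm, G.symm hg, ?_, ?_⟩
  · rw [← h2.self_of_nhds]; exact g.map_source h1
  · filter_upwards [h2, (ψ.continuousAt hx).preimage_mem_nhds (g.open_source.mem_nhds h1)]
      with y hy hy'
    rw [← hy, g.left_inv hy']

theorem GermRel.trans {ψ ψ' ψ'' : OpenPartialHomeomorph X T} {x : X} (h : GermRel G ψ ψ' x)
    (h' : GermRel G ψ' ψ'' x) : GermRel G ψ ψ'' x := by
  obtain ⟨g, hg, h1, h2⟩ := h
  obtain ⟨g', hg', h1', h2'⟩ := h'
  refine ⟨g ≫ₕ g', G.trans hg hg', ?_, ?_⟩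
  · have := h2.self_of_nhds
    simp [h1, this, h1']
  · filter_upwards [h2, h2'] with y hy hy'
    simp [hy, hy']

theorem GermRel.of_compat {A : GAtlas G X} {ψ ψ' : OpenPartialHomeomorph X T} (hψ : ψ ∈ A.charts)
    (hψ' : ψ' ∈ A.charts) {x : X} (hx : x ∈ ψ.source) (hx' : x ∈ ψ'.source) :
    GermRel G ψ ψ' x := by
  refine ⟨_, A.compat ψ hψ ψ' hψ', ?_, ?_⟩
  · simp [hx, hx', ψ.map_source hx]
  · filter_upwards [ψ.open_source.mem_nhds hx] with y hy
    simp [hy]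

theorem GermRel.germ_id {A B : GAtlas G X} {ψ ψ' : OpenPartialHomeomorph X T} {x : X}
    (h : GermRel G ψ ψ' x) (hψ : ψ ∈ A.charts) (hψ' : ψ' ∈ B.charts) (hx : x ∈ ψ.source)
    (hx' : x ∈ ψ'.source) : A.Germ B id x := by
  obtain ⟨g, hg, h1, h2⟩ := h
  refine ⟨ψ, hψ, ψ', hψ', g, hg, hx, hx', h1, ?_⟩
  filter_upwards [h2, ψ'.open_source.mem_nhds hx'] with y hy hy' using ⟨hy', hy⟩

/-- A set of charts whose germs at common points differ by elements of `G`. -/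
def GAtlas.ofGermRel [ClosedUnderRestriction G] (S : Set (OpenPartialHomeomorph X T))
    (h : ∀ ψ ∈ S, ∀ ψ' ∈ S, ∀ x ∈ ψ.source, x ∈ ψ'.source → GermRel G ψ ψ' x) : GAtlas G X where
  charts := S
  compat ψ hψ ψ' hψ' := GAtlas.compat_of_germs (h ψ hψ ψ' hψ')

/-- The atlas pulled back by a local homeomorphism. -/
def GAtlas.comap [ClosedUnderRestriction G] (A : GAtlas G Y) (e : OpenPartialHomeomorph X Y) :
    GAtlas G X :=
  .ofGermRel {χ | ∃ ψ ∈ A.charts, χ = e ≫ₕ ψ} <| by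
    rintro _ ⟨ψ, hψ, rfl⟩ _ ⟨ψ', hψ', rfl⟩ x hx hx'
    simp only [OpenPartialHomeomorph.trans_source, mem_inter_iff, mem_preimage] at hx hx'
    obtain ⟨g, hg, h1, h2⟩ := GermRel.of_compat hψ hψ' hx.2 hx'.2
    exact ⟨g, hg, h1, (e.continuousAt hx.1).eventually h2⟩

theorem GAtlas.dom_comap [ClosedUnderRestriction G] (A : GAtlas G Y)
    (e : OpenPartialHomeomorph X Y) : (A.comap e).dom = e.source ∩ e ⁻¹' A.dom := by
  ext x
  constructor
  · rintro ⟨_, ⟨ψ, hψ, rfl⟩, hx⟩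
    simp only [OpenPartialHomeomorph.trans_source, mem_inter_iff, mem_preimage] at hx
    exact ⟨hx.1, ψ, hψ, hx.2⟩
  · rintro ⟨h1, ψ, hψ, h2⟩
    exact ⟨_, ⟨ψ, hψ, rfl⟩, by simp [h1, h2]⟩

theorem GAtlas.germ_comap [ClosedUnderRestriction G] (A : GAtlas G Y)
    {e : OpenPartialHomeomorph X Y} {x : X} (hx : x ∈ e.source) (hx' : e x ∈ A.dom) :
    (A.comap e).Germ A e x := by
  obtain ⟨ψ, hψ, h2⟩ := hx'
  refine ⟨_, ⟨ψ, hψ, rfl⟩, ψ, hψ, _, G.id_mem, by simp [hx, h2], h2, by simp, ?_⟩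
  filter_upwards [(e.continuousAt hx).preimage_mem_nhds (ψ.open_source.mem_nhds h2)] with y hy
  exact ⟨hy, by simp⟩

end

section

variable {T : Type*} [TopologicalSpace T] [ChartedSpace I T] {G : StructureGroupoid T}
  {Z Z' : Type*} [TopologicalSpace Z] [LinearOrder Z] [TopologicalSpace Z'] [LinearOrder Z']

/-- The `G`-interval pulled back by an increasing local homeomorphism. -/
def GInt.comap [ClosedUnderRestriction G] [Oriented G] (X : GInt G Z')
    (e : OpenPartialHomeomorph Z Z') (he : ∀ x ∈ e.source, LocMono e x)
    (hc : (e.source ∩ e ⁻¹' X.dom).OrdConnected) : GInt G Z where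
  toGAtlas := X.toGAtlas.comap e
  pos := by
    rintro _ ⟨ψ, hψ, rfl⟩ x hx
    simp only [OpenPartialHomeomorph.trans_source, mem_inter_iff, mem_preimage] at hx
    obtain ⟨φ, hφ, h1, h2⟩ := X.pos ψ hψ _ hx.2
    exact ⟨φ, hφ, h1, h2.comp (he x hx.1) (e.continuousAt hx.1)⟩
  ordConnected := by rwa [GAtlas.dom_comap]

/-- Two local homeomorphisms of the line into `T` which agree at `m` can be spliced: take one on the
left of `m` and the other one on the right. -/
theorem exists_junction [OrderTopology Z] (G : StructureGroupoid T) [Oriented G]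
    {e e' : OpenPartialHomeomorph Z T} {m : Z}
    (hm : m ∈ e.source) (hm' : m ∈ e'.source) (heq : e m = e' m) (he : PosAt e m)
    (he' : PosAt e' m) :
    ∃ χ : OpenPartialHomeomorph Z T, m ∈ χ.source ∧ χ.source ⊆ e.source ∩ e'.source ∧
      (∀ x ≤ m, χ x = e x) ∧ (∀ x, m ≤ x → χ x = e' x) ∧ PosAt χ m := by
  classical
  set φ := chartAt I (e m) with hφdef
  have hφ : φ ∈ atlas I T := chart_mem_atlas I _
  have hs : e m ∈ φ.source := mem_chart_source I _
  obtain ⟨u, hu, hmu⟩ := he.locMono (G := G) hm hφ hs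
  obtain ⟨u', hu', hmu'⟩ := he'.locMono (G := G) hm' hφ (heq ▸ hs)
  obtain ⟨B, hB, hBo, hmB⟩ := mem_nhds_iff.1
    (inter_mem (inter_mem (e.open_source.mem_nhds hm) (e'.open_source.mem_nhds hm'))
      (inter_mem hu hu'))
  have hE : (e.restrOpen B hBo).source = B := by
    rw [OpenPartialHomeomorph.restrOpen_source]
    exact inter_eq_right.2 fun x hx => (hB hx).1.1
  have hE' : (e'.restrOpen B hBo).source = B := by
    rw [OpenPartialHomeomorph.restrOpen_source]
    exact inter_eq_right.2 fun x hx => (hB hx).1.2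
  have hI : (e.restrOpen B hBo).IsImage (Iic m) {y | φ y ≤ φ (e m)} := by
    intro x hx
    rw [hE] at hx
    exact hmu.le_iff_le (hB hx).2.1 (mem_of_mem_nhds hu)
  have hI' : (e'.restrOpen B hBo).IsImage (Iic m) {y | φ y ≤ φ (e m)} := by
    intro x hx
    rw [hE'] at hx
    rw [heq]
    exact hmu'.le_iff_le (hB hx).2.2 (mem_of_mem_nhds hu')
  let χ := (e.restrOpen B hBo).piecewise (e'.restrOpen B hBo) (Iic m) {y | φ y ≤ φ (e m)} hI hI'
    (by rw [hE, hE']) (by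
      rintro x ⟨-, hx⟩
      obtain rfl : x = m := frontier_Iic_subset m hx
      exact heq)
  have hχ : χ.source = B := by
    change (Iic m).ite (e.restrOpen B hBo).source (e'.restrOpen B hBo).source = B
    rw [hE, hE', Set.ite_same]
  have h1 : ∀ x ≤ m, χ x = e x := fun x hx => piecewise_eq_of_mem (Iic m) _ _ hx
  have h2 : ∀ x, m ≤ x → χ x = e' x := by
    intro x hx
    rcases hx.eq_or_lt with rfl | hx
    · rw [h1 _ le_rfl, heq]
    · exact piecewise_eq_of_notMem (Iic m) _ _ (not_le.2 hx)
  refine ⟨χ, hχ ▸ hmB, hχ ▸ fun x hx => (hB hx).1, h1, h2, φ, hφ, by rwa [h1 m le_rfl], B,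
    hBo.mem_nhds hmB, fun a ha b hb hab => ?_⟩
  have hmm := mem_of_mem_nhds hu
  have hmm' := mem_of_mem_nhds hu'
  simp only [Function.comp_apply]
  rcases le_total b m with hbm | hbm
  · rw [h1 b hbm, h1 a (hab.le.trans hbm)]
    exact hmu (hB ha).2.1 (hB hb).2.1 hab
  rcases le_total m a with ham | ham
  · rw [h2 b hbm, h2 a ham]
    exact hmu' (hB ha).2.2 (hB hb).2.2 hab
  rw [h2 b hbm, h1 a ham]
  have k1 := hmu.monotoneOn (hB ha).2.1 hmm ham
  have k2 := hmu'.monotoneOn hmm' (hB hb).2.2 hbm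
  simp only [Function.comp_apply] at k1 k2
  rw [← heq] at k2
  rcases ham.eq_or_lt with rfl | ham
  · have := hmu' hmm' (hB hb).2.2 hab
    simp only [Function.comp_apply] at this
    rwa [← heq] at this
  · exact (hmu (hB ha).2.1 hmm ham).trans_le k2

/-- Two `G`-intervals can be glued at a common orbit: take the first one on the left of `m` and the
second one on the right. -/
theorem exists_glue [OrderTopology Z] [ClosedUnderRestriction G] [Oriented G] (X₁ X₂ : GInt G Z)
    {m : Z} {t : T} (h₁ : t ∈ X₁.orb m) (h₂ : t ∈ X₂.orb m) :
    ∃ X : GInt G Z, X.dom = (X₁.dom ∩ Iic m) ∪ (X₂.dom ∩ Ici m) ∧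
      (∀ x ∈ X₁.dom, x < m → X₁.Germ X.toGAtlas id x) ∧
      (∀ x ∈ X₂.dom, m < x → X₂.Germ X.toGAtlas id x) ∧ t ∈ X.orb m := by
  obtain ⟨ψ₁, hψ₁, hm₁, ho₁⟩ := h₁
  obtain ⟨ψ₂, hψ₂, hm₂, ho₂⟩ := h₂
  obtain ⟨g, hg, hgs, hgm⟩ := mem_orbit_trans (mem_orbit_symm ho₁) ho₂
  have hrel : GermRel G ψ₂ (ψ₂ ≫ₕ g) m := ⟨g, hg, hgs, by simp⟩
  have hpos : PosAt (ψ₂ ≫ₕ g) m := by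
    obtain ⟨g', hg', k1, k2⟩ := hrel
    exact (X₂.pos ψ₂ hψ₂ m hm₂).of_germ hm₂ hg' k1 k2
  obtain ⟨χ, c1, c2, c3, c4, c5⟩ := exists_junction (e := ψ₁) (e' := ψ₂ ≫ₕ g) G hm₁
    (by simp [hm₂, hgs]) (by simp [hgm]) (X₁.pos ψ₁ hψ₁ m hm₁) hpos
  have hsrc : ∀ x ∈ χ.source, x ∈ ψ₁.source ∧ x ∈ ψ₂.source ∧ ψ₂ x ∈ g.source := by
    intro x hx
    simpa using c2 hx
  have hleft : ∀ x < m, GermRel G ψ₁ χ x := fun x hx => .of_eventuallyEq <| by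
    filter_upwards [Iio_mem_nhds hx] with y hy using (c3 y (le_of_lt hy)).symm
  have hright : ∀ x ∈ χ.source, m < x → GermRel G ψ₂ χ x := by
    intro x hxs hx
    refine ⟨g, hg, (hsrc x hxs).2.2, ?_⟩
    filter_upwards [Ioi_mem_nhds hx] with y hy
    simp [c4 y (le_of_lt hy)]
  -- every chart of the new atlas is related to the charts of the two pieces
  let S : Set (OpenPartialHomeomorph Z T) := {ξ | (∃ ψ ∈ X₁.charts, ξ = ψ.restrOpen (Iio m) isOpen_Iio) ∨
    (∃ ψ ∈ X₂.charts, ξ = ψ.restrOpen (Ioi m) isOpen_Ioi) ∨ ξ = χ}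
  have key : ∀ ξ ∈ S, ∀ x ∈ ξ.source,
      (x < m → ∃ ψ ∈ X₁.charts, x ∈ ψ.source ∧ GermRel G ψ ξ x) ∧
      (m < x → ∃ ψ ∈ X₂.charts, x ∈ ψ.source ∧ GermRel G ψ ξ x) ∧ (x = m → ξ = χ) := by
    rintro ξ (⟨ψ, hψ, rfl⟩ | ⟨ψ, hψ, rfl⟩ | rfl) x hx
    · rw [OpenPartialHomeomorph.restrOpen_source] at hx
      exact ⟨fun _ => ⟨ψ, hψ, hx.1, .of_eventuallyEq (Eventually.of_forall fun _ => rfl)⟩,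
        fun h => absurd hx.2 (not_lt.2 h.le), fun h => absurd hx.2 (not_lt.2 h.ge)⟩
    · rw [OpenPartialHomeomorph.restrOpen_source] at hx
      exact ⟨fun h => absurd hx.2 (not_lt.2 h.le),
        fun _ => ⟨ψ, hψ, hx.1, .of_eventuallyEq (Eventually.of_forall fun _ => rfl)⟩,
        fun h => absurd hx.2 (not_lt.2 h.le)⟩
    · exact ⟨fun h => ⟨ψ₁, hψ₁, (hsrc x hx).1, hleft x h⟩,
        fun h => ⟨ψ₂, hψ₂, (hsrc x hx).2.1, hright x hx h⟩, fun _ => rfl⟩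
  let A : GAtlas G Z := .ofGermRel S <| by
    intro ξ hξ ξ' hξ' x hx hx'
    rcases lt_trichotomy x m with h | h | h
    · obtain ⟨ψ, hψ, k1, k2⟩ := (key ξ hξ x hx).1 h
      obtain ⟨ψ', hψ', k1', k2'⟩ := (key ξ' hξ' x hx').1 h
      exact (k2.symm k1).trans ((GermRel.of_compat hψ hψ' k1 k1').trans k2')
    · rw [(key ξ hξ x hx).2.2 h, (key ξ' hξ' x hx').2.2 h]
      exact .refl _ _
    · obtain ⟨ψ, hψ, k1, k2⟩ := (key ξ hξ x hx).2.1 h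
      obtain ⟨ψ', hψ', k1', k2'⟩ := (key ξ' hξ' x hx').2.1 h
      exact (k2.symm k1).trans ((GermRel.of_compat hψ hψ' k1 k1').trans k2')
  have hL : ∀ x ∈ X₁.dom, x < m → ∃ ψ ∈ X₁.charts, x ∈ ψ.source ∧
      ψ.restrOpen (Iio m) isOpen_Iio ∈ S ∧ x ∈ (ψ.restrOpen (Iio m) isOpen_Iio).source := by
    rintro x ⟨ψ, hψ, hx⟩ hxm
    exact ⟨ψ, hψ, hx, Or.inl ⟨ψ, hψ, rfl⟩,
      by rw [OpenPartialHomeomorph.restrOpen_source]; exact ⟨hx, hxm⟩⟩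
  have hR : ∀ x ∈ X₂.dom, m < x → ∃ ψ ∈ X₂.charts, x ∈ ψ.source ∧
      ψ.restrOpen (Ioi m) isOpen_Ioi ∈ S ∧ x ∈ (ψ.restrOpen (Ioi m) isOpen_Ioi).source := by
    rintro x ⟨ψ, hψ, hx⟩ hxm
    exact ⟨ψ, hψ, hx, Or.inr (Or.inl ⟨ψ, hψ, rfl⟩),
      by rw [OpenPartialHomeomorph.restrOpen_source]; exact ⟨hx, hxm⟩⟩
  have hχS : χ ∈ S := Or.inr (Or.inr rfl)
  have hdom : A.dom = (X₁.dom ∩ Iic m) ∪ (X₂.dom ∩ Ici m) := by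
    ext x
    constructor
    · rintro ⟨ξ, hξ, hx⟩
      rcases lt_trichotomy x m with h | h | h
      · obtain ⟨ψ, hψ, k1, k2⟩ := (key ξ hξ x hx).1 h
        exact Or.inl ⟨⟨ψ, hψ, k1⟩, h.le⟩
      · exact Or.inl ⟨h ▸ ⟨ψ₁, hψ₁, hm₁⟩, h.le⟩
      · obtain ⟨ψ, hψ, k1, k2⟩ := (key ξ hξ x hx).2.1 h
        exact Or.inr ⟨⟨ψ, hψ, k1⟩, h.le⟩
    · have hc : ∀ x, x = m → x ∈ A.dom := fun x hx => hx ▸ ⟨χ, hχS, c1⟩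
      rintro (⟨h1, h2⟩ | ⟨h1, h2⟩)
      · rcases (show x ≤ m from h2).eq_or_lt with h | h
        · exact hc x h
        · obtain ⟨ψ, -, -, h3, h4⟩ := hL x h1 h
          exact ⟨_, h3, h4⟩
      · rcases (show m ≤ x from h2).eq_or_lt with h | h
        · exact hc x h.symm
        · obtain ⟨ψ, -, -, h3, h4⟩ := hR x h1 h
          exact ⟨_, h3, h4⟩
  refine ⟨⟨A, ?_, ?_⟩, hdom, ?_, ?_, ?_⟩
  · intro ξ hξ x hx
    rcases lt_trichotomy x m with h | rfl | h
    · obtain ⟨ψ, hψ, k1, g, hg, k2, k3⟩ := (key ξ hξ x hx).1 h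
      exact (X₁.pos ψ hψ x k1).of_germ k1 hg k2 k3
    · rw [(key ξ hξ x hx).2.2 rfl]; exact c5
    · obtain ⟨ψ, hψ, k1, g, hg, k2, k3⟩ := (key ξ hξ x hx).2.1 h
      exact (X₂.pos ψ hψ x k1).of_germ k1 hg k2 k3
  · rw [hdom]
    have d1 := X₁.ordConnected
    have d2 := X₂.ordConnected
    have e1 : m ∈ X₁.dom := ⟨ψ₁, hψ₁, hm₁⟩
    have e2 : m ∈ X₂.dom := ⟨ψ₂, hψ₂, hm₂⟩
    refine ⟨?_⟩
    rintro x hx y hy z ⟨hz1, hz2⟩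
    rcases le_total z m with hz | hz
    · refine Or.inl ⟨?_, hz⟩
      rcases hx with hx | hx
      · exact d1.out hx.1 e1 ⟨hz1, hz⟩
      · rw [le_antisymm hz (hx.2.trans hz1)]; exact e1
    · refine Or.inr ⟨?_, hz⟩
      rcases hy with hy | hy
      · rw [le_antisymm (hz2.trans hy.2) hz]; exact e2
      · exact d2.out e2 hy.1 ⟨hz, hz2⟩
  · intro x hx hxm
    obtain ⟨ψ, hψ, h1, h2, h3⟩ := hL x hx hxm
    exact GermRel.germ_id (ψ := ψ) (ψ' := ψ.restrOpen (Iio m) isOpen_Iio)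
      (.of_eventuallyEq (Eventually.of_forall fun _ => rfl)) hψ h2 h1 h3
  · intro x hx hxm
    obtain ⟨ψ, hψ, h1, h2, h3⟩ := hR x hx hxm
    exact GermRel.germ_id (ψ := ψ) (ψ' := ψ.restrOpen (Ioi m) isOpen_Ioi)
      (.of_eventuallyEq (Eventually.of_forall fun _ => rfl)) hψ h2 h1 h3
  · exact ⟨χ, hχS, c1, by rw [c3 m le_rfl]; exact ho₁⟩

/-- The `G`-interval transported by an increasing homeomorphism. -/
def GInt.map [OrderTopology Z] [OrderTopology Z'] [ClosedUnderRestriction G] [Oriented G]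
    (X : GInt G Z) (κ : Z ≃o Z') : GInt G Z' :=
  X.comap κ.symm.toHomeomorph.toOpenPartialHomeomorph
    (fun _ _ => ⟨univ, univ_mem, κ.symm.strictMono.strictMonoOn _⟩) <| by
      have : (κ.symm.toHomeomorph.toOpenPartialHomeomorph.source ∩
          κ.symm.toHomeomorph.toOpenPartialHomeomorph ⁻¹' X.dom) = κ.symm ⁻¹' X.dom := by
        ext; simp
      rw [this]
      exact X.ordConnected.preimage_mono κ.symm.monotone

variable [OrderTopology Z] [OrderTopology Z'] [ClosedUnderRestriction G] [Oriented G]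

theorem GInt.dom_map (X : GInt G Z) (κ : Z ≃o Z') : (X.map κ).dom = κ.symm ⁻¹' X.dom := by
  refine (GAtlas.dom_comap _ _).trans ?_
  ext; simp

theorem GInt.germ_map_symm (X : GInt G Z) (κ : Z ≃o Z') {x : Z'} (hx : κ.symm x ∈ X.dom) :
    (X.map κ).Germ X.toGAtlas κ.symm x :=
  GAtlas.germ_comap X.toGAtlas (e := κ.symm.toHomeomorph.toOpenPartialHomeomorph) (by simp) hx

theorem GInt.germ_map (X : GInt G Z) (κ : Z ≃o Z') {x : Z} (hx : x ∈ X.dom) :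
    X.Germ (X.map κ).toGAtlas κ x := by
  have h := GAtlas.germ_comap X.toGAtlas (e := κ.symm.toHomeomorph.toOpenPartialHomeomorph)
    (x := κ x) (by simp) (by simpa using hx)
  have := h.symm (by simp)
  have e1 : κ.symm.toHomeomorph.toOpenPartialHomeomorph (κ x) = x := by simp
  rw [e1] at this
  exact this

theorem GInt.orb_map (X : GInt G Z) (κ : Z ≃o Z') (x : Z) : (X.map κ).orb (κ x) = X.orb x := by
  by_cases hx : x ∈ X.dom
  · exact (X.germ_map κ hx).orb_eq
  · have hx' : κ x ∉ (X.map κ).dom := by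
      rw [GInt.dom_map]; simpa using hx
    rw [GAtlas.mem_dom_iff, not_nonempty_iff_eq_empty] at hx hx'
    rw [hx, hx']

end

/-- The increasing homeomorphisms of `[0,1]` are transitive on its interior. -/
theorem exists_orderIso {a b : I} (ha : 0 < a) (ha' : a < 1) (hb : 0 < b) (hb' : b < 1) :
    ∃ κ : I ≃o I, κ a = b := by
  have a0 : (0 : ℝ) < a := ha
  have a1 : (a : ℝ) < 1 := ha'
  have b0 : (0 : ℝ) < b := hb
  have b1 : (b : ℝ) < 1 := hb'
  -- the power function with the right exponent
  set k : ℝ := Real.log b / Real.log a with hk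
  have hk0 : 0 < k := div_pos_of_neg_of_neg (Real.log_neg b0 b1) (Real.log_neg a0 a1)
  have hmem : ∀ (r : ℝ), 0 < r → ∀ x : I, (x : ℝ) ^ r ∈ I := fun r hr x =>
    ⟨Real.rpow_nonneg x.2.1 r, Real.rpow_le_one x.2.1 x.2.2 hr.le⟩
  let F : I → I := fun x => ⟨(x : ℝ) ^ k, hmem k hk0 x⟩
  have hF : StrictMono F := fun x y hxy => Real.rpow_lt_rpow x.2.1 hxy hk0
  have hs : Function.Surjective F := by
    intro y
    refine ⟨⟨(y : ℝ) ^ k⁻¹, hmem _ (inv_pos.2 hk0) y⟩, Subtype.ext ?_⟩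
    exact Real.rpow_inv_rpow y.2.1 hk0.ne'
  refine ⟨hF.orderIsoOfSurjective F hs, Subtype.ext ?_⟩
  change (a : ℝ) ^ k = b
  rw [Real.rpow_def_of_pos a0, hk, mul_div_cancel₀ _ (Real.log_neg a0 a1).ne, Real.exp_log b0]

section

variable {T : Type*} [TopologicalSpace T] [ChartedSpace I T] {G : StructureGroupoid T}

/-! ### The positive order between orbits -/

/-- Some `G`-interval runs positively from the orbit of `s` to the orbit of `t`. -/
def Prec (G : StructureGroupoid T) (s t : T) : Prop :=
  ∃ X : GInt G I, ∃ x y, x < y ∧ s ∈ X.orb x ∧ t ∈ X.orb y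

theorem Prec.of_mem_orbit {s s' t t' : T} (h : Prec G s t) (hs : s' ∈ orbit G s)
    (ht : t' ∈ orbit G t) : Prec G s' t' := by
  obtain ⟨X, x, y, hxy, h1, h2⟩ := h
  refine ⟨X, x, y, hxy, ?_, ?_⟩
  · rw [GAtlas.orb_eq_of_mem h1]; exact hs
  · rw [GAtlas.orb_eq_of_mem h2]; exact ht

/-- An orbit represented by a positive point is never represented by `0`, since an increasing germ at a
positive point also takes smaller values. -/
theorem GInt.pos_of_orb [Oriented G] {X Y : GInt G I} {x y : I} {t : T} (hx : t ∈ X.orb x)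
    (hy : t ∈ Y.orb y) (h : 0 < x) : 0 < y := by
  obtain ⟨e, he, rfl, hG⟩ := GAtlas.exists_germ_of_orb_eq hx hy
  obtain ⟨z, hz⟩ := (GAtlas.Germ.locMono (hG x he)).exists_lt ⟨0, h⟩
  exact (unitInterval.nonneg' (t := z)).trans_lt hz

theorem GInt.lt_one_of_orb [Oriented G] {X Y : GInt G I} {x y : I} {t : T} (hx : t ∈ X.orb x)
    (hy : t ∈ Y.orb y) (h : x < 1) : y < 1 := by
  obtain ⟨e, he, rfl, hG⟩ := GAtlas.exists_germ_of_orb_eq hx hy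
  obtain ⟨z, hz⟩ := (GAtlas.Germ.locMono (hG x he)).exists_gt ⟨1, h⟩
  exact hz.trans_le (unitInterval.le_one' (t := z))

theorem GInt.exists_orderIso_of_orb [Oriented G] {X Y : GInt G I} {x y : I} {t : T}
    (hx : t ∈ X.orb x) (hy : t ∈ Y.orb y) (h0 : 0 < x) (h1 : x < 1) : ∃ κ : I ≃o I, κ y = x :=
  exists_orderIso (GInt.pos_of_orb hx hy h0) (GInt.lt_one_of_orb hx hy h1) h0 h1

/-- `G`-interval version of essential orbits: the orbit of `t` lies neither on a closed `G`-curve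
nor on a compact `G`-interval (whose endpoints `0` and `1` represent boundary points). -/
def Ess (G : StructureGroupoid T) (t : T) : Prop :=
  ¬ Prec G t t ∧ ∀ X : GInt G I, X.dom = univ → ∀ x, t ∉ X.orb x

theorem Ess.of_mem_orbit {s t : T} (h : Ess G t) (hs : s ∈ orbit G t) : Ess G s := by
  refine ⟨fun h' => h.1 (h'.of_mem_orbit (mem_orbit_symm hs) (mem_orbit_symm hs)), ?_⟩
  intro X hX x hx
  refine h.2 X hX x ?_
  rw [GAtlas.orb_eq_of_mem hx]
  exact mem_orbit_symm hs

theorem isSaturated_ess : IsSaturated G {t | Ess G t} := fun _ ht _ hs => Ess.of_mem_orbit ht hs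

/-- Being inessential is an open condition: an orbit that comes back to a `G`-interval further to the
right does so together with the nearby orbits, by continuity of the return map, and the orbits that
meet a given `G`-interval form an open set. -/
theorem isOpen_compl_ess : IsOpen {t : T | Ess G t}ᶜ := by
  have key : {t : T | Ess G t}ᶜ = ⋃ X : GInt G I,
      (X.sat {x | ∃ y, x < y ∧ X.orb x = X.orb y ∧ x ∈ X.dom} ∪ X.sat {_x | X.dom = univ}) := by
    ext t
    simp only [mem_compl_iff, mem_ofPred_eq, mem_iUnion, mem_union, GAtlas.sat]
    constructor
    · intro h
      by_cases h' : Prec G t t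
      · obtain ⟨X, x, y, hxy, h1, h2⟩ := h'
        exact ⟨X, Or.inl ⟨x, ⟨y, hxy, GAtlas.orb_eq_orb_of_mem h1 h2,
          GAtlas.mem_dom_iff.2 ⟨_, h1⟩⟩, h1⟩⟩
      · have : ¬ ∀ X : GInt G I, X.dom = univ → ∀ x, t ∉ X.orb x := fun h'' => h ⟨h', h''⟩
        push Not at this
        obtain ⟨X, hX, x, hx⟩ := this
        exact ⟨X, Or.inr ⟨x, hX, hx⟩⟩
    · rintro ⟨X, ⟨x, ⟨y, hxy, h1, -⟩, h2⟩ | ⟨x, hX, hx⟩⟩ h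
      · exact h.1 ⟨X, x, y, hxy, h2, h1 ▸ h2⟩
      · exact h.2 X hX x hx
  rw [key]
  refine isOpen_iUnion fun X => (GAtlas.isOpen_sat _ ?_).union (GAtlas.isOpen_sat _ ?_)
  · rw [isOpen_iff_mem_nhds]
    rintro x ⟨y, hxy, h1, h2⟩
    obtain ⟨t, ht⟩ := GAtlas.mem_dom_iff.1 h2
    obtain ⟨e, he, hey, hG⟩ := GAtlas.exists_germ_of_orb_eq ht (h1 ▸ ht)
    have hlt : ∀ᶠ z in 𝓝 x, z < e z :=
      continuousAt_id.eventually_lt (e.continuousAt he) (by rw [hey]; exact hxy)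
    filter_upwards [hlt, e.open_source.mem_nhds he] with z hz hz'
    exact ⟨e z, hz, (hG z hz').orb_eq.symm, (hG z hz').mem_dom⟩
  · by_cases hX : X.dom = univ <;> simp [hX]

/-- `s` and `t` lie on the same orbit, or `s` precedes `t`. -/
def WeakPrec (G : StructureGroupoid T) (s t : T) : Prop := t ∈ orbit G s ∨ Prec G s t

theorem WeakPrec.refl (t : T) : WeakPrec G t t := Or.inl (mem_orbit_self t)

variable [ClosedUnderRestriction G]

/-- The preferred chart at `z` gives a `G`-interval that meets all the orbits close to `z`. -/
theorem exists_gint_chartAt (z : T) : ∃ X : GInt G I, ∀ᶠ y in 𝓝 z,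
    y ∈ X.orb (chartAt I z y) := by
  obtain ⟨X, ψ, h1, h2, h3, h4, h5⟩ := exists_gint_of_chart (G := G) (chart_mem_atlas I z)
    (mem_chart_source I z) univ_mem
  refine ⟨X, ?_⟩
  filter_upwards [(chartAt I z).open_source.mem_nhds (mem_chart_source I z),
    ((chartAt I z).continuousAt (mem_chart_source I z)).preimage_mem_nhds
      (ψ.open_source.mem_nhds h2)] with y hy hy'
  refine ⟨ψ, by simp [h1], hy', ?_⟩
  rw [h5, (chartAt I z).left_inv hy]
  exact mem_orbit_self _

theorem PositiveArc.prec_of_near (a : PositiveArc T) (s : I) :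
    ∃ u ∈ 𝓝 s, ∀ x ∈ u, ∀ y ∈ u, x < y → Prec G (a.toFun x) (a.toFun y) := by
  obtain ⟨u, hu, hm⟩ := a.increasing s
  obtain ⟨X, hX⟩ := exists_gint_chartAt (G := G) (a.toFun s)
  refine ⟨_, inter_mem hu (a.isEmbedding.continuous.continuousAt.preimage_mem_nhds hX), ?_⟩
  intro x hx y hy hxy
  exact ⟨X, _, _, hm hx.1 hy.1 hxy, hx.2, hy.2⟩

variable [Oriented G]

/-- A `G`-interval that ends on an orbit can be continued by one that starts on this orbit: the point
where they are glued is interior to both. -/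
theorem Prec.exists_between {r s t : T} (h : Prec G r s) (h' : Prec G s t) :
    ∃ X : GInt G I, ∃ x y z, x < y ∧ y < z ∧ r ∈ X.orb x ∧ s ∈ X.orb y ∧ t ∈ X.orb z := by
  obtain ⟨X, x, y, hxy, h1, h2⟩ := h
  obtain ⟨X', y', z, hyz, h3, h4⟩ := h'
  have hy0 : 0 < y := (unitInterval.nonneg' (t := x)).trans_lt hxy
  have hy1 : y < 1 := GInt.lt_one_of_orb h3 h2 (hyz.trans_le (unitInterval.le_one' (t := z)))
  obtain ⟨κ, hκ⟩ := GInt.exists_orderIso_of_orb h2 h3 hy0 hy1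
  obtain ⟨Y, -, hL, hR, hm⟩ := exists_glue X (X'.map κ) h2 (by rw [← hκ, GInt.orb_map]; exact h3)
  have hyz' : y < κ z := by rw [← hκ]; exact κ.strictMono hyz
  refine ⟨Y, x, y, κ z, hxy, hyz', ?_, hm, ?_⟩
  · have := (hL x (GAtlas.mem_dom_iff.2 ⟨_, h1⟩) hxy).orb_eq
    rw [id] at this
    rwa [this]
  · have hz : t ∈ (X'.map κ).orb (κ z) := by rwa [GInt.orb_map]
    have := (hR (κ z) (GAtlas.mem_dom_iff.2 ⟨_, hz⟩) hyz').orb_eq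
    rw [id] at this
    rwa [this]

theorem Prec.trans {r s t : T} (h : Prec G r s) (h' : Prec G s t) : Prec G r t := by
  obtain ⟨X, x, y, z, h1, h2, h3, -, h4⟩ := h.exists_between h'
  exact ⟨X, x, z, h1.trans h2, h3, h4⟩

/-- An essential orbit cuts a `G`-interval: no orbit can be met on both sides of it. -/
theorem Ess.not_prec_of_between {X : GInt G I} {x y z : I}
    {s t : T} (ht : Ess G t) (hy : t ∈ X.orb y) (hx : s ∈ X.orb x) (hz : s ∈ X.orb z)
    (hxy : x ≤ y) (hyz : y ≤ z) (hxz : x < z) : False := by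
  rcases hxy.eq_or_lt with rfl | hxy
  · have : t ∈ X.orb z := by
      rw [GAtlas.orb_eq_of_mem hz, ← GAtlas.orb_eq_of_mem hx]; exact hy
    exact ht.1 ⟨X, x, z, hxz, hy, this⟩
  · rcases hyz.eq_or_lt with rfl | hyz
    · have : t ∈ X.orb x := by
        rw [GAtlas.orb_eq_of_mem hx, ← GAtlas.orb_eq_of_mem hz]; exact hy
      exact ht.1 ⟨X, x, y, hxz, this, hy⟩
    · exact ht.1 (Prec.trans ⟨X, y, z, hyz, hy, hz⟩ ⟨X, x, y, hxy, hx, hy⟩)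

/-! ### Positive chains -/

/-- A positive arc is an increasing path, for the order between orbits. This holds locally by
`PositiveArc.prec_of_near`, and the set `B` of the points up to which it holds is seen to contain its
supremum and to extend beyond it. -/
theorem PositiveArc.prec (a : PositiveArc T) {s s' : I} (h : s < s') :
    Prec G (a.toFun s) (a.toFun s') := by
  let B : Set I := {x | s ≤ x ∧ x ≤ s' ∧ ∀ y, s ≤ y → y ≤ x → s < y → Prec G (a.toFun s) (a.toFun y)}
  have hsB : s ∈ B := ⟨le_rfl, h.le, fun y h1 h2 h3 => absurd h3 (not_lt.2 h2)⟩
  obtain ⟨z, hz⟩ : ∃ z, IsLUB B z := by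
    obtain ⟨z, hz⟩ := (isClosed_closure (s := B)).isCompact.exists_isLUB ⟨s, subset_closure hsB⟩
    exact ⟨z, (isLUB_congr (upperBounds_closure B)).1 hz.2⟩
  obtain ⟨u, hu, hP⟩ := a.prec_of_near (G := G) z
  have hsz : s ≤ z := hz.1 hsB
  have hzs : z ≤ s' := hz.2 fun x hx => hx.2.1
  -- every point beyond `s` and near `z` comes after `s`
  obtain ⟨v, hv1, hv2, hv3, hv4⟩ := exists_ordConnected_nhds hu
  have hclaim : ∀ y ∈ v, s < y → Prec G (a.toFun s) (a.toFun y) := by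
    intro y hy hsy
    by_cases hb : ∃ b ∈ B, s < b ∧ b ∈ v
    · obtain ⟨b, hb, hsb, hbv⟩ := hb
      have h1 := hb.2.2 b hb.1 le_rfl hsb
      rcases lt_trichotomy y b with h2 | rfl | h2
      · exact hb.2.2 y hsy.le h2.le hsy
      · exact h1
      · exact h1.trans (hP b (hv4 hbv) y (hv4 hy) h2)
    · push Not at hb
      have hzs : z = s := by
        by_contra hne
        have hlt : s < z := lt_of_le_of_ne hsz (Ne.symm hne)
        obtain ⟨b, hbz, hbs⟩ : ∃ b ∈ v, b < z ∧ s < b := by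
          have := nhdsLT_neBot_of_exists_lt ⟨s, hlt⟩
          obtain ⟨b, hb1, hb2, hb3⟩ := Filter.nonempty_of_mem (inter_mem
            (mem_nhdsWithin_of_mem_nhds (hv1.mem_nhds hv3)) (Ioo_mem_nhdsLT hlt))
          exact ⟨b, hb1, hb3, hb2⟩
        obtain ⟨c, hcB, hbc⟩ := (lt_isLUB_iff hz).1 hbs.1
        exact hb c hcB (hbs.2.trans hbc) (hv2.out hbz hv3 ⟨hbc.le, hz.1 hcB⟩)
      subst hzs
      exact hP z (hv4 hv3) y (hv4 hy) hsy
  have hB : ∀ y ∈ v, y ≤ s' → z ≤ y → y ∈ B := by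
    intro y hy hys hzy
    refine ⟨hsz.trans hzy, hys, fun w hw1 hw2 hw3 => ?_⟩
    by_cases hwz : w < z
    · obtain ⟨c, hcB, hwc⟩ := (lt_isLUB_iff hz).1 hwz
      exact hcB.2.2 w hw1 hwc.le hw3
    · exact hclaim w (hv2.out hv3 hy ⟨not_lt.1 hwz, hw2⟩) hw3
  rcases hzs.eq_or_lt with rfl | hlt
  · exact (hB z hv3 le_rfl le_rfl).2.2 z h.le le_rfl h
  · exfalso
    have := nhdsGT_neBot_of_exists_gt ⟨s', hlt⟩
    obtain ⟨b, hb1, hb2, hb3⟩ := Filter.nonempty_of_mem (inter_mem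
      (mem_nhdsWithin_of_mem_nhds (hv1.mem_nhds hv3)) (Ioo_mem_nhdsGT hlt))
    exact absurd (hz.1 (hB b hb1 hb3.le hb2.le)) (not_le.2 hb2)

theorem WeakPrec.trans_prec {r s t : T} (h : WeakPrec G r s) (h' : Prec G s t) : Prec G r t :=
  h.elim (fun h => h'.of_mem_orbit (mem_orbit_symm h) (mem_orbit_self t)) fun h => h.trans h'

theorem Prec.trans_weakPrec {r s t : T} (h : Prec G r s) (h' : WeakPrec G s t) : Prec G r t :=
  h'.elim (fun h' => h.of_mem_orbit (mem_orbit_self r) h') fun h' => h.trans h'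

theorem WeakPrec.trans {r s t : T} (h : WeakPrec G r s) (h' : WeakPrec G s t) : WeakPrec G r t :=
  h'.elim (fun h' => h.elim (fun h => Or.inl (mem_orbit_trans h' h))
    fun h => Or.inr (h.trans_weakPrec (Or.inl h'))) fun h' => Or.inr (h.trans_prec h')

theorem PositiveArc.weakPrec (a : PositiveArc T) {s s' : I} (h : s ≤ s') :
    WeakPrec G (a.toFun s) (a.toFun s') :=
  h.eq_or_lt.elim (fun h => h ▸ .refl _) fun h => Or.inr (a.prec h)

/-- The origins, and the extremities, of the arcs of a positive chain are in increasing order. -/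
theorem PositiveChain.weakPrec (γ : PositiveChain G) {i j : ℕ} (hij : i ≤ j) (hj : j < γ.n + 1) :
    WeakPrec G ((γ.arc ⟨i, hij.trans_lt hj⟩).toFun 0) ((γ.arc ⟨j, hj⟩).toFun 0) ∧
      WeakPrec G ((γ.arc ⟨i, hij.trans_lt hj⟩).toFun 1) ((γ.arc ⟨j, hj⟩).toFun 1) := by
  induction j, hij using Nat.le_induction with
  | base => exact ⟨.refl _, .refl _⟩
  | succ j hij ih =>
    obtain ⟨h1, h2⟩ := ih (by omega)
    have hc : WeakPrec G ((γ.arc ⟨j, by omega⟩).toFun 1) ((γ.arc ⟨j + 1, hj⟩).toFun 0) :=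
      Or.inl (γ.chain ⟨j, by omega⟩)
    exact ⟨h1.trans (((γ.arc _).weakPrec zero_le_one).trans hc),
      h2.trans (hc.trans ((γ.arc _).weakPrec zero_le_one))⟩

/-- A boundary point of `T` is represented by an endpoint of `[0,1]` in every `G`-interval. -/
theorem eq_zero_or_one_of_boundary {p : T} (hp : p ∈ boundary T) {X : GInt G I} {x : I}
    (hx : p ∈ X.orb x) : x = 0 ∨ x = 1 := by
  obtain ⟨Y, hY⟩ := exists_gint_chartAt (G := G) p
  have hp' := hY.self_of_nhds
  by_contra h
  push Not at h
  have h0 := GInt.pos_of_orb hx hp' (unitInterval.pos_iff_ne_zero.2 h.1)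
  have h1 := GInt.lt_one_of_orb hx hp' (unitInterval.lt_one_iff_ne_one.2 h.2)
  rcases hp with hp | hp
  · exact h0.ne' hp
  · exact h1.ne hp

/-- An orbit that lies neither on a closed `G`-curve nor on a compact `G`-interval is essential. -/
theorem Ess.isEssential {t : T} (ht : Ess G t) : IsEssential G t := by
  intro γ hγ
  rw [Set.disjoint_left]
  intro y hy hyγ
  have hEy := ht.of_mem_orbit hy
  obtain ⟨i, s, rfl⟩ := mem_iUnion.1 hyγ
  set y := (γ.arc i).toFun s
  have h1 : WeakPrec G γ.origin ((γ.arc i).toFun 0) := (γ.weakPrec (Nat.zero_le i) i.2).1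
  have h2 : WeakPrec G ((γ.arc i).toFun 1) γ.extremity :=
    (γ.weakPrec (Nat.lt_succ_iff.1 i.2) (Nat.lt_succ_self _)).2
  have h3 : WeakPrec G γ.origin y := h1.trans ((γ.arc i).weakPrec s.2.1)
  have h4 : WeakPrec G y γ.extremity := ((γ.arc i).weakPrec s.2.2).trans h2
  have h5 : Prec G γ.origin y ∨ Prec G y γ.extremity := by
    rcases (unitInterval.nonneg' (t := s)).eq_or_lt with hs | hs
    · refine Or.inr (((γ.arc i).prec ?_).trans_weakPrec h2)
      rw [← hs]; exact zero_lt_one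
    · exact Or.inl (h1.trans_prec ((γ.arc i).prec hs))
  rcases hγ with hl | ⟨ho, he⟩
  · have hl' : WeakPrec G γ.extremity γ.origin := Or.inl hl
    rcases h5 with h5 | h5
    · exact hEy.1 ((h4.trans hl').trans_prec h5)
    · exact hEy.1 (h5.trans_weakPrec (hl'.trans h3))
  · -- the endpoints of a `G`-interval that joins boundary points are `0` and `1`
    have hend : ∀ (X : GInt G I) (x z : I), x < z → γ.origin ∈ X.orb x → γ.extremity ∈ X.orb z →
        X.dom = univ := by
      intro X x z hxz hx hz
      have hx0 : x = 0 := (eq_zero_or_one_of_boundary ho hx).resolve_right fun h =>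
        absurd (hxz.trans_le (unitInterval.le_one' (t := z))) (by simp [h])
      have hz1 : z = 1 := (eq_zero_or_one_of_boundary he hz).resolve_left fun h =>
        absurd ((unitInterval.nonneg' (t := x)).trans_lt hxz) (by simp [h])
      subst hx0 hz1
      refine eq_univ_of_forall fun w => X.ordConnected.out (GAtlas.mem_dom_iff.2 ⟨_, hx⟩)
        (GAtlas.mem_dom_iff.2 ⟨_, hz⟩) ⟨unitInterval.nonneg' (t := w), unitInterval.le_one' (t := w)⟩
    rcases h3 with h3 | h3
    · rcases h5 with h5 | h5
      · exact hEy.1 (h5.of_mem_orbit h3 (mem_orbit_self y))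
      · obtain ⟨X, x, z, hxz, hx, hz⟩ := h5
        refine hEy.2 X (hend X x z hxz ?_ hz) x hx
        rw [GAtlas.orb_eq_of_mem hx]; exact mem_orbit_symm h3
    · rcases h4 with h4 | h4
      · obtain ⟨X, x, z, hxz, hx, hz⟩ := h3
        refine hEy.2 X (hend X x z hxz hx ?_) z hz
        rw [GAtlas.orb_eq_of_mem hz]; exact h4
      · obtain ⟨X, x, w, z, hxw, hwz, hx, hw, hz⟩ := h3.exists_between h4
        exact hEy.2 X (hend X x z (hxw.trans hwz) hx hz) w hw

end

/-! ### Closed curves through the other orbits -/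

/-- Charts read through two local sections of a covering differ by an element of `G` as soon as the
sections differ by a map whose germ belongs to `G`. -/
theorem GermRel.of_sections {T : Type*} [TopologicalSpace T] {G : StructureGroupoid T}
    {X Y : Type*} [TopologicalSpace X] [TopologicalSpace Y]
    {A : GAtlas G Y} {q q' : OpenPartialHomeomorph X Y} {ψ ψ' : OpenPartialHomeomorph Y T}
    (hψ : ψ ∈ A.charts) (hψ' : ψ' ∈ A.charts) {x : X} (hx : x ∈ (q ≫ₕ ψ).source)
    (hx' : x ∈ (q' ≫ₕ ψ').source) {h : Y → Y} (hG : A.Germ A h (q x))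
    (hq : ∀ᶠ y in 𝓝 x, q' y = h (q y)) : GermRel G (q ≫ₕ ψ) (q' ≫ₕ ψ') x := by
  simp only [OpenPartialHomeomorph.trans_source, mem_inter_iff, mem_preimage] at hx hx'
  have hhx : h (q x) ∈ ψ'.source := by rw [← hq.self_of_nhds]; exact hx'.2
  obtain ⟨g, hg, h1, h2⟩ := hG.in_charts hψ hx.2 hψ' hhx
  refine ⟨g, hg, h1, ?_⟩
  filter_upwards [(q.continuousAt hx.1).eventually h2, hq] with y hy hy'
  simp [hy.2, hy']

section

variable {T : Type*} [TopologicalSpace T] [ChartedSpace I T] {G : StructureGroupoid T}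

/-- A compact connected one-manifold, circle or interval, modelled on `G` and all of whose points
lie on inessential orbits. -/
structure GCurve (G : StructureGroupoid T) where
  carrier : Type
  [top : TopologicalSpace carrier]
  chart : GAtlas G carrier
  dom_eq : chart.dom = univ
  shape : Nonempty (carrier ≃ₜ Circle) ∨ Nonempty (carrier ≃ₜ I)
  not_ess : ∀ x, ∀ t ∈ chart.orb x, ¬ Ess G t

attribute [instance] GCurve.top

/-- The inclusion of the open unit interval, from `ℝ` to `[0,1]`. -/
noncomputable def realToUnit : OpenPartialHomeomorph ℝ I where
  toFun := projIcc 0 1 zero_le_one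
  invFun := Subtype.val
  source := Ioo 0 1
  target := Ioo 0 1
  map_source' x hx := by
    rw [projIcc_of_mem zero_le_one ⟨hx.1.le, hx.2.le⟩]
    exact ⟨hx.1, hx.2⟩
  map_target' x hx := ⟨hx.1, hx.2⟩
  left_inv' x hx := by rw [projIcc_of_mem zero_le_one ⟨hx.1.le, hx.2.le⟩]
  right_inv' x _ := projIcc_val zero_le_one x
  open_source := isOpen_Ioo
  open_target := isOpen_Ioo
  continuousOn_toFun := continuous_projIcc.continuousOn
  continuousOn_invFun := continuous_subtype_val.continuousOn

theorem realToUnit_val (x : I) : realToUnit x = x := projIcc_val zero_le_one x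

theorem strictMonoOn_realToUnit : StrictMonoOn realToUnit (Ioo 0 1) := fun x hx y hy hxy => by
  change projIcc 0 1 zero_le_one x < projIcc 0 1 zero_le_one y
  rw [projIcc_of_mem zero_le_one ⟨hx.1.le, hx.2.le⟩, projIcc_of_mem zero_le_one ⟨hy.1.le, hy.2.le⟩]
  exact hxy

variable [ClosedUnderRestriction G] [Oriented G]

/-- The interior of a `G`-interval, as a `G`-interval in `ℝ`. -/
noncomputable def GInt.toReal (X : GInt G I) : GInt G ℝ :=
  X.comap realToUnit (fun _ hx => ⟨_, isOpen_Ioo.mem_nhds hx, strictMonoOn_realToUnit⟩) <| by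
    refine ⟨fun x hx y hy z hz => ?_⟩
    have hz' : z ∈ Ioo (0 : ℝ) 1 := ⟨hx.1.1.trans_le hz.1, hz.2.trans_lt hy.1.2⟩
    exact ⟨hz', X.ordConnected.out hx.2 hy.2
      ⟨strictMonoOn_realToUnit.monotoneOn hx.1 hz' hz.1,
        strictMonoOn_realToUnit.monotoneOn hz' hy.1 hz.2⟩⟩

theorem GInt.germ_toReal (X : GInt G I) {x : ℝ} (hx : x ∈ Ioo (0 : ℝ) 1)
    (hx' : realToUnit x ∈ X.dom) : X.toReal.Germ X.toGAtlas realToUnit x :=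
  GAtlas.germ_comap X.toGAtlas (e := realToUnit) hx hx'

/-- If the orbit of `t` precedes itself, a `G`-interval joins it to itself. Gluing the ends of this
interval gives a circle, and all the orbits met by the circle precede themselves. -/
theorem exists_gcurve_of_prec {t : T} (h : Prec G t t) :
    ∃ B : GCurve G, ∃ x, t ∈ B.chart.orb x := by
  obtain ⟨X, x, y, hxy, hx, hy⟩ := h
  have hx0 : 0 < x := GInt.pos_of_orb hy hx (unitInterval.nonneg'.trans_lt hxy)
  have hy1 : y < 1 := GInt.lt_one_of_orb hx hy (hxy.trans_le unitInterval.le_one')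
  -- cut `X` along the orbit of `t`, and glue the two ends
  set r := (x : ℝ) with hr
  set s := (y : ℝ) with hs
  have hrs : r < s := hxy
  have hI : ∀ z ∈ Icc r s, z ∈ Ioo (0 : ℝ) 1 := fun z hz =>
    ⟨lt_of_lt_of_le hx0 hz.1, lt_of_le_of_lt hz.2 hy1⟩
  have hr' := hI r ⟨le_rfl, hrs.le⟩
  have hs' := hI s ⟨hrs.le, le_rfl⟩
  set p : ℝ := s - r with hp
  have hp0 : Fact (0 < p) := ⟨sub_pos.2 hrs⟩
  have hp0' : 0 < p := hp0.out
  have hXd : ∀ z ∈ Icc r s, realToUnit z ∈ X.dom := by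
    intro z hz
    refine X.ordConnected.out (GAtlas.mem_dom_iff.2 ⟨t, hx⟩) (GAtlas.mem_dom_iff.2 ⟨t, hy⟩) ⟨?_, ?_⟩
    · have := strictMonoOn_realToUnit.monotoneOn hr' (hI z hz) hz.1
      rwa [hr, realToUnit_val] at this
    · have := strictMonoOn_realToUnit.monotoneOn (hI z hz) hs' hz.2
      rwa [hs, realToUnit_val] at this
  have hXr : ∀ z ∈ Icc r s, X.toReal.Germ X.toGAtlas realToUnit z := fun z hz =>
    X.germ_toReal (hI z hz) (hXd z hz)
  -- splicing `X` on the left of `s` with its translate on the right gives a `G`-interval `Y` around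
  -- `[s - p / 2, s]` on which the translation by `p` belongs to `G` wherever it is defined
  let τ : ℝ ≃o ℝ := OrderIso.addRight p
  have hτ : ∀ z, τ z = z + p := fun z => rfl
  have htr : t ∈ X.toReal.orb r := by
    rw [← (hXr r ⟨le_rfl, hrs.le⟩).orb_eq, hr, realToUnit_val]; exact hx
  have hts : t ∈ X.toReal.orb s := by
    rw [← (hXr s ⟨hrs.le, le_rfl⟩).orb_eq, hs, realToUnit_val]; exact hy
  have hts' : t ∈ (X.toReal.map τ).orb s := by
    have : s = τ r := by rw [hτ]; ring
    rw [this, GInt.orb_map]; exact htr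
  obtain ⟨Y, hYd, hYL, hYR, hYm⟩ := exists_glue X.toReal (X.toReal.map τ) hts hts'
  have hL : ∀ z, r < z → z < s → X.toReal.Germ Y.toGAtlas id z := fun z h1 h2 =>
    hYL z (hXr z ⟨h1.le, h2.le⟩).mem_dom h2
  have hYd' : ∀ z, r < z → z < s → z ∈ Y.dom := fun z h1 h2 => (hL z h1 h2).map_mem_dom
  have hτG : ∀ z, r < z → z < s → Y.Germ Y.toGAtlas (fun w => w + p) z := by
    intro z h1 h2
    have k1 : Y.Germ X.toReal.toGAtlas id z :=
      (hL z h1 h2).symm (e := OpenPartialHomeomorph.refl ℝ) (mem_univ _)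
    have k2 : X.toReal.Germ (X.toReal.map τ).toGAtlas τ z := X.toReal.germ_map τ k1.map_mem_dom
    have k3 : (X.toReal.map τ).Germ Y.toGAtlas id (τ z) :=
      hYR _ k2.map_mem_dom (by rw [hτ]; linarith)
    exact GAtlas.Germ.comp (f' := id) k3 (GAtlas.Germ.comp (f := id) k2 k1)
  -- the circle `ℝ / pℤ` is covered by two arcs: the complements of `s` and of `s - p / 2`
  let Q₁ := AddCircle.openPartialHomeomorphCoe p r
  let Q₂ := AddCircle.openPartialHomeomorphCoe p (s - p / 2)
  have hQ₁ : ∀ z, z ∈ Q₁.source ↔ r < z ∧ z < s := by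
    intro z
    change z ∈ Ioo r (r + p) ↔ _
    rw [show r + p = s by ring]; rfl
  have hQ₂ : ∀ z, z ∈ Q₂.source ↔ s - p / 2 < z ∧ z < s + p / 2 := by
    intro z
    change z ∈ Ioo (s - p / 2) (s - p / 2 + p) ↔ _
    rw [show s - p / 2 + p = s + p / 2 by ring]; rfl
  have hQ₁c : ∀ z : ℝ, Q₁ z = (z : AddCircle p) := fun _ => rfl
  have hQ₂c : ∀ z : ℝ, Q₂ z = (z : AddCircle p) := fun _ => rfl
  have h12 : ∀ ψ ∈ Y.charts, ∀ ψ' ∈ Y.charts, ∀ θ ∈ (Q₁.symm ≫ₕ ψ).source,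
      θ ∈ (Q₂.symm ≫ₕ ψ').source → GermRel G (Q₁.symm ≫ₕ ψ) (Q₂.symm ≫ₕ ψ') θ := by
    intro ψ hψ ψ' hψ' θ hθ hθ'
    have hθ1 : θ ∈ Q₁.target := hθ.1
    have hθ2 : θ ∈ Q₂.target := hθ'.1
    have hz := (hQ₁ _).1 (Q₁.map_target hθ1)
    set z := Q₁.symm θ with hzdef
    have hzθ : (z : AddCircle p) = θ := Q₁.right_inv hθ1
    -- the two sections differ by `0` or by `p`
    have main : ∀ c : ℝ, (c : AddCircle p) = 0 → z + c ∈ Q₂.source →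
        Y.Germ Y.toGAtlas (fun w => w + c) z →
        GermRel G (Q₁.symm ≫ₕ ψ) (Q₂.symm ≫ₕ ψ') θ := by
      intro c hc hzc hG
      refine GermRel.of_sections hψ hψ' hθ hθ' hG ?_
      have hcont : ContinuousAt (fun η => Q₁.symm η + c) θ :=
        (Q₁.symm.continuousAt hθ1).add continuousAt_const
      filter_upwards [Q₁.open_target.mem_nhds hθ1,
        hcont.preimage_mem_nhds (Q₂.open_source.mem_nhds hzc)] with η h1 h2
      have : Q₂ (Q₁.symm η + c) = η := by
        rw [hQ₂c, AddCircle.coe_add, hc, add_zero]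
        exact Q₁.right_inv h1
      have h3 := Q₂.left_inv h2
      simp only [this] at h3
      exact h3
    rcases lt_trichotomy z (s - p / 2) with hlt | heq | hgt
    · refine main p (AddCircle.coe_period p) ((hQ₂ _).2 ⟨?_, ?_⟩) (hτG z hz.1 hz.2)
      · linarith [hz.1]
      · linarith
    · exfalso
      have : θ ∈ ({((s - p / 2 : ℝ) : AddCircle p)} : Set (AddCircle p))ᶜ := hθ2
      exact this (by rw [← heq, hzθ]; rfl)
    · refine main 0 (by simp) ((hQ₂ _).2 ⟨?_, ?_⟩) ?_
      · linarith
      · linarith [hz.2]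
      · exact (GAtlas.germ_id (hYd' z hz.1 hz.2)).congr (Eventually.of_forall fun w => add_zero w)
  have h11 : ∀ (q : OpenPartialHomeomorph (AddCircle p) ℝ), ∀ ψ ∈ Y.charts, ∀ ψ' ∈ Y.charts,
      ∀ θ ∈ (q ≫ₕ ψ).source, θ ∈ (q ≫ₕ ψ').source → GermRel G (q ≫ₕ ψ) (q ≫ₕ ψ') θ := by
    intro q ψ hψ ψ' hψ' θ hθ hθ'
    refine GermRel.of_sections hψ hψ' hθ hθ' (h := id) (GAtlas.germ_id ⟨ψ, hψ, hθ.2⟩) ?_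
    exact Eventually.of_forall fun _ => rfl
  let C : GAtlas G (AddCircle p) :=
    .ofGermRel {χ | ∃ ψ ∈ Y.charts, χ = Q₁.symm ≫ₕ ψ ∨ χ = Q₂.symm ≫ₕ ψ} <| by
      rintro _ ⟨ψ, hψ, rfl | rfl⟩ _ ⟨ψ', hψ', rfl | rfl⟩ θ hθ hθ'
      · exact h11 _ ψ hψ ψ' hψ' θ hθ hθ'
      · exact h12 ψ hψ ψ' hψ' θ hθ hθ'
      · exact (h12 ψ' hψ' ψ hψ θ hθ' hθ).symm hθ'
      · exact h11 _ ψ hψ ψ' hψ' θ hθ hθ'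
  have hC₁ : ∀ z, r < z → z < s → ∀ u ∈ Y.orb z, u ∈ C.orb (z : AddCircle p) := by
    rintro z h1 h2 u ⟨ψ, hψ, h3, h4⟩
    have h5 : z ∈ Q₁.source := (hQ₁ z).2 ⟨h1, h2⟩
    have h6 : Q₁.symm (z : AddCircle p) = z := Q₁.left_inv h5
    exact ⟨_, ⟨ψ, hψ, Or.inl rfl⟩, ⟨Q₁.map_source h5, by
      change Q₁.symm (z : AddCircle p) ∈ ψ.source; rwa [h6]⟩, by simpa [h6] using h4⟩
  have hC₂ : t ∈ C.orb (s : AddCircle p) := by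
    obtain ⟨ψ, hψ, h3, h4⟩ := hYm
    have h5 : s ∈ Q₂.source := (hQ₂ s).2 ⟨by linarith, by linarith⟩
    have h6 : Q₂.symm (s : AddCircle p) = s := Q₂.left_inv h5
    exact ⟨_, ⟨ψ, hψ, Or.inr rfl⟩, ⟨Q₂.map_source h5, by
      change Q₂.symm (s : AddCircle p) ∈ ψ.source; rwa [h6]⟩, by simpa [h6] using h4⟩
  have hcov : ∀ θ : AddCircle p, θ = (s : AddCircle p) ∨ ∃ z, r < z ∧ z < s ∧ θ = z := by
    intro θ
    have : θ ∈ ((↑) : ℝ → AddCircle p) '' Ico r (r + p) := by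
      rw [AddCircle.coe_image_Ico_eq]; trivial
    obtain ⟨z, ⟨hz1, hz2⟩, rfl⟩ := this
    rw [show r + p = s by ring] at hz2
    rcases hz1.eq_or_lt with rfl | hz1
    · left
      rw [show s = r + p by ring, AddCircle.coe_add, AddCircle.coe_period, add_zero]
    · exact Or.inr ⟨z, hz1, hz2, rfl⟩
  refine ⟨⟨AddCircle p, C, ?_, Or.inl ⟨AddCircle.homeomorphCircle hp0'.ne'⟩, ?_⟩, _, hC₂⟩
  · refine eq_univ_of_forall fun θ => ?_
    rcases hcov θ with rfl | ⟨z, h1, h2, rfl⟩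
    · exact GAtlas.mem_dom_iff.2 ⟨t, hC₂⟩
    · obtain ⟨u, hu⟩ := GAtlas.mem_dom_iff.1 (hYd' z h1 h2)
      exact GAtlas.mem_dom_iff.2 ⟨u, hC₁ z h1 h2 u hu⟩
  · intro θ u hu hE
    refine hE.1 ?_
    rcases hcov θ with rfl | ⟨z, h1, h2, rfl⟩
    · have hut : u ∈ orbit G t := by rwa [GAtlas.orb_eq_of_mem hC₂] at hu
      exact Prec.of_mem_orbit ⟨X, x, y, hxy, hx, hy⟩ hut hut
    · have hzI : z ∈ Icc r s := ⟨h1.le, h2.le⟩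
      obtain ⟨v, hv⟩ := GAtlas.mem_dom_iff.1 (hYd' z h1 h2)
      have e1 : C.orb z = Y.orb z := GAtlas.orb_eq_orb_of_mem (hC₁ z h1 h2 v hv) hv
      have e2 : Y.orb z = X.toReal.orb z := (hL z h1 h2).orb_eq
      rw [e1, e2, ← (hXr z hzI).orb_eq] at hu
      refine Prec.trans ⟨X, realToUnit z, y, ?_, hu, hy⟩ ⟨X, x, realToUnit z, ?_, hx, hu⟩
      · have := strictMonoOn_realToUnit (hI z hzI) hs' h2
        rwa [hs, realToUnit_val] at this
      · have := strictMonoOn_realToUnit hr' (hI z hzI) h1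
        rwa [hr, realToUnit_val] at this

/-- Every inessential orbit is met by a circle or a compact interval without essential points. -/
theorem exists_gcurve {t : T} (h : ¬ Ess G t) : ∃ B : GCurve G, ∃ x, t ∈ B.chart.orb x := by
  by_cases h' : Prec G t t
  · exact exists_gcurve_of_prec h'
  · have : ¬ ∀ X : GInt G I, X.dom = univ → ∀ x, t ∉ X.orb x := fun h'' => h ⟨h', h''⟩
    push Not at this
    obtain ⟨X, hX, x, hx⟩ := this
    exact ⟨⟨I, X.toGAtlas, hX, Or.inr ⟨Homeomorph.refl I⟩, fun y u hu hE => hE.2 X hX y hu⟩, x, hx⟩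

end

/-! ### Stability near an essential orbit -/

section

variable {T : Type*} [TopologicalSpace T] {G : StructureGroupoid T}

/-- The local transformations which preserve a given set `N`. -/
def preservingGroupoid {X : Type*} [TopologicalSpace X] (N : Set X) : StructureGroupoid X where
  members := {e | ∀ x ∈ e.source, x ∈ N ↔ e x ∈ N}
  trans' e e' he he' x hx := by
    rw [OpenPartialHomeomorph.trans_source] at hx
    exact (he x hx.1).trans (he' _ hx.2)
  symm' e he x hx := by
    have h := he (e.symm x) (e.map_target hx)
    rw [e.right_inv hx] at h
    exact h.symm
  id_mem' _ _ := Iff.rfl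
  locality' e h x hx := by
    obtain ⟨s, hs, hxs, hes⟩ := h x hx
    exact hes x (by rw [OpenPartialHomeomorph.restr_source, hs.interior_eq]; exact ⟨hx, hxs⟩)
  mem_of_eqOnSource' e e' he h x hx := by
    rw [h.2 hx]
    exact he x (h.1 ▸ hx)

instance {X : Type*} [TopologicalSpace X] (N : Set X) :
    ClosedUnderRestriction (preservingGroupoid N) where
  closedUnderRestriction := by
    intro e he s _ x hx
    rw [OpenPartialHomeomorph.restr_source] at hx
    exact he x hx.1

/-- A finite system `P` of elements of `G`, each with a compact part of its domain, such that a
subset of `U` that is stable under the elements of `P` restricted to these parts is stable under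
all the elements of `G`. -/
structure IsFiniteSystem (G : StructureGroupoid T) (U : Set T)
    (P : Set (OpenPartialHomeomorph T T × Set T)) : Prop where
  finite : P.Finite
  mem : ∀ a ∈ P, a.1 ∈ G
  compact : ∀ a ∈ P, IsCompact a.2
  subset : ∀ a ∈ P, a.2 ⊆ a.1.source
  stable : ∀ N : Set T, (∀ a ∈ P, ∀ x ∈ a.2, x ∈ U → x ∈ N → a.1 x ∈ U → a.1 x ∈ N) →
    ∀ g ∈ G, ∀ x ∈ g.source, x ∈ U → x ∈ N → g x ∈ U → g x ∈ N

/-- Compact generation provides a finite system: the extensions of the generators and of their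
inverses, with compact sets that contain the domains of the generators and of their inverses. -/
theorem exists_finiteSystem {U : Opens T} {S : Set (OpenPartialHomeomorph U U)} (hS : S.Finite)
    (hext : ∀ γ ∈ S, IsExtendable G γ) (hgen : IsGeneratedBy (restrictTo G U) S) :
    ∃ P, IsFiniteSystem G (U : Set T) P := by
  have : Nonempty (OpenPartialHomeomorph T T) := ⟨OpenPartialHomeomorph.refl T⟩
  choose! g hgG K hK hsK hKg hval using hext
  refine ⟨(fun γ => (g γ, K γ)) '' S ∪ (fun γ => ((g γ).symm, g γ '' K γ)) '' S,
    (hS.image _).union (hS.image _), ?_, ?_, ?_, ?_⟩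
  · rintro a (⟨γ, hγ, rfl⟩ | ⟨γ, hγ, rfl⟩)
    · exact hgG γ hγ
    · exact G.symm (hgG γ hγ)
  · rintro a (⟨γ, hγ, rfl⟩ | ⟨γ, hγ, rfl⟩)
    · exact hK γ hγ
    · exact (hK γ hγ).image_of_continuousOn ((g γ).continuousOn.mono (hKg γ hγ))
  · rintro a (⟨γ, hγ, rfl⟩ | ⟨γ, hγ, rfl⟩)
    · exact hKg γ hγ
    · rintro _ ⟨x, hx, rfl⟩
      exact (g γ).map_source (hKg γ hγ hx)
  · intro N hN
    -- the pseudo-group of the transformations preserving `N` contains the generators of `G|U`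
    have hle : restrictTo G U ≤ preservingGroupoid (Subtype.val ⁻¹' N : Set U) := by
      refine hgen.2 ⟨inferInstance, fun γ hγ x hx => ?_⟩
      have hxK : (x : T) ∈ K γ := hsK γ hγ ⟨x, hx, rfl⟩
      have hv := hval γ hγ x hx
      constructor
      · intro hxN
        have := hN _ (Or.inl ⟨γ, hγ, rfl⟩) x hxK x.2 hxN (by simp only [hv]; exact (γ x).2)
        change ((γ x : U) : T) ∈ N
        rwa [← hv]
      · intro hxN
        have hl : (g γ).symm (γ x) = x := by rw [← hv, (g γ).left_inv (hKg γ hγ hxK)]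
        have := hN _ (Or.inr ⟨γ, hγ, rfl⟩) (γ x : T) ⟨x, hxK, hv⟩ (γ x).2 hxN
          (by simp only [hl]; exact x.2)
        change (x : T) ∈ N
        rwa [← hl]
    intro f hf x hxf hxU hxN hfU
    have hne : Nonempty U := ⟨⟨x, hxU⟩⟩
    let j : OpenPartialHomeomorph U T := U.openPartialHomeomorphSubtypeCoe hne
    have hj : ∀ y : U, j y = y := fun _ => rfl
    have hjs : j.source = univ := by simp [j]
    have hjt : j.target = U := by simp [j]
    have hjr : ∀ y ∈ (U : Set T), (j.symm y : T) = y := fun y hy => j.right_inv (hjt ▸ hy)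
    have hmem : j ≫ₕ f ≫ₕ j.symm ∈ restrictTo G U := by
      intro y hy
      simp only [OpenPartialHomeomorph.trans_source, mem_inter_iff, mem_preimage] at hy
      have hev : ∀ᶠ z in 𝓝 y, z ∈ (j ≫ₕ f ≫ₕ j.symm).source :=
        (j ≫ₕ f ≫ₕ j.symm).open_source.mem_nhds (by simpa using hy)
      refine ⟨f, hf, hy.2.1, ?_⟩
      filter_upwards [hev] with z hz
      simp only [OpenPartialHomeomorph.trans_source, mem_inter_iff, mem_preimage] at hz
      exact (hjr _ (hjt ▸ hz.2.2 : f (j z) ∈ (U : Set T))).symm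
    have := (hle hmem (⟨x, hxU⟩ : U) (by
      simp only [OpenPartialHomeomorph.trans_source, mem_inter_iff, mem_preimage, hjs]
      exact ⟨trivial, hxf, (hjt ▸ hfU : f x ∈ j.target)⟩)).1 hxN
    rwa [mem_preimage, show (((j ≫ₕ f ≫ₕ j.symm) ⟨x, hxU⟩ : U) : T) = f x from hjr _ hfU] at this

end

section

variable {T : Type*} [TopologicalSpace T] [ChartedSpace I T] {G : StructureGroupoid T}

/-- An element of the isotropy group of `t`, read in a chart of a `G`-interval through `t`. -/
theorem germ_of_stab {X : GInt G I} {ψ : OpenPartialHomeomorph I T} (hψ : ψ ∈ X.charts) {x₀ : I}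
    (hx₀ : x₀ ∈ ψ.source) (u : Stab G (ψ x₀)) :
    X.Germ X.toGAtlas (fun x => ψ.symm (u.1 (ψ x))) x₀ := by
  obtain ⟨u, hu, h1, h2⟩ := u
  refine ⟨ψ, hψ, ψ, hψ, u, hu, hx₀, ?_, h1, ?_⟩
  · simp only [h2, ψ.left_inv hx₀, hx₀]
  · have hc : Tendsto (fun x => u (ψ x)) (𝓝 x₀) (𝓝 (ψ x₀)) := by
      have := (u.continuousAt h1).tendsto.comp (ψ.continuousAt hx₀).tendsto
      rwa [h2] at this
    filter_upwards [hc (ψ.open_target.mem_nhds (ψ.map_source hx₀))] with y hy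
    exact ⟨ψ.map_target hy, (ψ.right_inv hy).symm⟩

variable [ClosedUnderRestriction G]

/-- An essential orbit meets a compact set finitely many times. -/
theorem Ess.finite_orbit_inter {t : T} (ht : Ess G t) {K : Set T} (hK : IsCompact K) :
    (orbit G t ∩ K).Finite := by
  -- near each point, the orbits of distinct points of a positive chart are ordered
  have hloc : ∀ z ∈ K, ∃ W ∈ 𝓝 z, (orbit G t ∩ W).Subsingleton := by
    intro z _
    obtain ⟨X, hX⟩ := exists_gint_chartAt (G := G) z
    refine ⟨_, inter_mem hX ((chartAt I z).open_source.mem_nhds (mem_chart_source I z)), ?_⟩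
    rintro y ⟨hy, hy1, hy2⟩ y' ⟨hy', hy1', hy2'⟩
    refine (chartAt I z).injOn hy2 hy2' (le_antisymm ?_ ?_) <;> by_contra h <;> rw [not_le] at h
    · exact ht.1 (Prec.of_mem_orbit ⟨X, _, _, h, hy1', hy1⟩ (mem_orbit_symm hy')
        (mem_orbit_symm hy))
    · exact ht.1 (Prec.of_mem_orbit ⟨X, _, _, h, hy1, hy1'⟩ (mem_orbit_symm hy)
        (mem_orbit_symm hy'))
  choose! W hW hsub using hloc
  obtain ⟨F, hF, hcov⟩ := hK.elim_nhds_subcover W hW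
  refine (F.finite_toSet.biUnion fun z hz => (hsub z (hF z hz)).finite).subset ?_
  rintro y ⟨hy, hyK⟩
  obtain ⟨z, hz, hyz⟩ := mem_iUnion₂.1 (hcov hyK)
  exact mem_iUnion₂.2 ⟨z, hz, hy, hyz⟩

variable [Oriented G] [T2Space T]

/-- Stability: near an essential orbit there are finitely many elements of the isotropy group such
that the saturation of an interval whose endpoints are fixed by them is closed, and meets a
neighbourhood only in the given interval. -/
theorem Ess.exists_stability {U : Set T} (hU : IsExhaustive G U) (hUc : IsCompact (closure U))
    {P : Set (OpenPartialHomeomorph T T × Set T)} (hP : IsFiniteSystem G U P) {t : T}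
    (ht : Ess G t) (htU : t ∈ U) :
    ∃ 𝒰 : Set (Stab G t), 𝒰.Finite ∧ ∀ (X : GInt G I), ∀ ψ ∈ X.charts, ∀ x₀ ∈ ψ.source,
      ψ x₀ = t → ∃ V ∈ 𝓝 x₀, ∀ p ∈ V, ∀ q ∈ V, p ≤ q →
        (∀ u ∈ 𝒰, u.1 (ψ p) = ψ p) → (∀ u ∈ 𝒰, u.1 (ψ q) = ψ q) →
        IsClosed (X.sat (Icc p q)) ∧ ∀ y ∈ V, y ∈ X.pre (X.sat (Icc p q)) → y ∈ Icc p q := by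
  classical
  -- since the orbit of `t` meets `closure U` in a finite set `F`, the elements of the system induce
  -- finitely many elements of the isotropy group of `t`
  set F : Set T := orbit G t ∩ closure U with hF
  have hFfin : F.Finite := ht.finite_orbit_inter hUc
  have htF : t ∈ F := ⟨mem_orbit_self t, subset_closure htU⟩
  -- transport from `t` to the other points of its orbit
  obtain ⟨τ, hτ, hτt⟩ : ∃ τ : T → OpenPartialHomeomorph T T,
      (∀ s ∈ orbit G t, τ s ∈ G ∧ t ∈ (τ s).source ∧ τ s t = s) ∧
        τ t = OpenPartialHomeomorph.refl T := by
    have : Nonempty (OpenPartialHomeomorph T T) := ⟨OpenPartialHomeomorph.refl T⟩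
    have hex : ∀ s ∈ orbit G t, ∃ g : OpenPartialHomeomorph T T, g ∈ G ∧ t ∈ g.source ∧ g t = s :=
      fun s hs => hs
    choose! τ hτ using hex
    refine ⟨Function.update τ t (OpenPartialHomeomorph.refl T), fun s hs => ?_, by simp⟩
    by_cases h : s = t
    · subst h
      simpa using G.id_mem
    · simpa [h] using hτ s hs
  -- the holonomy, at `t`, of the elements of the system
  let P' := fun (s : T) (a : OpenPartialHomeomorph T T × Set T) =>
    s ∈ F ∧ a ∈ P ∧ s ∈ a.2 ∧ a.1 s ∈ closure U
  have hP' : ∀ {s a}, P' s a → a.1 s ∈ F := fun {s a} h =>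
    ⟨mem_orbit_trans (mem_orbit_of_mem (hP.mem a h.2.1) (hP.subset a h.2.1 h.2.2.1)) h.1.1, h.2.2.2⟩
  let ho := fun (s : T) (a : OpenPartialHomeomorph T T × Set T) => τ s ≫ₕ a.1 ≫ₕ (τ (a.1 s)).symm
  have hhos : ∀ {s a}, P' s a → t ∈ (ho s a).source := by
    intro s a h
    have h1 := hτ s h.1.1
    have h2 := hτ _ (hP' h).1
    have h3 := (τ (a.1 s)).map_source h2.2.1
    rw [h2.2.2] at h3
    simp only [ho, OpenPartialHomeomorph.trans_source, mem_inter_iff, mem_preimage,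
      OpenPartialHomeomorph.symm_source, h1.2.2]
    exact ⟨h1.2.1, hP.subset a h.2.1 h.2.2.1, h3⟩
  have hhot : ∀ {s a}, P' s a → ho s a t = t := by
    intro s a h
    have h1 := hτ s h.1.1
    have h2 := hτ _ (hP' h).1
    have h3 := (τ (a.1 s)).left_inv h2.2.1
    rw [h2.2.2] at h3
    simpa [ho, h1.2.2] using h3
  let u : T × (OpenPartialHomeomorph T T × Set T) → Stab G t := fun b =>
    if h : P' b.1 b.2 then ⟨ho b.1 b.2, G.trans (hτ _ h.1.1).1 (G.trans (hP.mem _ h.2.1)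
      (G.symm (hτ _ (hP' h).1).1)), hhos h, hhot h⟩ else Stab.one G t
  have hu : ∀ {s a}, P' s a → (u (s, a)).1 = ho s a := by
    intro s a h
    have : u (s, a) = ⟨ho s a, G.trans (hτ _ h.1.1).1 (G.trans (hP.mem _ h.2.1)
      (G.symm (hτ _ (hP' h).1).1)), hhos h, hhot h⟩ := dif_pos h
    rw [this]
  refine ⟨u '' (F ×ˢ P), (hFfin.prod hP.finite).image _, ?_⟩
  rintro X ψ hψ x₀ hx₀ rfl
  have hψc := ψ.continuousAt hx₀
  have hτc : ∀ s ∈ F, Tendsto (fun x => τ s (ψ x)) (𝓝 x₀) (𝓝 s) := by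
    intro s hs
    have := ((τ s).continuousAt (hτ s hs.1).2.1).tendsto.comp hψc.tendsto
    rwa [(hτ s hs.1).2.2] at this
  let û : T → OpenPartialHomeomorph T T × Set T → I → I := fun s a x => ψ.symm (ho s a (ψ x))
  have hû : ∀ s a, P' s a → LocMono (û s a) x₀ := by
    intro s a h
    have := GAtlas.Germ.locMono (germ_of_stab hψ hx₀ (u (s, a)))
    rw [hu h] at this
    exact this
  choose! m hm hmono using hû
  -- a neighbourhood on which the combinatorics is the same as at `t`
  have hsep : ∀ s ∈ F, ∀ᶠ xy in 𝓝 x₀ ×ˢ 𝓝 x₀, s ≠ ψ x₀ → ψ xy.1 ≠ τ s (ψ xy.2) := by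
    intro s hs
    by_cases hne : s = ψ x₀
    · exact Eventually.of_forall fun _ h => absurd hne h
    · obtain ⟨O, O', hO, hO', hsO, htO, hd⟩ := t2_separation hne
      filter_upwards [(hψc.tendsto.comp tendsto_fst).eventually (hO'.mem_nhds htO),
        ((hτc s hs).comp tendsto_snd).eventually (hO.mem_nhds hsO)] with xy h1 h2 _ heq
      exact Set.disjoint_left.1 hd (show τ s (ψ xy.2) ∈ O from h2)
        (show τ s (ψ xy.2) ∈ O' from heq ▸ h1)
  have hsep' : ∀ᶠ xy in 𝓝 x₀ ×ˢ 𝓝 x₀, ∀ s ∈ F, s ≠ ψ x₀ → ψ xy.1 ≠ τ s (ψ xy.2) :=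
    (eventually_all_finite hFfin).2 hsep
  obtain ⟨D, hD, hDsep'⟩ := mem_prod_self_iff.1 hsep'
  have hDsep : ∀ x ∈ D, ∀ y ∈ D, ∀ s ∈ F, s ≠ ψ x₀ → ψ x ≠ τ s (ψ y) :=
    fun x hx y hy => hDsep' (mk_mem_prod hx hy)
  have hcomb : ∀ s ∈ F, ∀ a ∈ P, ∀ᶠ x in 𝓝 x₀, ψ x ∈ (τ s).source ∧
      (s ∉ a.2 → τ s (ψ x) ∉ a.2) ∧
      (s ∈ a.2 → a.1 s ∉ closure U → a.1 (τ s (ψ x)) ∉ closure U) ∧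
      (P' s a → x ∈ m s a ∧ ho s a (ψ x) ∈ ψ.target ∧
        a.1 (τ s (ψ x)) = τ (a.1 s) (ho s a (ψ x))) := by
    intro s hs a ha
    have h1 : ∀ᶠ x in 𝓝 x₀, ψ x ∈ (τ s).source :=
      hψc.eventually ((τ s).open_source.mem_nhds (hτ s hs.1).2.1)
    have h2 : ∀ᶠ x in 𝓝 x₀, s ∉ a.2 → τ s (ψ x) ∉ a.2 := by
      by_cases h : s ∈ a.2
      · exact Eventually.of_forall fun _ h' => absurd h h'
      · filter_upwards [(hτc s hs) ((hP.compact a ha).isClosed.isOpen_compl.mem_nhds h)]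
          with x hx _ using hx
    have h3 : ∀ᶠ x in 𝓝 x₀, s ∈ a.2 → a.1 s ∉ closure U → a.1 (τ s (ψ x)) ∉ closure U := by
      by_cases h : s ∈ a.2 ∧ a.1 s ∉ closure U
      · have hc : Tendsto (fun x => a.1 (τ s (ψ x))) (𝓝 x₀) (𝓝 (a.1 s)) :=
          (a.1.continuousAt (hP.subset a ha h.1)).tendsto.comp (hτc s hs)
        filter_upwards [hc (isClosed_closure.isOpen_compl.mem_nhds h.2)] with x hx _ _ using hx
      · exact Eventually.of_forall fun _ h1 h2 => absurd ⟨h1, h2⟩ h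
    have h4 : ∀ᶠ x in 𝓝 x₀, P' s a → x ∈ m s a ∧ ho s a (ψ x) ∈ ψ.target ∧
        a.1 (τ s (ψ x)) = τ (a.1 s) (ho s a (ψ x)) := by
      by_cases h : P' s a
      · have hc : Tendsto (fun x => ho s a (ψ x)) (𝓝 x₀) (𝓝 (ψ x₀)) := by
          have := ((ho s a).continuousAt (hhos h)).tendsto.comp hψc.tendsto
          rwa [hhot h] at this
        filter_upwards [hm s a h, hc (ψ.open_target.mem_nhds (ψ.map_source hx₀)),
          hψc.preimage_mem_nhds ((ho s a).open_source.mem_nhds (hhos h))] with x k1 k2 k3 _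
        refine ⟨k1, k2, ?_⟩
        simp only [ho, OpenPartialHomeomorph.trans_source, mem_inter_iff, mem_preimage,
          OpenPartialHomeomorph.symm_source] at k3
        simp only [ho, OpenPartialHomeomorph.coe_trans, Function.comp_apply]
        exact ((τ (a.1 s)).right_inv k3.2.2).symm
      · exact Eventually.of_forall fun _ h' => absurd h' h
    filter_upwards [h1, h2, h3, h4] with x k1 k2 k3 k4 using ⟨k1, k2, k3, k4⟩
  have hcomb' : ∀ᶠ x in 𝓝 x₀, ∀ s ∈ F, ∀ a ∈ P, ψ x ∈ (τ s).source ∧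
      (s ∉ a.2 → τ s (ψ x) ∉ a.2) ∧
      (s ∈ a.2 → a.1 s ∉ closure U → a.1 (τ s (ψ x)) ∉ closure U) ∧
      (P' s a → x ∈ m s a ∧ ho s a (ψ x) ∈ ψ.target ∧
        a.1 (τ s (ψ x)) = τ (a.1 s) (ho s a (ψ x))) :=
    (eventually_all_finite hFfin).2 fun s hs => (eventually_all_finite hP.finite).2 fun a ha =>
      hcomb s hs a ha
  have hcont : ∀ᶠ x in 𝓝 x₀, ∀ s ∈ F, ψ x ∈ (τ s).source :=
    (eventually_all_finite hFfin).2 fun s hs =>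
      hψc.eventually ((τ s).open_source.mem_nhds (hτ s hs.1).2.1)
  have hbase : ∀ᶠ x in 𝓝 x₀, x ∈ ψ.source ∧ ψ x ∈ U :=
    inter_mem (ψ.open_source.mem_nhds hx₀) (hψc.preimage_mem_nhds (hU.1.mem_nhds htU))
  obtain ⟨V, hVo, hVc, hxV, hV⟩ := exists_ordConnected_nhds
    (inter_mem hD (inter_mem hcomb' (inter_mem hcont hbase)))
  have hVD : ∀ x ∈ V, x ∈ D := fun x hx => (hV hx).1
  have hVb : ∀ x ∈ V, x ∈ ψ.source ∧ ψ x ∈ U := fun x hx => (hV hx).2.2.2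
  have hVs : ∀ x ∈ V, ∀ s ∈ F, ψ x ∈ (τ s).source := fun x hx => (hV hx).2.2.1
  refine ⟨V, hVo.mem_nhds hxV, fun p hp q hq hpq hfp hfq => ?_⟩
  have hpqV : Icc p q ⊆ V := hVc.out hp hq
  have horb : ∀ f ∈ Icc p q, X.orb f = orbit G (ψ f) := fun f hf =>
    X.orb_eq_orbit hψ (hVb f (hpqV hf)).1
  -- the trace on `U` of the saturation is contained in finitely many copies of `[p, q]`
  set N : Set T := ⋃ s ∈ F, (fun x => τ s (ψ x)) '' Icc p q with hN
  have hNc : IsClosed N := by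
    refine hFfin.isClosed_biUnion fun s hs => (isCompact_Icc.image_of_continuousOn ?_).isClosed
    intro x hx
    exact (ContinuousAt.comp ((τ s).continuousAt (hVs x (hpqV hx) s hs))
      (ψ.continuousAt (hVb x (hpqV hx)).1)).continuousWithinAt
  have hNsat : N ⊆ X.sat (Icc p q) := by
    rintro y hy
    obtain ⟨s, hs, f, hf, rfl⟩ := mem_iUnion₂.1 hy
    refine ⟨f, hf, ?_⟩
    rw [horb f hf]
    exact mem_orbit_of_mem (hτ s hs.1).1 (hVs f (hpqV hf) s hs)
  have hIN : ∀ f ∈ Icc p q, ψ f ∈ N := fun f hf =>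
    mem_iUnion₂.2 ⟨ψ x₀, htF, f, hf, by simp [hτt]⟩
  have hstab : ∀ g ∈ G, ∀ x ∈ g.source, x ∈ U → x ∈ N → g x ∈ U → g x ∈ N := by
    refine hP.stable N fun a ha x hxa hxU hxN haU => ?_
    obtain ⟨s, hs, f, hf, rfl⟩ := mem_iUnion₂.1 hxN
    have hfV := hpqV hf
    have hcf := fun x (hx : x ∈ V) => (hV hx).2.1 s hs a ha
    have hsa : s ∈ a.2 := by
      by_contra h
      exact (hcf f hfV).2.1 h hxa
    have hsU : a.1 s ∈ closure U := by
      by_contra h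
      exact (hcf f hfV).2.2.1 hsa h (subset_closure haU)
    have hPs : P' s a := ⟨hs, ha, hsa, hsU⟩
    obtain ⟨k1, k2, k3⟩ := (hcf f hfV).2.2.2 hPs
    obtain ⟨p1, -, -⟩ := (hcf p hp).2.2.2 hPs
    obtain ⟨q1, -, -⟩ := (hcf q hq).2.2.2 hPs
    have hmon := (hmono s a hPs).monotoneOn
    -- the holonomy is increasing and fixes `p` and `q`, hence maps `[p, q]` into itself
    have hup : û s a p = p := by
      have := hfp (u (s, a)) ⟨(s, a), ⟨hs, ha⟩, rfl⟩
      rw [hu hPs] at this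
      simp only [û, this, ψ.left_inv (hVb p hp).1]
    have huq : û s a q = q := by
      have := hfq (u (s, a)) ⟨(s, a), ⟨hs, ha⟩, rfl⟩
      rw [hu hPs] at this
      simp only [û, this, ψ.left_inv (hVb q hq).1]
    refine mem_iUnion₂.2 ⟨a.1 s, hP' hPs, û s a f, ⟨?_, ?_⟩, ?_⟩
    · rw [← hup]; exact hmon p1 k1 hf.1
    · rw [← huq]; exact hmon k1 q1 hf.2
    · simp only [û, ψ.right_inv k2]
      exact k3.symm
  have hsatN : ∀ y ∈ U, y ∈ X.sat (Icc p q) → y ∈ N := by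
    rintro y hyU ⟨f, hf, hy⟩
    rw [horb f hf] at hy
    obtain ⟨g, hg, h1, rfl⟩ := hy
    exact hstab g hg _ h1 (hVb f (hpqV hf)).2 (hIN f hf) hyU
  refine ⟨?_, ?_⟩
  · rw [← isOpen_compl_iff, isOpen_iff_mem_nhds]
    intro z hz
    obtain ⟨z', ⟨g, hg, hzg, rfl⟩, hz'U⟩ := hU.2 z
    have hsat := X.isSaturated_sat (Icc p q)
    have hz' : g z ∉ N := fun h =>
      hz (hsat _ (hNsat h) z (mem_orbit_symm (mem_orbit_of_mem hg hzg)))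
    filter_upwards [g.open_source.mem_nhds hzg, (g.continuousAt hzg).preimage_mem_nhds
      (inter_mem (hU.1.mem_nhds hz'U) (hNc.isOpen_compl.mem_nhds hz'))] with y hy hy' hys
    exact hy'.2 (hsatN _ hy'.1 (hsat y hys _ (mem_orbit_of_mem hg hy)))
  · intro y hy hys
    have h1 := hVb y hy
    have h2 : ψ y ∈ X.sat (Icc p q) :=
      GAtlas.mem_of_mem_pre (X.isSaturated_sat _) hys (X.chart_mem_orb hψ h1.1)
    obtain ⟨s, hs, f, hf, h3⟩ := mem_iUnion₂.1 (hsatN _ h1.2 h2)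
    have hst : s = ψ x₀ := by
      by_contra hne
      exact hDsep y (hVD y hy) f (hVD f (hpqV hf)) s hs hne h3.symm
    subst hst
    simp only [hτt, OpenPartialHomeomorph.refl_apply] at h3
    rwa [← ψ.injOn (hVb f (hpqV hf)).1 h1.1 h3]

end

/-! ### The essential locus near one of its points -/

section

variable {T : Type*} [TopologicalSpace T] {G : StructureGroupoid T}

/-- The germ of an element of `G` that fixes `t`. -/
def Stab.germ {t : T} (a : Stab G t) : Isotropy G t := Quotient.mk (stabSetoid G t) a

theorem Stab.germ_eq_iff {t : T} {a b : Stab G t} :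
    a.germ = b.germ ↔ ∀ᶠ y in 𝓝 t, a.1 y = b.1 y :=
  ⟨fun h => Quotient.exact h, fun h => Quotient.sound h⟩

theorem Stab.germ_surjective {t : T} : Function.Surjective (Stab.germ : Stab G t → _) :=
  Quotient.mk_surjective

/-- Near `t`, the common fixed points of a set of elements of the isotropy group are fixed by
the elements of the subgroup it generates. -/
theorem eventually_fixed_of_mem_closure {t : T} {S : Set (Stab G t)} {a : Stab G t}
    (ha : a.germ ∈ Subgroup.closure (Stab.germ '' S)) :
    ∀ᶠ y in 𝓝 t, (∀ s ∈ S, s.1 y = y) → a.1 y = y := by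
  obtain ⟨g, hg, hga⟩ : ∃ g, g ∈ Subgroup.closure (Stab.germ '' S) ∧ a.germ = g := ⟨_, ha, rfl⟩
  clear ha
  induction hg using Subgroup.closure_induction generalizing a with
  | mem x hx =>
    obtain ⟨s, hs, rfl⟩ := hx
    filter_upwards [Stab.germ_eq_iff.1 hga] with y hy h
    rw [hy, h s hs]
  | one =>
    filter_upwards [(Stab.germ_eq_iff (b := Stab.one G t)).1 hga] with y hy h
    rw [hy]; rfl
  | mul x z _ _ ihx ihz =>
    obtain ⟨b, rfl⟩ := Stab.germ_surjective x
    obtain ⟨c, rfl⟩ := Stab.germ_surjective z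
    filter_upwards [(Stab.germ_eq_iff (b := Stab.mul b c)).1 hga, ihx rfl, ihz rfl]
      with y hy h1 h2 h
    rw [hy]
    change b.1 (c.1 y) = y
    rw [h2 h, h1 h]
  | inv x _ ihx =>
    obtain ⟨b, rfl⟩ := Stab.germ_surjective x
    filter_upwards [(Stab.germ_eq_iff (b := Stab.inv b)).1 hga, ihx rfl,
      b.1.open_source.mem_nhds b.2.2.1] with y hy h1 h2 h
    rw [hy]
    change b.1.symm y = y
    conv_lhs => rw [← h1 h]
    exact b.1.left_inv h2

theorem GAtlas.pre_iff_of_orb_eq {Z Z' : Type*} [TopologicalSpace Z] [TopologicalSpace Z']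
    {A : GAtlas G Z} {B : GAtlas G Z'} {x : Z} {y : Z'} {S : Set T} (h : A.orb x = B.orb y) :
    x ∈ A.pre S ↔ y ∈ B.pre S := by
  simp only [GAtlas.pre, mem_ofPred_eq, h]

theorem GAtlas.isClosed_pre_inter {Z : Type*} [TopologicalSpace Z] (X : GAtlas G Z) {S : Set T}
    (hS : IsSaturated G S) (hS' : IsClosed S) {K : Set Z} (hK : IsClosed K) (h : K ⊆ X.dom) :
    IsClosed (X.pre S ∩ K) := by
  have : X.pre S ∩ K = K ∩ (X.pre Sᶜ)ᶜ := by
    rw [X.pre_compl hS]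
    ext x
    simp only [mem_inter_iff, mem_compl_iff, Set.mem_sdiff, not_and, not_not]
    exact ⟨fun hx => ⟨hx.2, fun _ => hx.1⟩, fun hx => ⟨hx.2 (h hx.1), hx.1⟩⟩
  rw [this]
  exact hK.inter (X.isOpen_pre hS.compl hS'.isOpen_compl).isClosed_compl

/-- The isotropy group of an essential orbit contains a family of at most `essentialRank G` elements
which generate a subgroup that contains a given finite set. If the essential rank is infinite, the
finite set itself will do; otherwise a generating set of minimal cardinality does. -/
theorem exists_generators {T : Type*} [TopologicalSpace T] [ChartedSpace I T]
    {G : StructureGroupoid T} {t : T} (ht : IsEssential G t) {𝒰 : Set (Stab G t)} (h𝒰 : 𝒰.Finite) :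
    ∃ (r : ℕ) (w : Fin r → Stab G t), (r : ℕ∞) ≤ essentialRank G ∧
      ∀ a ∈ 𝒰, a.germ ∈ Subgroup.closure (Stab.germ '' range w) := by
  classical
  obtain ⟨S, hS, hcl⟩ : ∃ S : Finset (Isotropy G t), (S.card : ℕ∞) ≤ essentialRank G ∧
      ∀ a ∈ 𝒰, a.germ ∈ Subgroup.closure (S : Set (Isotropy G t)) := by
    by_cases h : essentialRank G = ⊤
    · refine ⟨(h𝒰.image Stab.germ).toFinset, by rw [h]; exact le_top, fun a ha => ?_⟩
      exact Subgroup.subset_closure (by simpa using ⟨a, ha, rfl⟩)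
    · have h1 : groupRank (Isotropy G t) ≤ essentialRank G :=
        le_iSup₂ (f := fun t (_ : IsEssential G t) => groupRank (Isotropy G t)) t ht
      obtain ⟨n, hn⟩ := ENat.ne_top_iff_exists.1 h
      have h2 : groupRank (Isotropy G t) < ((n + 1 : ℕ) : ℕ∞) := by
        refine h1.trans_lt ?_
        rw [← hn]
        exact_mod_cast Nat.lt_succ_self n
      simp only [groupRank, iInf_lt_iff] at h2
      obtain ⟨S, hS, hlt⟩ := h2
      refine ⟨S, ?_, fun a _ => by rw [hS]; trivial⟩
      rw [← hn]
      exact_mod_cast Nat.lt_succ_iff.1 (by exact_mod_cast hlt)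
  refine ⟨S.card, fun i => Quotient.out (S.equivFin.symm i : Isotropy G t), hS, ?_⟩
  intro a ha
  refine Subgroup.closure_mono ?_ (hcl a ha)
  intro g hg
  refine ⟨_, ⟨S.equivFin ⟨g, hg⟩, rfl⟩, ?_⟩
  simp only [Equiv.symm_apply_apply, Stab.germ]
  exact Quotient.out_eq g

end

section

variable {T : Type*} [TopologicalSpace T] [ChartedSpace I T] {G : StructureGroupoid T}

/-- The points of a `G`-interval that lie on essential orbits. -/
def GInt.ess (X : GInt G I) : Set I := X.pre {t | Ess G t}

theorem GInt.mem_ess_iff {X : GInt G I} {x : I} {t : T} (ht : t ∈ X.orb x) :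
    x ∈ X.ess ↔ Ess G t :=
  ⟨fun h => GAtlas.mem_of_mem_pre isSaturated_ess h ht, fun h => ⟨t, ht, h⟩⟩

theorem GInt.ess_subset_dom (X : GInt G I) : X.ess ⊆ X.dom :=
  fun _ ⟨t, ht, _⟩ => GAtlas.mem_dom_iff.2 ⟨t, ht⟩

theorem GInt.ess_eq_of_orb_eq {X Y : GInt G I} {x y : I} (h : X.orb x = Y.orb y) :
    x ∈ X.ess ↔ y ∈ Y.ess := by
  simp only [GInt.ess, GAtlas.pre, mem_ofPred_eq, h]

theorem GInt.eventually_dom_diff_ess (X : GInt G I) {x : I} (hx : x ∈ X.dom) (h : x ∉ X.ess) :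
    ∀ᶠ y in 𝓝 x, y ∉ X.ess := by
  have h1 : x ∈ X.pre {t | Ess G t}ᶜ := by
    rw [X.pre_compl isSaturated_ess]; exact ⟨hx, h⟩
  filter_upwards [(X.isOpen_pre isSaturated_ess.compl isOpen_compl_ess).mem_nhds h1] with y hy
  rw [X.pre_compl isSaturated_ess] at hy
  exact hy.2

/-- The essential locus of a `G`-interval is closed in its domain. -/
theorem GInt.isClosed_ess_inter (X : GInt G I) {K : Set I} (hK : IsClosed K) (h : K ⊆ X.dom) :
    IsClosed (X.ess ∩ K) := by
  rw [← isOpen_compl_iff, isOpen_iff_mem_nhds]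
  intro x hx
  by_cases hxK : x ∈ K
  · filter_upwards [X.eventually_dom_diff_ess (h hxK) fun h => hx ⟨h, hxK⟩] with y hy h
    exact hy h.1
  · filter_upwards [hK.isOpen_compl.mem_nhds hxK] with y hy h using hy h.2

/-- Neighbourhoods of two points on the same orbit look the same. -/
theorem GInt.eventually_transfer {X Y : GInt G I} {x y : I} {t : T} (hx : t ∈ X.orb x)
    (hy : t ∈ Y.orb y) {S : Set T} (h : ∀ᶠ z in 𝓝 x, z ∈ X.pre S) :
    ∀ᶠ z in 𝓝 y, z ∈ Y.pre S := by
  obtain ⟨e, he, rfl, hG⟩ := GAtlas.exists_germ_of_orb_eq hy hx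
  filter_upwards [e.open_source.mem_nhds he, (e.continuousAt he).eventually h] with z h2 h3
  exact (GAtlas.pre_iff_of_orb_eq (hG z h2).orb_eq).1 h3

variable [Oriented G]

/-- One-sided neighbourhoods of two points on the same orbit look the same. -/
theorem GInt.eventually_lt_transfer {X Y : GInt G I} {x y : I} {t : T} (hx : t ∈ X.orb x)
    (hy : t ∈ Y.orb y) {S : Set T} (h : ∀ᶠ z in 𝓝[<] x, z ∈ X.pre S) :
    ∀ᶠ z in 𝓝[<] y, z ∈ Y.pre S := by
  obtain ⟨e, he, rfl, hG⟩ := GAtlas.exists_germ_of_orb_eq hy hx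
  obtain ⟨u, hu, hm⟩ := GAtlas.Germ.locMono (hG y he)
  rw [eventually_nhdsWithin_iff] at h ⊢
  filter_upwards [hu, e.open_source.mem_nhds he, (e.continuousAt he).eventually h]
    with z h1 h2 h3 h4
  exact (GAtlas.pre_iff_of_orb_eq (hG z h2).orb_eq).1 (h3 (hm h1 (mem_of_mem_nhds hu) h4))

theorem GInt.eventually_gt_transfer {X Y : GInt G I} {x y : I} {t : T} (hx : t ∈ X.orb x)
    (hy : t ∈ Y.orb y) {S : Set T} (h : ∀ᶠ z in 𝓝[>] x, z ∈ X.pre S) :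
    ∀ᶠ z in 𝓝[>] y, z ∈ Y.pre S := by
  obtain ⟨e, he, rfl, hG⟩ := GAtlas.exists_germ_of_orb_eq hy hx
  obtain ⟨u, hu, hm⟩ := GAtlas.Germ.locMono (hG y he)
  rw [eventually_nhdsWithin_iff] at h ⊢
  filter_upwards [hu, e.open_source.mem_nhds he, (e.continuousAt he).eventually h]
    with z h1 h2 h3 h4
  exact (GAtlas.pre_iff_of_orb_eq (hG z h2).orb_eq).1 (h3 (hm (mem_of_mem_nhds hu) h1 h4))

variable [ClosedUnderRestriction G]

/-- If the saturation `C` of `[x₀, x]` is closed, and does not meet a right neighbourhood of `x`,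
a positive path that starts at `x` and comes back to `C` has to come back through `x₀`; so the orbit
of `x` is essential as soon as the orbit of `x₀` is. -/
theorem Ess.trap_right {X : GInt G I} {x₀ x : I} {t s : T} (ht : Ess G t) (hx₀ : t ∈ X.orb x₀)
    (hx : s ∈ X.orb x) (hlt : x₀ < x) (hcl : IsClosed (X.sat (Icc x₀ x)))
    (hout : ∀ᶠ y in 𝓝[>] x, y ∈ X.pre (X.sat (Icc x₀ x))ᶜ) : Ess G s := by
  set C := X.sat (Icc x₀ x) with hC
  have hCs : IsSaturated G C := X.isSaturated_sat _
  have hsub : ∀ f ∈ Icc x₀ x, f ∈ X.dom := fun f hf =>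
    X.ordConnected.out (GAtlas.mem_dom_iff.2 ⟨t, hx₀⟩) (GAtlas.mem_dom_iff.2 ⟨s, hx⟩) hf
  have hpre : ∀ f ∈ Icc x₀ x, f ∈ X.pre C := fun f hf => by
    obtain ⟨p, hp⟩ := GAtlas.mem_dom_iff.1 (hsub f hf)
    exact ⟨p, hp, f, hf, hp⟩
  have hts : Prec G t s := ⟨X, _, _, hlt, hx₀, hx⟩
  -- a point of `C` without points of `C` close to it on its left lies on the orbit of `x₀`
  have hleft : ∀ (Y : GInt G I) (y : I), y ∈ Y.pre C → (∃ᶠ z in 𝓝[<] y, z ∉ Y.pre C) →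
      t ∈ Y.orb y := by
    rintro Y y ⟨p, hp, f, hf, hpf⟩ hfr
    rcases hf.1.eq_or_lt with rfl | hlt'
    · rw [GAtlas.orb_eq_orb_of_mem hp hpf]; exact hx₀
    · refine absurd (GInt.eventually_lt_transfer hpf hp (S := C) ?_) (not_eventually.2 hfr)
      filter_upwards [Ioo_mem_nhdsLT hlt'] with z hz
      exact hpre z ⟨hz.1.le, hz.2.le.trans hf.2⟩
  refine ⟨fun hss => ?_, fun Y hY y hy => ?_⟩
  · -- a `G`-interval from the orbit of `s` to itself leaves `C`, and comes back at some first point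
    -- `m`, on the orbit of `x₀`
    obtain ⟨Y, y₁, y₂, h12, h1, h2⟩ := hss
    have hsC : s ∈ C := ⟨x, ⟨hlt.le, le_rfl⟩, hx⟩
    have hd : Icc y₁ y₂ ⊆ Y.dom :=
      Y.ordConnected.out (GAtlas.mem_dom_iff.2 ⟨s, h1⟩) (GAtlas.mem_dom_iff.2 ⟨s, h2⟩)
    have hr := GInt.eventually_gt_transfer hx h1 hout
    obtain ⟨y', hy', hy'r⟩ := (mem_nhdsGT_iff_exists_Ioo_subset' h12).1 hr
    have hnot : ∀ z ∈ Ioo y₁ y', z ∉ Y.pre C := fun z hz h => by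
      have := hy'r hz
      rw [mem_ofPred_eq, Y.pre_compl hCs] at this
      exact this.2 h
    have hy'2 : y' ≤ y₂ := by
      by_contra h
      exact hnot y₂ ⟨h12, not_le.1 h⟩ ⟨s, h2, hsC⟩
    have hK : IsCompact (Y.pre C ∩ Icc y' y₂) := (Y.isClosed_pre_inter hCs hcl isClosed_Icc
      fun z hz => hd ⟨(le_of_lt hy').trans hz.1, hz.2⟩).isCompact
    obtain ⟨m, ⟨hmC, hm⟩, hleast⟩ := hK.exists_isLeast ⟨y₂, ⟨s, h2, hsC⟩, hy'2, le_rfl⟩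
    have h1m : y₁ < m := lt_of_lt_of_le hy' hm.1
    have htm : t ∈ Y.orb m := by
      refine hleft Y m hmC ?_
      have := nhdsLT_neBot_of_exists_lt ⟨_, h1m⟩
      refine Eventually.frequently ?_
      filter_upwards [Ioo_mem_nhdsLT h1m] with z hz hzC
      rcases lt_or_ge z y' with h | h
      · exact hnot z ⟨hz.1, h⟩ hzC
      · exact absurd (hleast ⟨hzC, h, hz.2.le.trans hm.2⟩) (not_le.2 hz.2)
    exact ht.1 (hts.trans ⟨Y, _, _, h1m, h1, htm⟩)
  · -- a compact `G`-interval that meets the orbit of `s` enters `C` at some point `m`, or begins in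
    -- `C`; in both cases it meets the orbit of `x₀`
    have hyC : y ∈ Y.pre C := ⟨s, hy, x, ⟨hlt.le, le_rfl⟩, hx⟩
    set N := (Y.pre C)ᶜ ∩ Iic y with hN
    rcases N.eq_empty_or_nonempty with hNe | hNe
    · have h0 : (0 : I) ∈ Y.pre C := by
        by_contra h
        exact (hNe ▸ (⟨h, unitInterval.nonneg'⟩ : (0 : I) ∈ N) : (0 : I) ∈ (∅ : Set I))
      obtain ⟨p, hp, f, hf, hpf⟩ := h0
      rcases hf.1.eq_or_lt with rfl | hlt'
      · refine ht.2 Y hY 0 ?_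
        rw [GAtlas.orb_eq_orb_of_mem hp hpf]; exact hx₀
      · exact lt_irrefl _ (GInt.pos_of_orb hpf hp (unitInterval.nonneg'.trans_lt hlt'))
    · have hlub := isLUB_sSup N
      set m := sSup N
      have hmy : m ≤ y := hlub.2 fun z hz => hz.2
      have hmC : m ∈ Y.pre C := by
        by_contra h
        have hmo : m ∈ Y.pre Cᶜ := by rw [Y.pre_compl hCs]; exact ⟨hY ▸ mem_univ _, h⟩
        have hmy' : m < y := lt_of_le_of_ne hmy fun h' => h (h' ▸ hyC)
        have hev : ∀ᶠ z in 𝓝[>] m, z ∈ Y.pre Cᶜ :=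
          mem_nhdsWithin_of_mem_nhds ((Y.isOpen_pre hCs.compl hcl.isOpen_compl).mem_nhds hmo)
        have := nhdsGT_neBot_of_exists_gt ⟨_, hmy'⟩
        obtain ⟨z, hz, hz'⟩ := (hev.and (Ioo_mem_nhdsGT hmy')).exists
        rw [Y.pre_compl hCs] at hz
        exact absurd (hlub.1 ⟨hz.2, hz'.2.le⟩) (not_le.2 hz'.1)
      refine ht.2 Y hY m (hleft Y m hmC ?_)
      have hmN : m ∉ N := fun h => h.1 hmC
      have hfr := hlub.frequently_mem hNe
      rw [frequently_nhdsWithin_iff] at hfr ⊢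
      refine hfr.mono fun z hz => ⟨hz.1.1, ?_⟩
      exact lt_of_le_of_ne (mem_Iic.1 hz.2) fun h => hmN (h ▸ hz.1)

/-- The mirror image of `Ess.trap_right`. -/
theorem Ess.trap_left {X : GInt G I} {x₀ x : I} {t s : T} (ht : Ess G t) (hx₀ : t ∈ X.orb x₀)
    (hx : s ∈ X.orb x) (hlt : x < x₀) (hcl : IsClosed (X.sat (Icc x x₀)))
    (hout : ∀ᶠ y in 𝓝[<] x, y ∈ X.pre (X.sat (Icc x x₀))ᶜ) : Ess G s := by
  set C := X.sat (Icc x x₀) with hC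
  have hCs : IsSaturated G C := X.isSaturated_sat _
  have hsub : ∀ f ∈ Icc x x₀, f ∈ X.dom := fun f hf =>
    X.ordConnected.out (GAtlas.mem_dom_iff.2 ⟨s, hx⟩) (GAtlas.mem_dom_iff.2 ⟨t, hx₀⟩) hf
  have hpre : ∀ f ∈ Icc x x₀, f ∈ X.pre C := fun f hf => by
    obtain ⟨p, hp⟩ := GAtlas.mem_dom_iff.1 (hsub f hf)
    exact ⟨p, hp, f, hf, hp⟩
  have hts : Prec G s t := ⟨X, _, _, hlt, hx, hx₀⟩
  -- a point of `C` without points of `C` close to it on its right lies on the orbit of `x₀`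
  have hright : ∀ (Y : GInt G I) (y : I), y ∈ Y.pre C → (∃ᶠ z in 𝓝[>] y, z ∉ Y.pre C) →
      t ∈ Y.orb y := by
    rintro Y y ⟨p, hp, f, hf, hpf⟩ hfr
    rcases hf.2.eq_or_lt with rfl | hlt'
    · rw [GAtlas.orb_eq_orb_of_mem hp hpf]; exact hx₀
    · refine absurd (GInt.eventually_gt_transfer hpf hp (S := C) ?_) (not_eventually.2 hfr)
      filter_upwards [Ioo_mem_nhdsGT hlt'] with z hz
      exact hpre z ⟨hf.1.trans hz.1.le, hz.2.le⟩
  refine ⟨fun hss => ?_, fun Y hY y hy => ?_⟩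
  · obtain ⟨Y, y₁, y₂, h12, h1, h2⟩ := hss
    have hsC : s ∈ C := ⟨x, ⟨le_rfl, hlt.le⟩, hx⟩
    have hd : Icc y₁ y₂ ⊆ Y.dom :=
      Y.ordConnected.out (GAtlas.mem_dom_iff.2 ⟨s, h1⟩) (GAtlas.mem_dom_iff.2 ⟨s, h2⟩)
    have hr := GInt.eventually_lt_transfer hx h2 hout
    obtain ⟨y', hy', hy'r⟩ := (mem_nhdsLT_iff_exists_Ioo_subset' h12).1 hr
    have hnot : ∀ z ∈ Ioo y' y₂, z ∉ Y.pre C := fun z hz h => by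
      have := hy'r hz
      rw [mem_ofPred_eq, Y.pre_compl hCs] at this
      exact this.2 h
    have hy'1 : y₁ ≤ y' := by
      by_contra h
      exact hnot y₁ ⟨not_le.1 h, h12⟩ ⟨s, h1, hsC⟩
    have hK : IsCompact (Y.pre C ∩ Icc y₁ y') := (Y.isClosed_pre_inter hCs hcl isClosed_Icc
      fun z hz => hd ⟨hz.1, hz.2.trans (le_of_lt hy')⟩).isCompact
    obtain ⟨m, ⟨hmC, hm⟩, hgreatest⟩ := hK.exists_isGreatest ⟨y₁, ⟨s, h1, hsC⟩, le_rfl, hy'1⟩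
    have hm2 : m < y₂ := lt_of_le_of_lt hm.2 hy'
    have htm : t ∈ Y.orb m := by
      refine hright Y m hmC ?_
      have := nhdsGT_neBot_of_exists_gt ⟨_, hm2⟩
      refine Eventually.frequently ?_
      filter_upwards [Ioo_mem_nhdsGT hm2] with z hz hzC
      rcases lt_or_ge y' z with h | h
      · exact hnot z ⟨h, hz.2⟩ hzC
      · exact absurd (hgreatest ⟨hzC, hm.1.trans hz.1.le, h⟩) (not_le.2 hz.1)
    exact ht.1 (Prec.trans ⟨Y, _, _, hm2, htm, h2⟩ hts)
  · have hyC : y ∈ Y.pre C := ⟨s, hy, x, ⟨le_rfl, hlt.le⟩, hx⟩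
    set N := (Y.pre C)ᶜ ∩ Ici y with hN
    rcases N.eq_empty_or_nonempty with hNe | hNe
    · have h0 : (1 : I) ∈ Y.pre C := by
        by_contra h
        exact (hNe ▸ (⟨h, unitInterval.le_one'⟩ : (1 : I) ∈ N) : (1 : I) ∈ (∅ : Set I))
      obtain ⟨p, hp, f, hf, hpf⟩ := h0
      rcases hf.2.eq_or_lt with rfl | hlt'
      · refine ht.2 Y hY 1 ?_
        rw [GAtlas.orb_eq_orb_of_mem hp hpf]; exact hx₀
      · exact lt_irrefl _ (GInt.lt_one_of_orb hpf hp (hlt'.trans_le unitInterval.le_one'))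
    · have hglb := isGLB_sInf N
      set m := sInf N
      have hmy : y ≤ m := hglb.2 fun z hz => hz.2
      have hmC : m ∈ Y.pre C := by
        by_contra h
        have hmo : m ∈ Y.pre Cᶜ := by rw [Y.pre_compl hCs]; exact ⟨hY ▸ mem_univ _, h⟩
        have hmy' : y < m := lt_of_le_of_ne hmy fun h' => h (h' ▸ hyC)
        have hev : ∀ᶠ z in 𝓝[<] m, z ∈ Y.pre Cᶜ :=
          mem_nhdsWithin_of_mem_nhds ((Y.isOpen_pre hCs.compl hcl.isOpen_compl).mem_nhds hmo)
        have := nhdsLT_neBot_of_exists_lt ⟨_, hmy'⟩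
        obtain ⟨z, hz, hz'⟩ := (hev.and (Ioo_mem_nhdsLT hmy')).exists
        rw [Y.pre_compl hCs] at hz
        exact absurd (hglb.1 ⟨hz.2, hz'.1.le⟩) (not_le.2 hz'.2)
      refine ht.2 Y hY m (hright Y m hmC ?_)
      have hmN : m ∉ N := fun h => h.1 hmC
      have hfr := hglb.frequently_mem hNe
      rw [frequently_nhdsWithin_iff] at hfr ⊢
      refine hfr.mono fun z hz => ⟨hz.1.1, ?_⟩
      exact lt_of_le_of_ne (mem_Ici.1 hz.2) fun h => hmN (h ▸ hz.1)

end

section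

variable {T : Type*} [TopologicalSpace T] [ChartedSpace I T] {G : StructureGroupoid T}

/-- Commuting increasing maps `w 0, …, w (r - 1)`, defined on the open interval `V` of the
`G`-interval `X`, whose germs belong to `G` and whose common fixed points are the points of `V` that
lie on essential orbits. To avoid partial maps, the `w i` are total functions, whose values outside
`V` are irrelevant, and to ease concatenation the family is extended by `w i = id` for `i ≥ r`. -/
structure CommutingSystem (X : GInt G I) (V : Set I) (r : ℕ) (w : ℕ → I → I) : Prop where
  isOpen : IsOpen V
  ordConnected : V.OrdConnected
  subset : V ⊆ X.dom
  eq_id : ∀ i, r ≤ i → w i = id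
  mono : ∀ i, StrictMonoOn (w i) V
  germ : ∀ i, ∀ x ∈ V, X.Germ X.toGAtlas (w i) x
  comm : ∀ i j, ∀ x ∈ V, w i (w j x) = w j (w i x)
  fix : ∀ x ∈ V, x ∈ X.ess ↔ ∀ i, w i x = x

/-- A `G`-interval meets an essential orbit at most once. -/
theorem GInt.eq_of_orb_eq_of_ess {X : GInt G I} {x y : I} (h : X.orb x = X.orb y) (hx : x ∈ X.ess) :
    x = y := by
  obtain ⟨t, ht, hE⟩ := hx
  by_contra hne
  rcases lt_or_gt_of_ne hne with hlt | hlt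
  · exact hE.1 ⟨X, x, y, hlt, ht, h ▸ ht⟩
  · exact hE.1 ⟨X, y, x, hlt, h ▸ ht, ht⟩

variable [ClosedUnderRestriction G] [Oriented G] [T2Space T]

/-- Near a point of an essential orbit with commutative isotropy, generators of the isotropy group are
a commuting system. Their fixed points are essential: by stability, the saturation of the interval
between `x₀` and a common fixed point is closed, so `Ess.trap_left` or `Ess.trap_right` applies. -/
theorem Ess.exists_commutingSystem {U : Set T} (hU : IsExhaustive G U)
    (hUc : IsCompact (closure U)) {P : Set (OpenPartialHomeomorph T T × Set T)}
    (hP : IsFiniteSystem G U P) {t : T} (ht : Ess G t) (htU : t ∈ U)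
    (hcomm : ∀ a b : Isotropy G t, a * b = b * a) :
    ∃ (X : GInt G I) (x₀ : I) (V : Set I) (r : ℕ) (w : ℕ → I → I), t ∈ X.orb x₀ ∧ x₀ ∈ V ∧
      (r : ℕ∞) ≤ essentialRank G ∧ CommutingSystem X V r w ∧
      ∀ p ∈ X.ess ∩ V, ∀ q ∈ X.ess ∩ V, p ≤ q → IsClosed (X.sat (Icc p q)) := by
  obtain ⟨𝒰, h𝒰, hst⟩ := ht.exists_stability hU hUc hP htU
  obtain ⟨r, v, hr, hv⟩ := exists_generators ht.isEssential h𝒰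
  obtain ⟨X, ψ, x₀, hψ, hdom, hx₀, hψt⟩ : ∃ (X : GInt G I) (ψ : OpenPartialHomeomorph I T) (x₀ : I),
      ψ ∈ X.charts ∧ X.dom = ψ.source ∧ x₀ ∈ ψ.source ∧ ψ x₀ = t := by
    obtain ⟨X, ψ, h1, h2, h3, -, h4⟩ := exists_gint_of_chart (G := G) (chart_mem_atlas I t)
      (mem_chart_source I t) univ_mem
    exact ⟨X, ψ, _, h1 ▸ rfl, h3, h2, by rw [h4, (chartAt I t).left_inv (mem_chart_source I t)]⟩
  obtain ⟨V', hV', hst'⟩ := hst X ψ hψ x₀ hx₀ hψt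
  subst hψt
  have hψc := ψ.continuousAt hx₀
  let f : Stab G (ψ x₀) → I → I := fun a x => ψ.symm (a.1 (ψ x))
  have hfg : ∀ a, X.Germ X.toGAtlas (f a) x₀ := germ_of_stab hψ hx₀
  have hft : ∀ a : Stab G (ψ x₀), ∀ᶠ x in 𝓝 x₀, a.1 (ψ x) ∈ ψ.target := fun a =>
    (a.tendsto.comp hψc) (ψ.open_target.mem_nhds (ψ.map_source hx₀))
  have hff : ∀ a b, ∀ᶠ x in 𝓝 x₀, f a (f b x) = f b (f a x) := by
    intro a b
    have h : (Stab.mul a b).germ = (Stab.mul b a).germ := hcomm a.germ b.germ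
    filter_upwards [hft a, hft b, hψc.eventually (Stab.germ_eq_iff.1 h)] with x h1 h2 h3
    simp only [f, ψ.right_inv h1, ψ.right_inv h2]
    exact congrArg ψ.symm h3
  have hfix : ∀ᶠ x in 𝓝 x₀, (∀ i, f (v i) x = x) → ∀ a ∈ 𝒰, a.1 (ψ x) = ψ x := by
    have h1 : ∀ᶠ x in 𝓝 x₀, ∀ i, (v i).1 (ψ x) ∈ ψ.target := eventually_all.2 fun i => hft (v i)
    have h2 : ∀ᶠ x in 𝓝 x₀, ∀ a ∈ 𝒰, (∀ s ∈ range v, s.1 (ψ x) = ψ x) → a.1 (ψ x) = ψ x :=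
      (eventually_all_finite h𝒰).2 fun a ha =>
        hψc.eventually (eventually_fixed_of_mem_closure (hv a ha))
    filter_upwards [h1, h2] with x k1 k2 k3 a ha
    refine k2 a ha ?_
    rintro _ ⟨i, rfl⟩
    rw [← ψ.right_inv (k1 i)]
    exact congrArg ψ (k3 i)
  choose u hu hum using fun a => GAtlas.Germ.locMono (hfg a)
  have e1 : ∀ᶠ x in 𝓝 x₀, ∀ i, x ∈ u (v i) := eventually_all.2 fun i => hu (v i)
  have e2 : ∀ᶠ x in 𝓝 x₀, ∀ i, X.Germ X.toGAtlas (f (v i)) x :=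
    eventually_all.2 fun i => (hfg (v i)).eventually
  have e3 : ∀ᶠ x in 𝓝 x₀, ∀ i j, f (v i) (f (v j) x) = f (v j) (f (v i) x) :=
    eventually_all.2 fun i => eventually_all.2 fun j => hff _ _
  obtain ⟨V, hVo, hVc, hxV, hV⟩ := exists_ordConnected_nhds (inter_mem hV' (inter_mem hfix
    (inter_mem e1 (inter_mem e2 (inter_mem e3 (ψ.open_source.mem_nhds hx₀))))))
  have hVs : ∀ x ∈ V, x ∈ ψ.source := fun x hx => (hV hx).2.2.2.2.2
  have horb : ∀ x ∈ V, ψ x ∈ X.orb x := fun x hx => X.chart_mem_orb hψ (hVs x hx)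
  have hE : ∀ x ∈ V, x ∈ X.ess ↔ ∀ i, f (v i) x = x := by
    refine fun x hx => ⟨fun h i => ?_, fun h => ?_⟩
    · exact (GInt.eq_of_orb_eq_of_ess ((hV hx).2.2.2.1 i).orb_eq.symm h).symm
    · have hux := (hV hx).2.1 h
      have hu₀ : ∀ a ∈ 𝒰, a.1 (ψ x₀) = ψ x₀ := fun a _ => a.2.2.2
      have hdm : ∀ y ∈ V, y ∈ X.dom := fun y hy => hdom ▸ hVs y hy
      refine ⟨ψ x, horb x hx, ?_⟩
      rcases lt_trichotomy x x₀ with hlt | rfl | hlt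
      · obtain ⟨h1, h2⟩ := hst' x (hV hx).1 x₀ (hV hxV).1 hlt.le hux hu₀
        refine ht.trap_left (horb x₀ hxV) (horb x hx) hlt h1 ?_
        filter_upwards [mem_nhdsWithin_of_mem_nhds (hVo.mem_nhds hx), self_mem_nhdsWithin]
          with y hy hyx
        rw [X.pre_compl (X.isSaturated_sat _)]
        exact ⟨hdm y hy, fun h => absurd (h2 y (hV hy).1 h).1 (not_le.2 hyx)⟩
      · exact ht
      · obtain ⟨h1, h2⟩ := hst' x₀ (hV hxV).1 x (hV hx).1 hlt.le hu₀ hux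
        refine ht.trap_right (horb x₀ hxV) (horb x hx) hlt h1 ?_
        filter_upwards [mem_nhdsWithin_of_mem_nhds (hVo.mem_nhds hx), self_mem_nhdsWithin]
          with y hy hyx
        rw [X.pre_compl (X.isSaturated_sat _)]
        exact ⟨hdm y hy, fun h => absurd (h2 y (hV hy).1 h).2 (not_le.2 hyx)⟩
  let w : ℕ → I → I := fun i => if h : i < r then f (v ⟨i, h⟩) else id
  have hw : ∀ i (h : i < r), w i = f (v ⟨i, h⟩) := fun i h => dif_pos h
  have hw' : ∀ i, ¬ i < r → w i = id := fun i h => dif_neg h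
  refine ⟨X, x₀, V, r, w, horb x₀ hxV, hxV, hr, ⟨hVo, hVc, fun x hx => hdom ▸ hVs x hx,
    fun i h => hw' i (not_lt.2 h), fun i => ?_, fun i x hx => ?_, fun i j x hx => ?_,
    fun x hx => ?_⟩, ?_⟩
  · by_cases h : i < r
    · rw [hw i h]
      exact (hum _).mono fun x hx => (hV hx).2.2.1 _
    · rw [hw' i h]
      exact strictMonoOn_id
  · by_cases h : i < r
    · rw [hw i h]
      exact (hV hx).2.2.2.1 _
    · rw [hw' i h]
      exact GAtlas.germ_id (hdom ▸ hVs x hx)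
  · by_cases h : i < r <;> by_cases h' : j < r
    · rw [hw i h, hw j h']
      exact (hV hx).2.2.2.2.1 _ _
    all_goals first | simp only [hw' _ h, id_eq] | simp only [hw' _ h', id_eq]
  · rw [hE x hx]
    refine ⟨fun h i => ?_, fun h i => ?_⟩
    · by_cases h' : i < r
      · rw [hw i h']; exact h _
      · rw [hw' i h']; rfl
    · rw [← hw i i.2]; exact h i
  · rintro p ⟨hpE, hp⟩ q ⟨hqE, hq⟩ hpq
    exact (hst' p (hV hp).1 q (hV hq).1 hpq ((hV hp).2.1 ((hE p hp).1 hpE))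
      ((hV hq).2.1 ((hE q hq).1 hqE))).1

end

/-! ### Cores -/

section

variable {T : Type*} [TopologicalSpace T] [ChartedSpace I T] {G : StructureGroupoid T}

/-- A candidate for the core of a hinge of rank at most `R`: a compact interval `[a, b]` in a
`G`-interval, with endpoints on essential orbits and a system of at most `R` commuting maps around
it, such that its subintervals with endpoints on essential orbits have closed saturations. -/
structure IsCore (R : ℕ∞) (X : GInt G I) (a b : I) : Prop where
  le : a ≤ b
  left_mem : a ∈ X.ess
  right_mem : b ∈ X.ess
  system : ∃ (V : Set I) (r : ℕ) (w : ℕ → I → I), Icc a b ⊆ V ∧ (r : ℕ∞) ≤ R ∧ CommutingSystem X V r w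
  isClosed_sat : ∀ p ∈ X.ess ∩ Icc a b, ∀ q ∈ X.ess ∩ Icc a b, p ≤ q → IsClosed (X.sat (Icc p q))

theorem IsCore.sub {R : ℕ∞} {X : GInt G I} {a b p q : I} (h : IsCore R X a b) (hp : p ∈ X.ess)
    (hq : q ∈ X.ess) (hap : a ≤ p) (hpq : p ≤ q) (hqb : q ≤ b) : IsCore R X p q := by
  have hsub : Icc p q ⊆ Icc a b := Icc_subset_Icc hap hqb
  obtain ⟨V, r, w, h1, h2, h3⟩ := h.system
  exact ⟨hpq, hp, hq, ⟨V, r, w, hsub.trans h1, h2, h3⟩, fun x hx y hy =>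
    h.isClosed_sat x ⟨hx.1, hsub hx.2⟩ y ⟨hy.1, hsub hy.2⟩⟩

/-- The essential locus does not accumulate at `b` from the right. -/
def GInt.RightIsolated (X : GInt G I) (b : I) : Prop := ∀ᶠ y in 𝓝[>] b, y ∈ X.pre {t | Ess G t}ᶜ

/-- The essential locus does not accumulate at `a` from the left. -/
def GInt.LeftIsolated (X : GInt G I) (a : I) : Prop := ∀ᶠ y in 𝓝[<] a, y ∈ X.pre {t | Ess G t}ᶜ

theorem GInt.mem_pre_compl_ess {X : GInt G I} {x : I} :
    x ∈ X.pre {t | Ess G t}ᶜ ↔ x ∈ X.dom ∧ x ∉ X.ess := by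
  rw [X.pre_compl isSaturated_ess]; rfl

variable [Oriented G] [ClosedUnderRestriction G]

theorem CommutingSystem.map {X : GInt G I} {V : Set I} {r : ℕ} {w : ℕ → I → I}
    (h : CommutingSystem X V r w) (κ : I ≃o I) :
    CommutingSystem (X.map κ) (κ.symm ⁻¹' V) r (fun i => κ ∘ w i ∘ κ.symm) where
  isOpen := h.isOpen.preimage κ.symm.continuous
  ordConnected := h.ordConnected.preimage_mono κ.symm.monotone
  subset x hx := by rw [GInt.dom_map]; exact h.subset hx
  eq_id i hi := by ext x; simp [h.eq_id i hi]
  mono i x hx y hy hxy := κ.strictMono (h.mono i hx hy (κ.symm.strictMono hxy))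
  germ i x hx := GAtlas.Germ.comp (f := w i ∘ κ.symm) (f' := κ)
    (X.germ_map κ (h.germ i _ hx).map_mem_dom)
    (GAtlas.Germ.comp (f := κ.symm) (f' := w i) (h.germ i _ hx) (X.germ_map_symm κ (h.subset hx)))
  comm i j x hx := by simp [h.comm i j _ hx]
  fix x hx := by
    have h1 : (X.map κ).orb x = X.orb (κ.symm x) := by simpa using X.orb_map κ (κ.symm x)
    rw [GInt.ess_eq_of_orb_eq h1, h.fix _ hx]
    simp only [Function.comp_apply, OrderIso.eq_symm_apply]

theorem IsCore.map {R : ℕ∞} {X : GInt G I} {a b : I} (h : IsCore R X a b) (κ : I ≃o I) :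
    IsCore R (X.map κ) (κ a) (κ b) := by
  have h1 : ∀ x, (X.map κ).orb x = X.orb (κ.symm x) := fun x => by
    simpa using X.orb_map κ (κ.symm x)
  have h2 : ∀ x, x ∈ (X.map κ).ess ↔ κ.symm x ∈ X.ess := fun x => GInt.ess_eq_of_orb_eq (h1 x)
  have h3 : ∀ x, x ∈ Icc (κ a) (κ b) ↔ κ.symm x ∈ Icc a b := fun x => by
    simp [mem_Icc, OrderIso.le_symm_apply, OrderIso.symm_apply_le]
  obtain ⟨V, r, w, k1, k2, k3⟩ := h.system
  refine ⟨κ.monotone h.le, (h2 _).2 (by simpa using h.left_mem),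
    (h2 _).2 (by simpa using h.right_mem), ⟨κ.symm ⁻¹' V, r, _,
      fun x hx => k1 ((h3 x).1 hx), k2, k3.map κ⟩, ?_⟩
  rintro p ⟨hp, hp'⟩ q ⟨hq, hq'⟩ hpq
  have := h.isClosed_sat _ ⟨(h2 p).1 hp, (h3 p).1 hp'⟩ _ ⟨(h2 q).1 hq, (h3 q).1 hq'⟩
    (κ.symm.monotone hpq)
  convert this using 1
  ext t
  constructor
  · rintro ⟨x, hx, ht⟩
    exact ⟨κ.symm x, ⟨κ.symm.monotone hx.1, κ.symm.monotone hx.2⟩, h1 x ▸ ht⟩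
  · rintro ⟨x, hx, ht⟩
    refine ⟨κ x, ⟨?_, ?_⟩, (X.orb_map κ x).symm ▸ ht⟩
    · rw [← OrderIso.symm_apply_le]; exact hx.1
    · rw [← OrderIso.le_symm_apply]; exact hx.2

/-- Cores can be concatenated at a point around which all orbits are essential, since the two
systems of maps are the identity near this point. -/
theorem IsCore.glue {R : ℕ∞} {X₁ X₂ : GInt G I} {a m b : I} {t : T} (h₁ : IsCore R X₁ a m)
    (h₂ : IsCore R X₂ m b) (ht₁ : t ∈ X₁.orb m) (ht₂ : t ∈ X₂.orb m) (hE₁ : X₁.ess ∈ 𝓝 m) :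
    ∃ X : GInt G I, IsCore R X a b ∧ (∀ x ≤ m, X.orb x = X₁.orb x) ∧
      ∀ x, m ≤ x → X.orb x = X₂.orb x := by
  have hE₂ : X₂.ess ∈ 𝓝 m := GInt.eventually_transfer ht₁ ht₂ hE₁
  obtain ⟨X, hdom, hL, hR, ht⟩ := exists_glue X₁ X₂ ht₁ ht₂
  have hoL : ∀ x ≤ m, X.orb x = X₁.orb x := by
    intro x hx
    rcases hx.eq_or_lt with rfl | hlt
    · exact GAtlas.orb_eq_orb_of_mem ht ht₁
    by_cases hd : x ∈ X₁.dom
    · exact (hL x hd hlt).orb_eq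
    · have hd' : x ∉ X.dom := by
        rw [hdom]
        exact fun h => h.elim (fun h => hd h.1) fun h => absurd h.2 (not_le.2 hlt)
      rw [GAtlas.mem_dom_iff, not_nonempty_iff_eq_empty] at hd hd'
      rw [hd, hd']
  have hoR : ∀ x, m ≤ x → X.orb x = X₂.orb x := by
    intro x hx
    rcases hx.eq_or_lt with rfl | hlt
    · exact GAtlas.orb_eq_orb_of_mem ht ht₂
    by_cases hd : x ∈ X₂.dom
    · exact (hR x hd hlt).orb_eq
    · have hd' : x ∉ X.dom := by
        rw [hdom]
        exact fun h => h.elim (fun h => absurd h.2 (not_le.2 hlt)) fun h => hd h.1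
      rw [GAtlas.mem_dom_iff, not_nonempty_iff_eq_empty] at hd hd'
      rw [hd, hd']
  refine ⟨X, ?_, hoL, hoR⟩
  have hEL : ∀ x ≤ m, x ∈ X.ess ↔ x ∈ X₁.ess := fun x hx => GInt.ess_eq_of_orb_eq (hoL x hx)
  have hER : ∀ x, m ≤ x → (x ∈ X.ess ↔ x ∈ X₂.ess) := fun x hx => GInt.ess_eq_of_orb_eq (hoR x hx)
  obtain ⟨V₁, r₁, w₁, hV₁, hr₁, s₁⟩ := h₁.system
  obtain ⟨V₂, r₂, w₂, hV₂, hr₂, s₂⟩ := h₂.system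
  have hm₁ : m ∈ V₁ := hV₁ ⟨h₁.le, le_rfl⟩
  have hm₂ : m ∈ V₂ := hV₂ ⟨le_rfl, h₂.le⟩
  have hf₁ : ∀ i, w₁ i m = m := (s₁.fix m hm₁).1 h₁.right_mem
  have hf₂ : ∀ i, w₂ i m = m := (s₂.fix m hm₂).1 h₂.left_mem
  have hlt₁ : ∀ i, ∀ x ∈ V₁, x < m → w₁ i x < m := fun i x hx h => by
    have := s₁.mono i hx hm₁ h
    rwa [hf₁] at this
  have hlt₂ : ∀ i, ∀ x ∈ V₂, m < x → m < w₂ i x := fun i x hx h => by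
    have := s₂.mono i hm₂ hx h
    rwa [hf₂] at this
  -- the maps of the first system on the left of `m`, those of the second one on the right
  let V := V₁ ∩ Iic m ∪ V₂ ∩ Ici m
  let w : ℕ → I → I := fun i x => if x ≤ m then w₁ i x else w₂ i x
  have hwL : ∀ i, ∀ x ≤ m, w i x = w₁ i x := fun i x hx => if_pos hx
  have hwR : ∀ i x, m < x → w i x = w₂ i x := fun i x hx => if_neg (not_le.2 hx)
  have hL' : ∀ x ∈ X₁.dom, x < m → X.Germ X₁.toGAtlas id x := fun x hx h =>
    GAtlas.Germ.symm (e := OpenPartialHomeomorph.refl I) (by simp) (hL x hx h)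
  have hR' : ∀ x ∈ X₂.dom, m < x → X.Germ X₂.toGAtlas id x := fun x hx h =>
    GAtlas.Germ.symm (e := OpenPartialHomeomorph.refl I) (by simp) (hR x hx h)
  have hnear : ∀ i, ∀ᶠ x in 𝓝 m, w i x = x := by
    intro i
    filter_upwards [hE₁, hE₂, s₁.isOpen.mem_nhds hm₁, s₂.isOpen.mem_nhds hm₂] with x k1 k2 k3 k4
    rcases le_or_gt x m with h | h
    · rw [hwL i x h]; exact (s₁.fix x k3).1 k1 i
    · rw [hwR i x h]; exact (s₂.fix x k4).1 k2 i
  have hVsub : V ⊆ X.dom := by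
    rw [hdom]
    exact union_subset_union (inter_subset_inter_left _ s₁.subset)
      (inter_subset_inter_left _ s₂.subset)
  have htri : ∀ x ∈ V, (x < m ∧ x ∈ V₁) ∨ x = m ∨ (m < x ∧ x ∈ V₂) := by
    rintro x (⟨h1, h2⟩ | ⟨h1, h2⟩)
    · exact (mem_Iic.1 h2).eq_or_lt.elim (fun h => .inr (.inl h)) fun h => .inl ⟨h, h1⟩
    · exact (mem_Ici.1 h2).eq_or_lt.elim (fun h => .inr (.inl h.symm)) fun h => .inr (.inr ⟨h, h1⟩)
  have sys : CommutingSystem X V (max r₁ r₂) w := by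
    refine ⟨?_, ?_, hVsub, ?_, ?_, ?_, ?_, ?_⟩
    · rw [isOpen_iff_mem_nhds]
      intro x hx
      rcases htri x hx with ⟨h, hx1⟩ | rfl | ⟨h, hx2⟩
      · filter_upwards [s₁.isOpen.mem_nhds hx1, Iio_mem_nhds h] with y k1 k2
        exact Or.inl ⟨k1, mem_Iic.2 (mem_Iio.1 k2).le⟩
      · filter_upwards [s₁.isOpen.mem_nhds hm₁, s₂.isOpen.mem_nhds hm₂] with y k1 k2
        exact (le_total y x).elim (fun h => Or.inl ⟨k1, h⟩) fun h => Or.inr ⟨k2, h⟩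
      · filter_upwards [s₂.isOpen.mem_nhds hx2, Ioi_mem_nhds h] with y k1 k2
        exact Or.inr ⟨k1, mem_Ici.2 (mem_Ioi.1 k2).le⟩
    · refine ⟨fun x hx y hy z hz => ?_⟩
      rcases le_total z m with h | h
      · have hx1 : x ∈ V₁ := by
          rcases htri x hx with ⟨_, hx1⟩ | rfl | ⟨h', _⟩
          · exact hx1
          · exact hm₁
          · exact absurd (hz.1.trans h) (not_le.2 h')
        exact Or.inl ⟨s₁.ordConnected.out hx1 hm₁ ⟨hz.1, h⟩, h⟩
      · have hy1 : y ∈ V₂ := by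
          rcases htri y hy with ⟨h', _⟩ | rfl | ⟨_, hy1⟩
          · exact absurd (h.trans hz.2) (not_le.2 h')
          · exact hm₂
          · exact hy1
        exact Or.inr ⟨s₂.ordConnected.out hm₂ hy1 ⟨h, hz.2⟩, h⟩
    · intro i hi
      ext1 x
      rcases le_or_gt x m with h | h
      · rw [hwL i x h, s₁.eq_id i ((le_max_left _ _).trans hi)]
      · rw [hwR i x h, s₂.eq_id i ((le_max_right _ _).trans hi)]
    · intro i x hx y hy hxy
      rcases le_or_gt y m with h | h
      · have hx1 : x ∈ V₁ := by
          rcases htri x hx with ⟨_, hx1⟩ | rfl | ⟨h', _⟩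
          · exact hx1
          · exact hm₁
          · exact absurd (hxy.le.trans h) (not_le.2 h')
        have hy1 : y ∈ V₁ := s₁.ordConnected.out hx1 hm₁ ⟨hxy.le, h⟩
        rw [hwL i x (hxy.le.trans h), hwL i y h]
        exact s₁.mono i hx1 hy1 hxy
      · have hy2 : y ∈ V₂ := by
          rcases htri y hy with ⟨h', _⟩ | rfl | ⟨_, hy1⟩
          · exact absurd h (not_lt.2 h'.le)
          · exact hm₂
          · exact hy1
        rw [hwR i y h]
        rcases htri x hx with ⟨h', hx1⟩ | rfl | ⟨h', hx2⟩
        · rw [hwL i x h'.le]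
          exact (hlt₁ i x hx1 h').trans (hlt₂ i y hy2 h)
        · rw [hwL i x le_rfl, hf₁]
          exact hlt₂ i y hy2 h
        · rw [hwR i x h']
          exact s₂.mono i hx2 hy2 hxy
    · intro i x hx
      rcases htri x hx with ⟨h, hx1⟩ | rfl | ⟨h, hx2⟩
      · refine ((hL _ (s₁.germ i x hx1).map_mem_dom (hlt₁ i x hx1 h)).comp
          ((s₁.germ i x hx1).comp (hL' x (s₁.subset hx1) h))).congr ?_
        filter_upwards [Iio_mem_nhds h] with y hy
        exact hwL i y (le_of_lt hy)
      · exact (GAtlas.germ_id (hVsub hx)).congr (hnear i)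
      · refine ((hR _ (s₂.germ i x hx2).map_mem_dom (hlt₂ i x hx2 h)).comp
          ((s₂.germ i x hx2).comp (hR' x (s₂.subset hx2) h))).congr ?_
        filter_upwards [Ioi_mem_nhds h] with y hy
        exact hwR i y hy
    · intro i j x hx
      rcases htri x hx with ⟨h, hx1⟩ | rfl | ⟨h, hx2⟩
      · rw [hwL j x h.le, hwL i x h.le, hwL _ _ (hlt₁ j x hx1 h).le, hwL _ _ (hlt₁ i x hx1 h).le]
        exact s₁.comm i j x hx1
      · rw [hwL j x le_rfl, hwL i x le_rfl, hf₁, hf₁, hwL j x le_rfl, hwL i x le_rfl, hf₁, hf₁]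
      · rw [hwR j x h, hwR i x h, hwR _ _ (hlt₂ j x hx2 h), hwR _ _ (hlt₂ i x hx2 h)]
        exact s₂.comm i j x hx2
    · intro x hx
      rcases htri x hx with ⟨h, hx1⟩ | rfl | ⟨h, hx2⟩
      · rw [hEL x h.le, s₁.fix x hx1]
        exact forall_congr' fun i => by rw [hwL i x h.le]
      · rw [hEL x le_rfl, s₁.fix x hm₁]
        exact forall_congr' fun i => by rw [hwL i x le_rfl]
      · rw [hER x h.le, s₂.fix x hx2]
        exact forall_congr' fun i => by rw [hwR i x h]
  have hsatL : ∀ p q, q ≤ m → X.sat (Icc p q) = X₁.sat (Icc p q) := fun p q hq => by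
    ext s
    exact exists_congr fun x => and_congr_right fun hx => by rw [hoL x (hx.2.trans hq)]
  have hsatR : ∀ p q, m ≤ p → X.sat (Icc p q) = X₂.sat (Icc p q) := fun p q hp => by
    ext s
    exact exists_congr fun x => and_congr_right fun hx => by rw [hoR x (hp.trans hx.1)]
  refine ⟨h₁.le.trans h₂.le, (hEL a h₁.le).2 h₁.left_mem, (hER b h₂.le).2 h₂.right_mem,
    ⟨V, _, w, fun x hx => ?_, ?_, sys⟩, ?_⟩
  · exact (le_total x m).elim (fun h => Or.inl ⟨hV₁ ⟨hx.1, h⟩, h⟩) fun h => Or.inr ⟨hV₂ ⟨h, hx.2⟩, h⟩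
  · rcases max_choice r₁ r₂ with h | h <;> rw [h] <;> assumption
  · rintro p ⟨hpE, hp⟩ q ⟨hqE, hq⟩ hpq
    rcases le_total q m with h | h
    · rw [hsatL p q h]
      exact h₁.isClosed_sat p ⟨(hEL p (hpq.trans h)).1 hpE, hp.1, hpq.trans h⟩ q
        ⟨(hEL q h).1 hqE, hq.1, h⟩ hpq
    rcases le_total m p with h' | h'
    · rw [hsatR p q h']
      exact h₂.isClosed_sat p ⟨(hER p h').1 hpE, h', hp.2⟩ q
        ⟨(hER q h).1 hqE, h, hq.2⟩ hpq
    · have : X.sat (Icc p q) = X₁.sat (Icc p m) ∪ X₂.sat (Icc m q) := by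
        rw [← hsatL p m le_rfl, ← hsatR m q le_rfl]
        ext s
        constructor
        · rintro ⟨x, hx, hs⟩
          exact (le_total x m).elim (fun h => Or.inl ⟨x, ⟨hx.1, h⟩, hs⟩)
            fun h => Or.inr ⟨x, ⟨h, hx.2⟩, hs⟩
        · rintro (⟨x, hx, hs⟩ | ⟨x, hx, hs⟩)
          · exact ⟨x, ⟨hx.1, hx.2.trans h⟩, hs⟩
          · exact ⟨x, ⟨h'.trans hx.1, hx.2⟩, hs⟩
      rw [this]
      exact (h₁.isClosed_sat p ⟨(hEL p h').1 hpE, hp.1, h'⟩ m ⟨h₁.right_mem, h₁.le, le_rfl⟩ h').union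
        (h₂.isClosed_sat m ⟨h₂.left_mem, le_rfl, h₂.le⟩ q ⟨(hER q h).1 hqE, h, hq.2⟩ h)

end

/-! ### Finitely many cores with isolated ends -/

section

variable {T : Type*} [TopologicalSpace T] [ChartedSpace I T] {G : StructureGroupoid T}

/-- The right end of `[a, b]` is isolated, or can be continued through essential orbits. -/
def GInt.RightEnd (X : GInt G I) (a b : I) : Prop := X.RightIsolated b ∨ (a < b ∧ X.ess ∈ 𝓝 b)

/-- The left end of `[a, b]` is isolated, or can be continued through essential orbits. -/
def GInt.LeftEnd (X : GInt G I) (a b : I) : Prop := X.LeftIsolated a ∨ (a < b ∧ X.ess ∈ 𝓝 a)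

theorem GInt.RightIsolated.not_ess_mem_nhds {X : GInt G I} {b : I} (h : X.RightIsolated b)
    (hb : b < 1) : X.ess ∉ 𝓝 b := by
  intro hE
  have := nhdsGT_neBot_of_exists_gt ⟨_, hb⟩
  obtain ⟨y, hy, hy'⟩ := (h.and (mem_nhdsWithin_of_mem_nhds hE)).exists
  exact (GInt.mem_pre_compl_ess.1 hy).2 hy'

theorem GInt.LeftIsolated.not_ess_mem_nhds {X : GInt G I} {b : I} (h : X.LeftIsolated b)
    (hb : 0 < b) : X.ess ∉ 𝓝 b := by
  intro hE
  have := nhdsLT_neBot_of_exists_lt ⟨_, hb⟩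
  obtain ⟨y, hy, hy'⟩ := (h.and (mem_nhdsWithin_of_mem_nhds hE)).exists
  exact (GInt.mem_pre_compl_ess.1 hy).2 hy'

/-- Whether all orbits close to a point are essential depends only on the orbit of this point. -/
theorem GInt.ess_mem_nhds_transfer {X Y : GInt G I} {x y : I} (h : X.ess ∈ 𝓝 x)
    (hxy : X.orb x = Y.orb y) : Y.ess ∈ 𝓝 y := by
  obtain ⟨t, ht, -⟩ := mem_of_mem_nhds h
  exact GInt.eventually_transfer ht (hxy ▸ ht) h

/-- The right half of a local core at a point `x₀` on an essential orbit. -/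
theorem exists_local_right {X : GInt G I} {V : Set I} (hV : IsOpen V) (hVc : V.OrdConnected)
    (hVd : V ⊆ X.dom) {x₀ : I} (hx₀ : x₀ ∈ V) (hE : x₀ ∈ X.ess) :
    ∃ b ∈ V, x₀ ≤ b ∧ b ∈ X.ess ∧ X.RightEnd x₀ b ∧ ∀ᶠ y in 𝓝 x₀, y ∈ X.ess → x₀ ≤ y →
      y ≤ b ∧ (y < b ∨ X.RightIsolated b) := by
  by_cases h1 : ∃ y ∈ V, x₀ < y ∧ y ∉ X.ess
  · obtain ⟨y, hyV, hy, hyE⟩ := h1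
    have hsub : Icc x₀ y ⊆ V := hVc.out hx₀ hyV
    obtain ⟨b, ⟨hbE, hb⟩, hgr⟩ := (X.isClosed_ess_inter isClosed_Icc
      (hsub.trans hVd)).isCompact.exists_isGreatest ⟨x₀, hE, le_rfl, hy.le⟩
    have hby : b < y := lt_of_le_of_ne hb.2 fun h => hyE (h ▸ hbE)
    have hiso : X.RightIsolated b := by
      filter_upwards [Ioo_mem_nhdsGT hby] with z hz
      have hz' : z ∈ Icc x₀ y := ⟨hb.1.trans hz.1.le, hz.2.le⟩
      exact GInt.mem_pre_compl_ess.2 ⟨hVd (hsub hz'), fun h => absurd (hgr ⟨h, hz'⟩) (not_le.2 hz.1)⟩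
    refine ⟨b, hsub hb, hb.1, hbE, Or.inl hiso, ?_⟩
    filter_upwards [Iio_mem_nhds hy] with z hz hzE hz'
    exact ⟨hgr ⟨hzE, hz', le_of_lt hz⟩, Or.inr hiso⟩
  · push Not at h1
    by_cases h2 : ∃ b ∈ V, x₀ < b
    · obtain ⟨b, hb, hlt⟩ := h2
      refine ⟨b, hb, hlt.le, h1 b hb hlt, Or.inr ⟨hlt, ?_⟩, ?_⟩
      · filter_upwards [hV.mem_nhds hb, Ioi_mem_nhds hlt] with y hy hy' using h1 y hy hy'
      · filter_upwards [Iio_mem_nhds hlt] with z hz _ _ using ⟨le_of_lt hz, Or.inl hz⟩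
    · push Not at h2
      have hiso : X.RightIsolated x₀ := by
        filter_upwards [self_mem_nhdsWithin, mem_nhdsWithin_of_mem_nhds (hV.mem_nhds hx₀)]
          with y hy hyV
        exact absurd hy (not_lt.2 (h2 y hyV))
      refine ⟨x₀, hx₀, le_rfl, hE, Or.inl hiso, ?_⟩
      filter_upwards [hV.mem_nhds hx₀] with y hy _ _ using ⟨h2 y hy, Or.inr hiso⟩

/-- The mirror image of `exists_local_right`. -/
theorem exists_local_left {X : GInt G I} {V : Set I} (hV : IsOpen V) (hVc : V.OrdConnected)
    (hVd : V ⊆ X.dom) {x₀ : I} (hx₀ : x₀ ∈ V) (hE : x₀ ∈ X.ess) :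
    ∃ a ∈ V, a ≤ x₀ ∧ a ∈ X.ess ∧ X.LeftEnd a x₀ ∧ ∀ᶠ y in 𝓝 x₀, y ∈ X.ess → y ≤ x₀ →
      a ≤ y ∧ (a < y ∨ X.LeftIsolated a) := by
  by_cases h1 : ∃ y ∈ V, y < x₀ ∧ y ∉ X.ess
  · obtain ⟨y, hyV, hy, hyE⟩ := h1
    have hsub : Icc y x₀ ⊆ V := hVc.out hyV hx₀
    obtain ⟨b, ⟨hbE, hb⟩, hls⟩ := (X.isClosed_ess_inter isClosed_Icc
      (hsub.trans hVd)).isCompact.exists_isLeast ⟨x₀, hE, hy.le, le_rfl⟩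
    have hby : y < b := lt_of_le_of_ne hb.1 fun h => hyE (h ▸ hbE)
    have hiso : X.LeftIsolated b := by
      filter_upwards [Ioo_mem_nhdsLT hby] with z hz
      have hz' : z ∈ Icc y x₀ := ⟨hz.1.le, hz.2.le.trans hb.2⟩
      exact GInt.mem_pre_compl_ess.2 ⟨hVd (hsub hz'), fun h => absurd (hls ⟨h, hz'⟩) (not_le.2 hz.2)⟩
    refine ⟨b, hsub hb, hb.2, hbE, Or.inl hiso, ?_⟩
    filter_upwards [Ioi_mem_nhds hy] with z hz hzE hz'
    exact ⟨hls ⟨hzE, le_of_lt hz, hz'⟩, Or.inr hiso⟩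
  · push Not at h1
    by_cases h2 : ∃ b ∈ V, b < x₀
    · obtain ⟨b, hb, hlt⟩ := h2
      refine ⟨b, hb, hlt.le, h1 b hb hlt, Or.inr ⟨hlt, ?_⟩, ?_⟩
      · filter_upwards [hV.mem_nhds hb, Iio_mem_nhds hlt] with y hy hy' using h1 y hy hy'
      · filter_upwards [Ioi_mem_nhds hlt] with z hz _ _ using ⟨le_of_lt hz, Or.inl hz⟩
    · push Not at h2
      have hiso : X.LeftIsolated x₀ := by
        filter_upwards [self_mem_nhdsWithin, mem_nhdsWithin_of_mem_nhds (hV.mem_nhds hx₀)]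
          with y hy hyV
        exact absurd hy (not_lt.2 (h2 y hyV))
      refine ⟨x₀, hx₀, le_rfl, hE, Or.inl hiso, ?_⟩
      filter_upwards [hV.mem_nhds hx₀] with y hy _ _ using ⟨h2 y hy, Or.inr hiso⟩

variable [Oriented G]

theorem GInt.RightIsolated.transfer {X Y : GInt G I} {x y : I} (h : X.RightIsolated x)
    (hx : x ∈ X.dom) (hxy : X.orb x = Y.orb y) : Y.RightIsolated y := by
  obtain ⟨t, ht⟩ := GAtlas.mem_dom_iff.1 hx
  exact GInt.eventually_gt_transfer ht (hxy ▸ ht) h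

theorem GInt.LeftIsolated.transfer {X Y : GInt G I} {x y : I} (h : X.LeftIsolated x)
    (hx : x ∈ X.dom) (hxy : X.orb x = Y.orb y) : Y.LeftIsolated y := by
  obtain ⟨t, ht⟩ := GAtlas.mem_dom_iff.1 hx
  exact GInt.eventually_lt_transfer ht (hxy ▸ ht) h

variable [ClosedUnderRestriction G]

/-- A finite family of cores such that every essential orbit is met, away from the ends that are not
isolated. -/
structure CoreFamily (R : ℕ∞) {ι : Type*} (Y : ι → GInt G I) (a b : ι → I) : Prop where
  isCore : ∀ k, IsCore R (Y k) (a k) (b k)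
  right : ∀ k, (Y k).RightEnd (a k) (b k)
  left : ∀ k, (Y k).LeftEnd (a k) (b k)
  cover : ∀ t, Ess G t → ∃ k, ∃ x ∈ Icc (a k) (b k), t ∈ (Y k).orb x ∧
    (x < b k ∨ (Y k).RightIsolated (b k)) ∧ (a k < x ∨ (Y k).LeftIsolated (a k))

/-- A core can be extended to the right until its right end is isolated. The extension stops because
each right end used is strictly larger, for the order between orbits, than those used before. -/
theorem CoreFamily.exists_extend_right {R : ℕ∞} {ι : Type*} [Finite ι] {Y : ι → GInt G I}
    {a b : ι → I} (hY : CoreFamily R Y a b) {X : GInt G I} {p q : I} (hX : IsCore R X p q)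
    (hq : X.RightEnd p q) : ∃ (X' : GInt G I) (q' : I), q ≤ q' ∧ IsCore R X' p q' ∧
      X'.RightIsolated q' ∧ ∀ x ≤ q, X'.orb x = X.orb x := by
  classical
  have := Fintype.ofFinite ι
  let S : T → Finset ι := fun t => Finset.univ.filter fun k => ∃ t' ∈ (Y k).orb (b k), Prec G t t'
  -- `S t` counts the right ends beyond `t`; it decreases with each extension
  suffices H : ∀ (n : ℕ) (X : GInt G I) (q : I) (t : T), t ∈ X.orb q → (S t).card ≤ n →
      IsCore R X p q → X.RightEnd p q → ∃ (X' : GInt G I) (q' : I), q ≤ q' ∧ IsCore R X' p q' ∧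
        X'.RightIsolated q' ∧ ∀ x ≤ q, X'.orb x = X.orb x by
    obtain ⟨t, ht, -⟩ := hX.right_mem
    exact H _ X q t ht le_rfl hX hq
  intro n
  induction n with
  | zero => ?_
  | succ n ih => ?_
  all_goals
    intro X q t ht hn hX hq
    by_cases hiso : X.RightIsolated q
    · exact ⟨X, q, le_rfl, hX, hiso, fun _ _ => rfl⟩
    obtain ⟨hpq, hE⟩ := hq.resolve_left hiso
    have hq0 : 0 < q := unitInterval.nonneg'.trans_lt hpq
    have hq1 : q < 1 := by
      refine lt_of_le_of_ne unitInterval.le_one' fun h => hiso ?_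
      subst h
      have : 𝓝[>] (1 : I) = ⊥ := by
        rw [show Ioi (1 : I) = ∅ from Ioi_eq_empty_iff.2 isMax_top, nhdsWithin_empty]
      rw [GInt.RightIsolated, this]
      exact eventually_bot
    have htE : Ess G t := (GInt.mem_ess_iff ht).1 hX.right_mem
    obtain ⟨k, x, hx, htx, hxb, -⟩ := hY.cover t htE
    have hxb' : x < b k := by
      refine hxb.elim id fun h => lt_of_le_of_ne hx.2 fun h' => ?_
      subst h'
      exact h.not_ess_mem_nhds (GInt.lt_one_of_orb ht htx hq1)
        (GInt.ess_mem_nhds_transfer hE (GAtlas.orb_eq_orb_of_mem ht htx))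
    obtain ⟨s, hs, hsE⟩ := (hY.isCore k).right_mem
    have hts : Prec G t s := ⟨Y k, x, b k, hxb', htx, hs⟩
    have hkS : k ∈ S t := Finset.mem_filter.2 ⟨Finset.mem_univ _, s, hs, hts⟩
  · exact absurd (Finset.card_pos.2 ⟨k, hkS⟩) (by omega)
  · have hlt : (S s).card < (S t).card := by
      refine Finset.card_lt_card ⟨fun j hj => ?_, fun h => ?_⟩
      · obtain ⟨-, t', h1, h2⟩ := Finset.mem_filter.1 hj
        exact Finset.mem_filter.2 ⟨Finset.mem_univ _, t', h1, hts.trans h2⟩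
      · obtain ⟨-, t', h1, h2⟩ := Finset.mem_filter.1 (h hkS)
        refine hsE.1 (h2.of_mem_orbit (mem_orbit_self s) ?_)
        rw [← GAtlas.orb_eq_of_mem h1]
        exact hs
    -- move `x` to `q`, in order to concatenate the part of the core `k` beyond `x`
    obtain ⟨κ, hκ⟩ := GInt.exists_orderIso_of_orb ht htx hq0 hq1
    have hxE : x ∈ (Y k).ess := ⟨t, htx, htE⟩
    have h2 := ((hY.isCore k).sub hxE (hY.isCore k).right_mem hx.1 hxb'.le le_rfl).map κ
    rw [hκ] at h2
    have htm : t ∈ ((Y k).map κ).orb q := by rw [← hκ, GInt.orb_map]; exact htx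
    obtain ⟨X₁, h3, h4, h5⟩ := hX.glue h2 ht htm hE
    have hqb : q < κ (b k) := hκ ▸ κ.strictMono hxb'
    have horb : X₁.orb (κ (b k)) = (Y k).orb (b k) := by rw [h5 _ hqb.le, GInt.orb_map]
    have hend : X₁.RightEnd p (κ (b k)) := by
      rcases hY.right k with h | ⟨-, h⟩
      · exact Or.inl (h.transfer (GInt.ess_subset_dom _ (hY.isCore k).right_mem) horb.symm)
      · exact Or.inr ⟨hpq.trans hqb, GInt.ess_mem_nhds_transfer h horb.symm⟩
    obtain ⟨X', q', k1, k2, k3, k4⟩ := ih X₁ (κ (b k)) s (horb ▸ hs) (by omega) h3 hend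
    exact ⟨X', q', hqb.le.trans k1, k2, k3, fun y hy => by rw [k4 y (hy.trans hqb.le), h4 y hy]⟩

/-- The mirror image of `CoreFamily.exists_extend_right`. -/
theorem CoreFamily.exists_extend_left {R : ℕ∞} {ι : Type*} [Finite ι] {Y : ι → GInt G I}
    {a b : ι → I} (hY : CoreFamily R Y a b) {X : GInt G I} {p q : I} (hX : IsCore R X p q)
    (hp : X.LeftEnd p q) : ∃ (X' : GInt G I) (p' : I), p' ≤ p ∧ IsCore R X' p' q ∧
      X'.LeftIsolated p' ∧ ∀ x, p ≤ x → X'.orb x = X.orb x := by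
  classical
  have := Fintype.ofFinite ι
  let S : T → Finset ι := fun t => Finset.univ.filter fun k => ∃ t' ∈ (Y k).orb (a k), Prec G t' t
  suffices H : ∀ (n : ℕ) (X : GInt G I) (p : I) (t : T), t ∈ X.orb p → (S t).card ≤ n →
      IsCore R X p q → X.LeftEnd p q → ∃ (X' : GInt G I) (p' : I), p' ≤ p ∧ IsCore R X' p' q ∧
        X'.LeftIsolated p' ∧ ∀ x, p ≤ x → X'.orb x = X.orb x by
    obtain ⟨t, ht, -⟩ := hX.left_mem
    exact H _ X p t ht le_rfl hX hp
  intro n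
  induction n with
  | zero => ?_
  | succ n ih => ?_
  all_goals
    intro X p t ht hn hX hp
    by_cases hiso : X.LeftIsolated p
    · exact ⟨X, p, le_rfl, hX, hiso, fun _ _ => rfl⟩
    obtain ⟨hpq, hE⟩ := hp.resolve_left hiso
    have hp1 : p < 1 := hpq.trans_le unitInterval.le_one'
    have hp0 : 0 < p := by
      refine lt_of_le_of_ne unitInterval.nonneg' fun h => hiso ?_
      subst h
      have : 𝓝[<] (0 : I) = ⊥ := by
        rw [show Iio (0 : I) = ∅ from Iio_eq_empty_iff.2 isMin_bot, nhdsWithin_empty]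
      rw [GInt.LeftIsolated, this]
      exact eventually_bot
    have htE : Ess G t := (GInt.mem_ess_iff ht).1 hX.left_mem
    obtain ⟨k, x, hx, htx, -, hxa⟩ := hY.cover t htE
    have hxa' : a k < x := by
      refine hxa.elim id fun h => lt_of_le_of_ne hx.1 fun h' => ?_
      subst h'
      exact h.not_ess_mem_nhds (GInt.pos_of_orb ht htx hp0)
        (GInt.ess_mem_nhds_transfer hE (GAtlas.orb_eq_orb_of_mem ht htx))
    obtain ⟨s, hs, hsE⟩ := (hY.isCore k).left_mem
    have hts : Prec G s t := ⟨Y k, a k, x, hxa', hs, htx⟩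
    have hkS : k ∈ S t := Finset.mem_filter.2 ⟨Finset.mem_univ _, s, hs, hts⟩
  · exact absurd (Finset.card_pos.2 ⟨k, hkS⟩) (by omega)
  · have hlt : (S s).card < (S t).card := by
      refine Finset.card_lt_card ⟨fun j hj => ?_, fun h => ?_⟩
      · obtain ⟨-, t', h1, h2⟩ := Finset.mem_filter.1 hj
        exact Finset.mem_filter.2 ⟨Finset.mem_univ _, t', h1, h2.trans hts⟩
      · obtain ⟨-, t', h1, h2⟩ := Finset.mem_filter.1 (h hkS)
        refine hsE.1 (h2.of_mem_orbit ?_ (mem_orbit_self s))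
        rw [← GAtlas.orb_eq_of_mem h1]
        exact hs
    obtain ⟨κ, hκ⟩ := GInt.exists_orderIso_of_orb ht htx hp0 hp1
    have hxE : x ∈ (Y k).ess := ⟨t, htx, htE⟩
    have h2 := ((hY.isCore k).sub (hY.isCore k).left_mem hxE le_rfl hxa'.le hx.2).map κ
    rw [hκ] at h2
    have htm : t ∈ ((Y k).map κ).orb p := by rw [← hκ, GInt.orb_map]; exact htx
    have hE' : ((Y k).map κ).ess ∈ 𝓝 p :=
      GInt.ess_mem_nhds_transfer hE (GAtlas.orb_eq_orb_of_mem ht htm)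
    obtain ⟨X₁, h3, h4, h5⟩ := h2.glue hX htm ht hE'
    have hap : κ (a k) < p := hκ ▸ κ.strictMono hxa'
    have horb : X₁.orb (κ (a k)) = (Y k).orb (a k) := by rw [h4 _ hap.le, GInt.orb_map]
    have hend : X₁.LeftEnd (κ (a k)) q := by
      rcases hY.left k with h | ⟨-, h⟩
      · exact Or.inl (h.transfer (GInt.ess_subset_dom _ (hY.isCore k).left_mem) horb.symm)
      · exact Or.inr ⟨hap.trans hpq, GInt.ess_mem_nhds_transfer h horb.symm⟩
    obtain ⟨X', p', k1, k2, k3, k4⟩ := ih X₁ (κ (a k)) s (horb ▸ hs) (by omega) h3 hend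
    exact ⟨X', p', k1.trans hap.le, k2, k3, fun y hy => by rw [k4 y (hap.le.trans hy), h5 y hy]⟩

/-- All the cores of a family can be extended to both sides until their ends are isolated. -/
theorem CoreFamily.exists_isolated {R : ℕ∞} {ι : Type*} [Finite ι] {Y : ι → GInt G I}
    {a b : ι → I} (hY : CoreFamily R Y a b) : ∃ (X : ι → GInt G I) (p q : ι → I),
      (∀ k, IsCore R (X k) (p k) (q k)) ∧ (∀ k, (X k).LeftIsolated (p k)) ∧
      (∀ k, (X k).RightIsolated (q k)) ∧
      ∀ t, Ess G t → ∃ k, ∃ x ∈ Icc (p k) (q k), t ∈ (X k).orb x := by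
  have key : ∀ k, ∃ (X : GInt G I) (p q : I), IsCore R X p q ∧ X.LeftIsolated p ∧
      X.RightIsolated q ∧ p ≤ a k ∧ b k ≤ q ∧ ∀ x ∈ Icc (a k) (b k), X.orb x = (Y k).orb x := by
    intro k
    have hk := hY.isCore k
    obtain ⟨X, q, h1, h2, h3, h4⟩ := hY.exists_extend_right hk (hY.right k)
    have hl : X.LeftEnd (a k) q := by
      rcases hY.left k with h | ⟨h, h'⟩
      · exact Or.inl (h.transfer (GInt.ess_subset_dom _ hk.left_mem) (h4 _ hk.le).symm)
      · exact Or.inr ⟨h.trans_le h1, GInt.ess_mem_nhds_transfer h' (h4 _ hk.le).symm⟩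
    obtain ⟨X', p, k1, k2, k3, k4⟩ := hY.exists_extend_left h2 hl
    refine ⟨X', p, q, k2, k3, h3.transfer (GInt.ess_subset_dom _ h2.right_mem) (k4 q h2.le).symm,
      k1, h1, fun x hx => by rw [k4 x hx.1, h4 x hx.2]⟩
  choose X p q h1 h2 h3 h4 h5 h6 using key
  refine ⟨X, p, q, h1, h2, h3, fun t ht => ?_⟩
  obtain ⟨k, x, hx, htx, -⟩ := hY.cover t ht
  exact ⟨k, x, ⟨(h4 k).trans hx.1, hx.2.trans (h5 k)⟩, by rw [h6 k x hx]; exact htx⟩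

variable [T2Space T]

/-- Every essential orbit lies on a core that contains all the essential orbits close to it. -/
theorem Ess.exists_local_core {U : Set T} (hU : IsExhaustive G U)
    (hUc : IsCompact (closure U)) {P : Set (OpenPartialHomeomorph T T × Set T)}
    (hP : IsFiniteSystem G U P) (hcomm : ∀ t, IsEssential G t → ∀ a b : Isotropy G t, a * b = b * a)
    {t : T} (ht : Ess G t) :
    ∃ (O : Set T) (X : GInt G I) (a b : I), IsOpen O ∧ t ∈ O ∧ IsCore (essentialRank G) X a b ∧
      X.RightEnd a b ∧ X.LeftEnd a b ∧ ∀ s ∈ O, Ess G s → ∃ x ∈ Icc a b, s ∈ X.orb x ∧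
        (x < b ∨ X.RightIsolated b) ∧ (a < x ∨ X.LeftIsolated a) := by
  obtain ⟨t', ht't, ht'U⟩ := hU.2 t
  have ht' : Ess G t' := ht.of_mem_orbit ht't
  obtain ⟨X, x₀, V, r, w, htx, hx₀, hr, hsys, hcl⟩ :=
    ht'.exists_commutingSystem hU hUc hP ht'U (hcomm t' ht'.isEssential)
  have hE : x₀ ∈ X.ess := ⟨t', htx, ht'⟩
  obtain ⟨b, hbV, hxb, hbE, hbR, hb⟩ :=
    exists_local_right hsys.isOpen hsys.ordConnected hsys.subset hx₀ hE
  obtain ⟨a, haV, hxa, haE, haL, ha⟩ :=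
    exists_local_left hsys.isOpen hsys.ordConnected hsys.subset hx₀ hE
  have hab : Icc a b ⊆ V := hsys.ordConnected.out haV hbV
  obtain ⟨N, hN, hNo, hxN⟩ := eventually_nhds_iff.1 (ha.and hb)
  refine ⟨X.sat N, X, a, b, X.isOpen_sat hNo,
    X.isSaturated_sat N t' ⟨x₀, hxN, htx⟩ t (mem_orbit_symm ht't),
    ⟨hxa.trans hxb, haE, hbE, ⟨V, r, w, hab, hr, hsys⟩, fun p hp q hq hpq =>
      hcl p ⟨hp.1, hab hp.2⟩ q ⟨hq.1, hab hq.2⟩ hpq⟩, ?_, ?_, ?_⟩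
  · exact hbR.imp_right fun h => ⟨hxa.trans_lt h.1, h.2⟩
  · exact haL.imp_right fun h => ⟨h.1.trans_le hxb, h.2⟩
  · rintro s ⟨y, hy, hs⟩ hsE
    have hyE : y ∈ X.ess := ⟨s, hs, hsE⟩
    obtain ⟨h1, h2⟩ := hN y hy
    rcases le_total y x₀ with h | h
    · obtain ⟨k1, k2⟩ := h1 hyE h
      refine ⟨y, ⟨k1, h.trans hxb⟩, hs, ?_, k2⟩
      exact hbR.symm.imp_left fun h' => h.trans_lt h'.1
    · obtain ⟨k1, k2⟩ := h2 hyE h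
      refine ⟨y, ⟨hxa.trans h, k1⟩, hs, k2, ?_⟩
      exact haL.symm.imp_left fun h' => h'.1.trans_le h

/-- Since the set of essential points in `closure U` is compact, finitely many local cores meet all
the essential orbits. -/
theorem exists_coreFamily {U : Set T} (hU : IsExhaustive G U)
    (hUc : IsCompact (closure U)) {P : Set (OpenPartialHomeomorph T T × Set T)}
    (hP : IsFiniteSystem G U P)
    (hcomm : ∀ t, IsEssential G t → ∀ a b : Isotropy G t, a * b = b * a) :
    ∃ (n : ℕ) (Y : Fin n → GInt G I) (a b : Fin n → I), CoreFamily (essentialRank G) Y a b := by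
  have hEc : IsClosed {t : T | Ess G t} := ⟨isOpen_compl_ess⟩
  have hK : IsCompact ({t : T | Ess G t} ∩ closure U) := hUc.inter_left hEc
  choose O X a b h1 h2 h3 h4 h5 h6 using
    fun t : {t : T // Ess G t} => t.2.exists_local_core hU hUc hP hcomm
  obtain ⟨F, hF⟩ := hK.elim_finite_subcover O h1
    fun t ht => mem_iUnion.2 ⟨⟨t, ht.1⟩, h2 _⟩
  let e := F.equivFin.symm
  refine ⟨F.card, fun k => X (e k), fun k => a (e k), fun k => b (e k),
    fun k => h3 _, fun k => h4 _, fun k => h5 _, fun t ht => ?_⟩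
  obtain ⟨t', ht't, ht'U⟩ := hU.2 t
  have ht' : Ess G t' := ht.of_mem_orbit ht't
  obtain ⟨i, hi, hit⟩ := mem_iUnion₂.1 (hF ⟨ht', subset_closure ht'U⟩)
  obtain ⟨x, k1, k2, k3⟩ := h6 i t' hit ht'
  refine ⟨F.equivFin ⟨i, hi⟩, x, ?_, ?_, ?_⟩
  all_goals simp only [e, Equiv.symm_apply_apply]
  · exact k1
  · rw [GAtlas.orb_eq_of_mem k2]; exact mem_orbit_symm ht't
  · exact k3

end

/-! ### Disjoint cores -/

/-- A compact subset `K'` of `[0,1]` is covered by finitely many intervals disjoint from a given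
closed set `K''`, with disjoint traces on `K'`, and maximal with these properties. -/
theorem exists_finite_hulls {K' K'' : Set I} (hK' : IsCompact K') (hK'' : IsClosed K'')
    (hd : Disjoint K' K'') : ∃ (m : ℕ) (p q : Fin m → I),
      (∀ i, p i ∈ K' ∧ q i ∈ K' ∧ p i ≤ q i ∧ Disjoint (Icc (p i) (q i)) K'') ∧
      (∀ x ∈ K', ∃ i, x ∈ Icc (p i) (q i)) ∧
      (∀ i j, ∀ x ∈ K', x ∈ Icc (p i) (q i) → x ∈ Icc (p j) (q j) → i = j) ∧
      (∀ i, ∀ y ∈ K', q i < y → ¬ Disjoint (Icc (q i) y) K'') ∧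
      ∀ i, ∀ y ∈ K', y < p i → ¬ Disjoint (Icc y (p i)) K'' := by
  classical
  -- `O x` is the set of the points that are not separated from `x` by `K''`. The intervals are the
  -- convex hulls of the traces on `K'` of these equivalence classes, which are open.
  let O : I → Set I := fun x => {y | Disjoint (uIcc x y) K''}
  have hsymm : ∀ {x y}, y ∈ O x → x ∈ O y := fun {x y} h => by
    change Disjoint (uIcc y x) K''
    rw [uIcc_comm]; exact h
  have htrans : ∀ {x y z}, y ∈ O x → z ∈ O y → z ∈ O x := fun h h' =>
    (disjoint_union_left.2 ⟨h, h'⟩).mono_left uIcc_subset_uIcc_union_uIcc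
  have hself : ∀ x ∈ K', x ∈ O x := fun x hx => by
    change Disjoint (uIcc x x) K''
    rw [uIcc_self, Set.disjoint_singleton_left]
    exact Set.disjoint_left.1 hd hx
  have hO : ∀ x, IsOpen (O x) := by
    intro x
    rw [isOpen_iff_mem_nhds]
    intro y hy
    have hy' : y ∉ K'' := Set.disjoint_left.1 hy right_mem_uIcc
    obtain ⟨V, hV1, hV2, hV3, hV4⟩ := exists_ordConnected_nhds (hK''.isOpen_compl.mem_nhds hy')
    filter_upwards [hV1.mem_nhds hV3] with z hz
    exact htrans hy (Set.disjoint_left.2 fun v hv => hV4 (hV2.uIcc_subset hV3 hz hv))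
  have hcl : ∀ x, IsCompact (K' ∩ O x) := by
    intro x
    have : K' ∩ O x = K' ∩ (⋃ y ∈ K' \ O x, O y)ᶜ := by
      ext z
      simp only [mem_inter_iff, mem_compl_iff, mem_iUnion₂, not_exists]
      refine and_congr_right fun hz => ⟨fun h y hy hzy => hy.2 (htrans h (hsymm hzy)), fun h => ?_⟩
      by_contra hzx
      exact h z ⟨hz, hzx⟩ (hself z hz)
    rw [this]
    exact hK'.inter_right (isOpen_biUnion fun y _ => hO y).isClosed_compl
  have hp : ∀ x ∈ K', ∃ p, IsLeast (K' ∩ O x) p := fun x hx =>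
    (hcl x).exists_isLeast ⟨x, hx, hself x hx⟩
  have hq : ∀ x ∈ K', ∃ q, IsGreatest (K' ∩ O x) q := fun x hx =>
    (hcl x).exists_isGreatest ⟨x, hx, hself x hx⟩
  choose! p hp using hp
  choose! q hq using hq
  have hpq : ∀ x ∈ K', Disjoint (Icc (p x) (q x)) K'' := fun x hx =>
    (htrans (hsymm (hp x hx).1.2) (hq x hx).1.2 : Disjoint (uIcc (p x) (q x)) K'').mono_left
      Icc_subset_uIcc
  have hle : ∀ x ∈ K', p x ≤ q x := fun x hx => (hp x hx).2 (hq x hx).1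
  have hmem : ∀ x ∈ K', ∀ z ∈ K', z ∈ Icc (p x) (q x) → z ∈ O x := fun x hx z hz h =>
    htrans (hp x hx).1.2 ((hpq x hx).mono_left (by
      rw [uIcc_of_le h.1]; exact Icc_subset_Icc_right h.2))
  obtain ⟨F, hFK, hF⟩ := hK'.elim_nhds_subcover O fun x hx => (hO x).mem_nhds (hself x hx)
  let PQ : Finset (I × I) := F.image fun x => (p x, q x)
  have hPQ : ∀ b ∈ PQ, ∃ x ∈ K', b = (p x, q x) := fun b hb => by
    obtain ⟨x, hx, rfl⟩ := Finset.mem_image.1 hb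
    exact ⟨x, hFK x hx, rfl⟩
  let e := PQ.equivFin.symm
  refine ⟨PQ.card, fun i => (e i).1.1, fun i => (e i).1.2, ?_, ?_, ?_, ?_, ?_⟩
  · intro i
    obtain ⟨x, hx, h⟩ := hPQ _ (e i).2
    simp only [h]
    exact ⟨(hp x hx).1.1, (hq x hx).1.1, hle x hx, hpq x hx⟩
  · intro x hx
    obtain ⟨y, hy, hxy⟩ := mem_iUnion₂.1 (hF hx)
    refine ⟨PQ.equivFin ⟨(p y, q y), Finset.mem_image_of_mem _ hy⟩, ?_⟩
    simp only [e, Equiv.symm_apply_apply]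
    exact ⟨(hp y (hFK y hy)).2 ⟨hx, hxy⟩, (hq y (hFK y hy)).2 ⟨hx, hxy⟩⟩
  · intro i j z hz hi hj
    obtain ⟨x, hx, h⟩ := hPQ _ (e i).2
    obtain ⟨y, hy, h'⟩ := hPQ _ (e j).2
    simp only [h] at hi
    simp only [h'] at hj
    have hzx := hmem x hx z hz hi
    have hzy := hmem y hy z hz hj
    have hOO : O x = O y := by
      ext v
      exact ⟨fun hv => htrans (htrans hzy (hsymm hzx)) hv,
        fun hv => htrans (htrans hzx (hsymm hzy)) hv⟩
    have h1 : p x = p y := (hOO ▸ hp x hx : IsLeast (K' ∩ O y) (p x)).unique (hp y hy)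
    have h2 : q x = q y := (hOO ▸ hq x hx : IsGreatest (K' ∩ O y) (q x)).unique (hq y hy)
    exact e.injective (Subtype.ext (by rw [h, h', h1, h2]))
  · intro i y hy hlt hdis
    obtain ⟨x, hx, h⟩ := hPQ _ (e i).2
    simp only [h] at hlt hdis
    refine absurd ((hq x hx).2 ⟨hy, htrans (hq x hx).1.2 ?_⟩) (not_le.2 hlt)
    change Disjoint (uIcc _ _) _
    rwa [uIcc_of_le hlt.le]
  · intro i y hy hlt hdis
    obtain ⟨x, hx, h⟩ := hPQ _ (e i).2
    simp only [h] at hlt hdis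
    refine absurd ((hp x hx).2 ⟨hy, htrans (hp x hx).1.2 ?_⟩) (not_le.2 hlt)
    change Disjoint (uIcc _ _) _
    rwa [uIcc_of_ge hlt.le]

section

variable {T : Type*} [TopologicalSpace T] [ChartedSpace I T] {G : StructureGroupoid T}

/-- The saturation of an interval with isolated ends is open relatively to the essential locus. -/
theorem GInt.eventually_pre_sat_of_ess {Z : Type*} [TopologicalSpace Z] {X : GInt G I}
    {Y : GAtlas G Z} {a b : I} (ha : X.LeftIsolated a) (hb : X.RightIsolated b) {y : Z}
    (hy : y ∈ Y.pre (X.sat (Icc a b))) :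
    ∀ᶠ z in 𝓝 y, z ∈ Y.pre {t | Ess G t} → z ∈ Y.pre (X.sat (Icc a b)) := by
  obtain ⟨t, hty, f, hf, htf⟩ := hy
  have hd : ∀ᶠ z in 𝓝 f, z ∈ X.dom := X.isOpen_dom.mem_nhds (GAtlas.mem_dom_iff.2 ⟨t, htf⟩)
  have hl : ∀ᶠ z in 𝓝 f, z ∈ X.pre {t | Ess G t}ᶜ ∨ a ≤ z := by
    rcases hf.1.eq_or_lt with rfl | h
    · filter_upwards [eventually_nhdsWithin_iff.1 ha] with z hz
      exact (lt_or_ge z a).imp hz id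
    · filter_upwards [Ioi_mem_nhds h] with z hz using Or.inr (le_of_lt hz)
  have hr : ∀ᶠ z in 𝓝 f, z ∈ X.pre {t | Ess G t}ᶜ ∨ z ≤ b := by
    rcases hf.2.eq_or_lt with rfl | h
    · filter_upwards [eventually_nhdsWithin_iff.1 hb] with z hz
      exact (lt_or_ge f z).imp hz id
    · filter_upwards [Iio_mem_nhds h] with z hz using Or.inr (le_of_lt hz)
  obtain ⟨e, he, rfl, hG⟩ := GAtlas.exists_germ_of_orb_eq hty htf
  filter_upwards [e.open_source.mem_nhds he, (e.continuousAt he).eventually hd,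
    (e.continuousAt he).eventually hl, (e.continuousAt he).eventually hr] with z h1 h2 h3 h4 h5
  have horb := (hG z h1).orb_eq
  have h6 : e z ∈ X.ess := (GAtlas.pre_iff_of_orb_eq horb).2 h5
  have h7 : e z ∉ X.pre {t | Ess G t}ᶜ := fun h => (GInt.mem_pre_compl_ess.1 h).2 h6
  obtain ⟨s, hs⟩ := GAtlas.mem_dom_iff.1 h2
  exact ⟨s, horb ▸ hs, e z, ⟨h3.resolve_left h7, h4.resolve_left h7⟩, hs⟩

/-- Finitely many cores with isolated ends can be cut into pieces that meet each essential orbit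
exactly once. -/
theorem exists_disjoint_cores {R : ℕ∞} {n : ℕ} {X : Fin n → GInt G I} {a b : Fin n → I}
    (hX : ∀ k, IsCore R (X k) (a k) (b k)) (ha : ∀ k, (X k).LeftIsolated (a k))
    (hb : ∀ k, (X k).RightIsolated (b k))
    (hcov : ∀ t, Ess G t → ∃ k, ∃ x ∈ Icc (a k) (b k), t ∈ (X k).orb x) :
    ∃ (l : ℕ) (Y : Fin l → GInt G I) (p q : Fin l → I),
      (∀ k, IsCore R (Y k) (p k) (q k)) ∧ (∀ k, (Y k).LeftIsolated (p k)) ∧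
      (∀ k, (Y k).RightIsolated (q k)) ∧
      (∀ t, Ess G t → ∃ k, ∃ x ∈ Icc (p k) (q k), t ∈ (Y k).orb x) ∧
      ∀ i j, ∀ x ∈ Icc (p i) (q i), ∀ y ∈ Icc (p j) (q j), x ∈ (Y i).ess →
        (Y i).orb x = (Y j).orb y → i = j := by
  let C : Fin n → Set T := fun k => (X k).sat (Icc (a k) (b k))
  have hCs : ∀ k, IsSaturated G (C k) := fun k => (X k).isSaturated_sat _
  have hCc : ∀ k, IsClosed (C k) := fun k => (hX k).isClosed_sat _ ⟨(hX k).left_mem, le_rfl, (hX k).le⟩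
    _ ⟨(hX k).right_mem, (hX k).le, le_rfl⟩ (hX k).le
  have hdom : ∀ k, Icc (a k) (b k) ⊆ (X k).dom := fun k => (X k).ordConnected.out
    (GInt.ess_subset_dom _ (hX k).left_mem) (GInt.ess_subset_dom _ (hX k).right_mem)
  -- the essential points `K k` of the core `k` are divided into those which are met by an earlier core
  -- and those which are not; both sets are closed, by isolation of the ends for the latter
  let K : Fin n → Set I := fun k => (X k).ess ∩ Icc (a k) (b k)
  have hK : ∀ k, IsClosed (K k) := fun k => (X k).isClosed_ess_inter isClosed_Icc (hdom k)
  let K'' : Fin n → Set I := fun k => {x ∈ K k | ∃ j < k, x ∈ (X k).pre (C j)}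
  let K' : Fin n → Set I := fun k => {x ∈ K k | ∀ j < k, x ∉ (X k).pre (C j)}
  have hK'' : ∀ k, IsClosed (K'' k) := by
    intro k
    have : K'' k = ⋃ j ∈ {j | j < k}, (X k).pre (C j) ∩ K k := by
      ext x
      simp only [K'', mem_ofPred_eq, mem_iUnion, mem_inter_iff, exists_prop]
      exact ⟨fun ⟨h, j, hj, hx⟩ => ⟨j, hj, hx, h⟩, fun ⟨j, hj, hx, h⟩ => ⟨h, j, hj, hx⟩⟩
    rw [this]
    exact (toFinite _).isClosed_biUnion fun j _ =>
      (X k).isClosed_pre_inter (hCs j) (hCc j) (hK k) (inter_subset_right.trans (hdom k))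
  have hK' : ∀ k, IsCompact (K' k) := by
    intro k
    refine IsClosed.isCompact ?_
    rw [← isOpen_compl_iff, isOpen_iff_mem_nhds]
    intro x hx
    by_cases hxK : x ∈ K k
    · have : ∃ j < k, x ∈ (X k).pre (C j) := by
        by_contra h
        push Not at h
        exact hx ⟨hxK, h⟩
      obtain ⟨j, hj, hxj⟩ := this
      filter_upwards [GInt.eventually_pre_sat_of_ess (ha j) (hb j) hxj] with z hz hzK
      exact hzK.2 j hj (hz hzK.1.1)
    · filter_upwards [(hK k).isOpen_compl.mem_nhds hxK] with z hz hzK using hz hzK.1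
  have hdisj : ∀ k, Disjoint (K' k) (K'' k) := fun k => Set.disjoint_left.2 fun x hx hx' => by
    obtain ⟨-, j, hj, hxj⟩ := hx'
    exact hx.2 j hj hxj
  have hmem : ∀ k, ∀ x ∈ K k, x ∉ K'' k → x ∈ K' k := fun k x hx hx' =>
    ⟨hx, fun j hj h => hx' ⟨hx, j, hj, h⟩⟩
  choose m p q h1 h2 h3 h4 h5 using fun k => exists_finite_hulls (hK' k) (hK'' k) (hdisj k)
  have hin : ∀ k i, ∀ x ∈ Icc (p k i) (q k i), x ∈ (X k).ess → x ∈ K' k := fun k i x hx hE =>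
    hmem k x ⟨hE, (h1 k i).1.1.2.1.trans hx.1, hx.2.trans (h1 k i).2.1.1.2.2⟩
      (Set.disjoint_left.1 (h1 k i).2.2.2 hx)
  suffices H : (∀ k i, IsCore R (X k) (p k i) (q k i)) ∧ (∀ k i, (X k).LeftIsolated (p k i)) ∧
      (∀ k i, (X k).RightIsolated (q k i)) ∧
      (∀ t, Ess G t → ∃ k i, ∃ x ∈ Icc (p k i) (q k i), t ∈ (X k).orb x) ∧
      ∀ c c' : Σ k, Fin (m k), ∀ x ∈ Icc (p c.1 c.2) (q c.1 c.2), ∀ y ∈ Icc (p c'.1 c'.2) (q c'.1 c'.2),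
        x ∈ (X c.1).ess → (X c.1).orb x = (X c'.1).orb y → c = c' by
    obtain ⟨H1, H2, H3, H4, H5⟩ := H
    let e := (Fintype.equivFin (Σ k, Fin (m k))).symm
    refine ⟨_, fun c => X (e c).1, fun c => p (e c).1 (e c).2, fun c => q (e c).1 (e c).2,
      fun c => H1 _ _, fun c => H2 _ _, fun c => H3 _ _, fun t ht => ?_,
      fun c c' x hx y hy hE hxy => e.injective (H5 _ _ x hx y hy hE hxy)⟩
    obtain ⟨k, i, x, hx, htx⟩ := H4 t ht
    obtain ⟨c, hc⟩ := e.surjective ⟨k, i⟩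
    exact ⟨c, x, by beta_reduce; rw [hc]; exact hx, by beta_reduce; rw [hc]; exact htx⟩
  refine ⟨fun k i => ?_, fun k i => ?_, fun k i => ?_, fun t ht => ?_, ?_⟩
  · obtain ⟨k1, k2, k3, -⟩ := h1 k i
    exact (hX k).sub k1.1.1 k2.1.1 k1.1.2.1 k3 k2.1.2.2
  · obtain ⟨k1, -⟩ := h1 k i
    change ∀ᶠ y in 𝓝[<] p k i, y ∈ (X k).pre {t | Ess G t}ᶜ
    rcases k1.1.2.1.eq_or_lt with h | h
    · rw [← h]; exact ha k
    have hnK : p k i ∉ K'' k := Set.disjoint_left.1 (hdisj k) k1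
    obtain ⟨V, hV1, hV2, hV3, hV4⟩ := exists_ordConnected_nhds ((hK'' k).isOpen_compl.mem_nhds hnK)
    filter_upwards [self_mem_nhdsWithin, mem_nhdsWithin_of_mem_nhds (hV1.mem_nhds hV3),
      mem_nhdsWithin_of_mem_nhds (Ioi_mem_nhds h)] with y hy hyV hya
    have hyI : y ∈ Icc (a k) (b k) := ⟨le_of_lt hya, (le_of_lt hy).trans k1.1.2.2⟩
    refine GInt.mem_pre_compl_ess.2 ⟨hdom k hyI, fun hE => ?_⟩
    exact h5 k i y (hmem k y ⟨hE, hyI⟩ (hV4 hyV)) hy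
      (Set.disjoint_left.2 fun v hv => hV4 (hV2.out hyV hV3 hv))
  · obtain ⟨-, k1, -⟩ := h1 k i
    change ∀ᶠ y in 𝓝[>] q k i, y ∈ (X k).pre {t | Ess G t}ᶜ
    rcases k1.1.2.2.eq_or_lt with h | h
    · rw [h]; exact hb k
    have hnK : q k i ∉ K'' k := Set.disjoint_left.1 (hdisj k) k1
    obtain ⟨V, hV1, hV2, hV3, hV4⟩ := exists_ordConnected_nhds ((hK'' k).isOpen_compl.mem_nhds hnK)
    filter_upwards [self_mem_nhdsWithin, mem_nhdsWithin_of_mem_nhds (hV1.mem_nhds hV3),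
      mem_nhdsWithin_of_mem_nhds (Iio_mem_nhds h)] with y hy hyV hyb
    have hyI : y ∈ Icc (a k) (b k) := ⟨k1.1.2.1.trans (le_of_lt hy), le_of_lt hyb⟩
    refine GInt.mem_pre_compl_ess.2 ⟨hdom k hyI, fun hE => ?_⟩
    exact h4 k i y (hmem k y ⟨hE, hyI⟩ (hV4 hyV)) hy
      (Set.disjoint_left.2 fun v hv => hV4 (hV2.out hV3 hyV hv))
  · -- an essential orbit is represented in the first core that it meets
    obtain ⟨k, ⟨x, hx, htx⟩, hmin⟩ :=
      (wellFounded_lt (α := Fin n)).has_min {k | ∃ x ∈ Icc (a k) (b k), t ∈ (X k).orb x} (hcov t ht)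
    have hxK : x ∈ K' k := by
      refine ⟨⟨⟨t, htx, ht⟩, hx⟩, fun j hj hxj => hmin j ?_ hj⟩
      exact GAtlas.mem_of_mem_pre (hCs j) hxj htx
    obtain ⟨i, hi⟩ := h2 k x hxK
    exact ⟨k, i, x, hi, htx⟩
  · rintro ⟨k, i⟩ ⟨k', i'⟩ x hx y hy hE hxy
    dsimp only at hx hy hE hxy
    have hE' : y ∈ (X k').ess := (GInt.ess_eq_of_orb_eq hxy).1 hE
    obtain ⟨t, ht⟩ := GAtlas.mem_dom_iff.1 (GInt.ess_subset_dom _ hE)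
    have hxK := hin k i x hx hE
    have hyK := hin k' i' y hy hE'
    rcases lt_trichotomy k k' with hlt | rfl | hlt
    · exact absurd ⟨t, hxy ▸ ht, x, hxK.1.2, ht⟩ (hyK.2 k hlt)
    · obtain rfl := GInt.eq_of_orb_eq_of_ess hxy hE
      rw [h3 k i i' x hxK hx hy]
    · exact absurd ⟨t, ht, y, hyK.1.2, hxy ▸ ht⟩ (hxK.2 k' hlt)

end

/-! ### Dynamics near a core -/

section Dynamics

variable {α : Type*} [ConditionallyCompleteLinearOrder α] [TopologicalSpace α] [OrderTopology α]
  [DenselyOrdered α] {w : ℕ → α → α} {b c : α} {S : Set α}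

/-- A set that is invariant under increasing maps fixing `b`, without other common fixed points,
accumulates at `b`: any greater infimum would be moved by one of the maps. -/
theorem isGLB_of_invariant (hmono : ∀ i, StrictMonoOn (w i) (Icc b c))
    (hcont : ∀ i, ContinuousOn (w i) (Icc b c)) (hb : ∀ i, w i b = b)
    (hfix : ∀ x ∈ Ioc b c, ∃ i, w i x ≠ x) (hS : S ⊆ Ioc b c) (hne : S.Nonempty)
    (h1 : ∀ i, ∀ y ∈ S, w i y ∈ Ioc b c → w i y ∈ S)
    (h2 : ∀ i, ∀ y ∈ Ioc b c, w i y ∈ S → y ∈ S) : IsGLB S b := by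
  have hbdd : BddBelow S := ⟨b, fun y hy => (hS hy).1.le⟩
  have hglb := isGLB_csInf hne hbdd
  set s := sInf S
  have hbs : b ≤ s := hglb.2 fun y hy => (hS hy).1.le
  rcases hbs.eq_or_lt with h | hlt
  · rwa [h]
  exfalso
  obtain ⟨y₀, hy₀⟩ := hne
  have hsc : s ≤ c := (hglb.1 hy₀).trans (hS hy₀).2
  have hbc : b ≤ c := hbs.trans hsc
  have hfr : ∃ᶠ y in 𝓝 s, y ∈ S := (hglb.frequently_mem ⟨y₀, hy₀⟩).filter_mono nhdsWithin_le_nhds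
  have hpos : ∀ i, ∀ y ∈ Ioc b c, b < w i y := fun i y hy => by
    have := hmono i ⟨le_rfl, hbc⟩ ⟨hy.1.le, hy.2⟩ hy.1
    rwa [hb] at this
  obtain ⟨i, hi⟩ := hfix s ⟨hlt, hsc⟩
  rcases lt_or_gt_of_ne hi with hi | hi
  · have hev := eventually_nhdsWithin_iff.1 ((hcont i s ⟨hbs, hsc⟩).eventually (Iio_mem_nhds hi))
    obtain ⟨y, hyS, hy⟩ := (hfr.and_eventually hev).exists
    have hy' : w i y < s := hy ⟨(hS hyS).1.le, (hS hyS).2⟩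
    exact absurd (hglb.1 (h1 i y hyS ⟨hpos i y (hS hyS), hy'.le.trans hsc⟩)) (not_le.2 hy')
  · obtain ⟨y, hyS, hy⟩ := (hfr.and_eventually (Iio_mem_nhds hi)).exists
    have hsub : Icc b s ⊆ Icc b c := Icc_subset_Icc_right hsc
    obtain ⟨y', hy', hyy'⟩ := intermediate_value_Icc hbs ((hcont i).mono hsub)
      (show y ∈ Icc (w i b) (w i s) from ⟨by rw [hb]; exact (hS hyS).1.le, le_of_lt hy⟩)
    have hlt' : y' < s := by
      refine lt_of_le_of_ne hy'.2 fun h => ?_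
      rw [h] at hyy'
      exact absurd hy (by rw [hyy']; exact lt_irrefl y)
    have hby' : b < y' := by
      refine lt_of_le_of_ne hy'.1 fun h => ?_
      rw [← h, hb] at hyy'
      exact absurd (hS hyS).1 (by rw [hyy']; exact lt_irrefl y)
    exact absurd (hglb.1 (h2 i y' ⟨hby', hy'.2.trans hsc⟩ (hyy'.symm ▸ hyS))) (not_le.2 hlt')

/-- Such a set meets the interval `[d, c]` if `d` is so close to the fixed point `b` that no map
sends a point below `d` beyond `c`, or a point beyond `c` below `d`. -/
theorem exists_mem_ge_of_invariant {d : α} (hmono : ∀ i, StrictMonoOn (w i) (Icc b c))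
    (hcont : ∀ i, ContinuousOn (w i) (Icc b c)) (hfix : ∀ x ∈ Ioc b c, ∃ i, w i x ≠ x)
    (hd : d ∈ Ioo b c) (hd1 : ∀ i, d < w i c) (hd2 : ∀ i, w i d < c)
    (hS : S ⊆ Ioc b c) (hne : S.Nonempty) (h1 : ∀ i, ∀ y ∈ S, w i y ∈ Ioc b c → w i y ∈ S)
    (h2 : ∀ i, ∀ y ∈ Ioc b c, w i y ∈ S → y ∈ S) : ∃ y ∈ S, d ≤ y := by
  by_contra! hlt
  have hlub := isLUB_csSup hne ⟨d, fun y hy => (hlt y hy).le⟩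
  set s := sSup S
  obtain ⟨y₀, hy₀⟩ := id hne
  have hbs : b < s := (hS hy₀).1.trans_le (hlub.1 hy₀)
  have hsd : s ≤ d := hlub.2 fun y hy => (hlt y hy).le
  have hsc : s ≤ c := hsd.trans hd.2.le
  have hfr : ∃ᶠ y in 𝓝 s, y ∈ S := (hlub.frequently_mem hne).filter_mono nhdsWithin_le_nhds
  obtain ⟨i, hi⟩ := hfix s ⟨hbs, hsc⟩
  rcases lt_or_gt_of_ne hi with hi | hi
  · obtain ⟨y, hyS, hy⟩ := (hfr.and_eventually (Ioi_mem_nhds hi)).exists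
    have hy : w i s < y := hy
    obtain ⟨y', hy', hyy'⟩ := intermediate_value_Icc hsc
      ((hcont i).mono (Icc_subset_Icc_left hbs.le))
      (show y ∈ Icc (w i s) (w i c) from ⟨hy.le, (hlt y hyS).le.trans (hd1 i).le⟩)
    have hlt' : s < y' := by
      refine lt_of_le_of_ne hy'.1 fun h => ?_
      rw [← h] at hyy'
      exact absurd hy (by rw [hyy']; exact lt_irrefl y)
    exact absurd (hlub.1 (h2 i y' ⟨hbs.trans hlt', hy'.2⟩ (hyy'.symm ▸ hyS))) (not_le.2 hlt')
  · have hev := eventually_nhdsWithin_iff.1 ((hcont i s ⟨hbs.le, hsc⟩).eventually (Ioi_mem_nhds hi))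
    obtain ⟨y, hyS, hy⟩ := (hfr.and_eventually hev).exists
    have hyI : y ∈ Icc b c := ⟨(hS hyS).1.le, (hS hyS).2⟩
    have hy' : s < w i y := hy hyI
    have hyc : w i y < c := (hmono i hyI ⟨hd.1.le, hd.2.le⟩ (hlt y hyS)).trans (hd2 i)
    exact absurd (hlub.1 (h1 i y hyS ⟨hbs.trans hy', hyc.le⟩)) (not_le.2 hy')

end Dynamics

section

variable {T : Type*} [TopologicalSpace T] [ChartedSpace I T] {G : StructureGroupoid T}
  {X : GInt G I} {V : Set I} {r : ℕ} {w : ℕ → I → I}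

theorem CommutingSystem.continuousOn (h : CommutingSystem X V r w) (i : ℕ) :
    ContinuousOn (w i) V := fun x hx => (h.germ i x hx).continuousAt.continuousWithinAt

theorem CommutingSystem.orb_eq (h : CommutingSystem X V r w) (i : ℕ) {x : I} (hx : x ∈ V) :
    X.orb (w i x) = X.orb x := (h.germ i x hx).orb_eq

/-- On the right of an isolated right end `b`, some compact set without essential points meets all
the orbits close to the end. -/
theorem CommutingSystem.exists_fundamental_right (h : CommutingSystem X V r w) {b : I} (hbV : b ∈ V)
    (hbE : b ∈ X.ess) (hb : X.RightIsolated b) :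
    ∃ R L : Set I, IsOpen R ∧ R.OrdConnected ∧ Iic b ⊆ R ∧ IsCompact L ∧ L ⊆ X.dom \ X.ess ∧
      ∀ x ∈ R, b < x → x ∈ V ∧ x ∉ X.ess ∧ ∃ y ∈ L, X.orb y = X.orb x := by
  rcases (unitInterval.le_one' (t := b)).eq_or_lt with rfl | hb1
  · exact ⟨univ, ∅, isOpen_univ, ordConnected_univ, subset_univ _, isCompact_empty, empty_subset _,
      fun x _ hx => absurd unitInterval.le_one' (not_le.2 hx)⟩
  have hfb : ∀ i, w i b = b := (h.fix b hbV).1 hbE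
  obtain ⟨c', hbc', hc'⟩ := (mem_nhdsGT_iff_exists_Ioo_subset' hb1).1
    (inter_mem hb (mem_nhdsWithin_of_mem_nhds (h.isOpen.mem_nhds hbV)))
  obtain ⟨c, hbc, hcc'⟩ := exists_between (mem_Ioi.1 hbc')
  have hc : ∀ x ∈ Ioc b c, _ := fun x hx => hc' ⟨hx.1, hx.2.trans_lt hcc'⟩
  have hcV : Icc b c ⊆ V := h.ordConnected.out hbV (hc c ⟨hbc, le_rfl⟩).2
  have hcE : ∀ x ∈ Ioc b c, x ∉ X.ess := fun x hx => (GInt.mem_pre_compl_ess.1 (hc x hx).1).2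
  have hmono : ∀ i, StrictMonoOn (w i) (Icc b c) := fun i => (h.mono i).mono hcV
  have hcont : ∀ i, ContinuousOn (w i) (Icc b c) := fun i => (h.continuousOn i).mono hcV
  have hfix : ∀ x ∈ Ioc b c, ∃ i, w i x ≠ x := fun x hx => by
    have := mt (h.fix x (hcV ⟨hx.1.le, hx.2⟩)).2 (hcE x hx)
    push Not at this
    exact this
  -- `[b, c]` lies in `V` without essential points except `b`; choose `d` so close to `b` that the orbits
  -- in `(b, c]` cannot jump over `[d, c]`
  have hev : ∀ᶠ d in 𝓝 b, ∀ i ∈ {i | i < r}, d < w i c ∧ w i d < c := by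
    refine (eventually_all_finite (finite_lt_nat r)).2 fun i _ => ?_
    have h1 : b < w i c := by
      have := hmono i ⟨le_rfl, hbc.le⟩ ⟨hbc.le, le_rfl⟩ hbc
      rwa [hfb] at this
    have h2 := (h.germ i b hbV).continuousAt.eventually (Iio_mem_nhds (by rwa [hfb] : w i b < c))
    filter_upwards [Iio_mem_nhds h1, h2] with d k1 k2 using ⟨k1, k2⟩
  have := nhdsGT_neBot_of_exists_gt ⟨_, hb1⟩
  obtain ⟨d, hd, hdI⟩ := ((hev.filter_mono nhdsWithin_le_nhds).and (Ioo_mem_nhdsGT hbc)).exists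
  have hd' : ∀ i, d < w i c ∧ w i d < c := fun i => by
    by_cases hi : i < r
    · exact hd i hi
    · rw [h.eq_id i (not_lt.1 hi)]; exact ⟨hdI.2, hdI.2⟩
  refine ⟨Iio c, Icc d c, isOpen_Iio, ordConnected_Iio, Iic_subset_Iio.2 hbc, isCompact_Icc,
    fun x hx => ?_, fun x hx hbx => ?_⟩
  · have hx' : x ∈ Ioc b c := ⟨hdI.1.trans_le hx.1, hx.2⟩
    exact ⟨h.subset (hcV ⟨hx'.1.le, hx'.2⟩), hcE x hx'⟩
  · have hx' : x ∈ Ioc b c := ⟨hbx, le_of_lt hx⟩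
    refine ⟨hcV ⟨hx'.1.le, hx'.2⟩, hcE x hx', ?_⟩
    obtain ⟨y, hy, hdy⟩ := exists_mem_ge_of_invariant (S := {y ∈ Ioc b c | X.orb y = X.orb x}) hmono
      hcont hfix hdI (fun i => (hd' i).1) (fun i => (hd' i).2) (fun y hy => hy.1)
      ⟨x, hx', rfl⟩ (fun i y hy hy' => ⟨hy', by rw [h.orb_eq i (hcV ⟨hy.1.1.le, hy.1.2⟩), hy.2]⟩)
      (fun i y hy hy' => ⟨hy, by rw [← h.orb_eq i (hcV ⟨hy.1.le, hy.2⟩), hy'.2]⟩)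
    exact ⟨y, ⟨hdy, hy.1.2⟩, hy.2⟩

/-- The mirror image of `CommutingSystem.exists_fundamental_right`. -/
theorem CommutingSystem.exists_fundamental_left (h : CommutingSystem X V r w) {b : I} (hbV : b ∈ V)
    (hbE : b ∈ X.ess) (hb : X.LeftIsolated b) :
    ∃ R L : Set I, IsOpen R ∧ R.OrdConnected ∧ Ici b ⊆ R ∧ IsCompact L ∧ L ⊆ X.dom \ X.ess ∧
      ∀ x ∈ R, x < b → x ∈ V ∧ x ∉ X.ess ∧ ∃ y ∈ L, X.orb y = X.orb x := by
  rcases (unitInterval.nonneg' (t := b)).eq_or_lt with rfl | hb1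
  · exact ⟨univ, ∅, isOpen_univ, ordConnected_univ, subset_univ _, isCompact_empty, empty_subset _,
      fun x _ hx => absurd unitInterval.nonneg' (not_le.2 hx)⟩
  have hfb : ∀ i, w i b = b := (h.fix b hbV).1 hbE
  obtain ⟨c', hbc', hc'⟩ := (mem_nhdsLT_iff_exists_Ioo_subset' hb1).1
    (inter_mem hb (mem_nhdsWithin_of_mem_nhds (h.isOpen.mem_nhds hbV)))
  obtain ⟨c, hcc', hbc⟩ := exists_between (mem_Iio.1 hbc')
  have hc : ∀ x ∈ Ico c b, _ := fun x hx => hc' ⟨hcc'.trans_le hx.1, hx.2⟩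
  have hcV : Icc c b ⊆ V := h.ordConnected.out (hc c ⟨le_rfl, hbc⟩).2 hbV
  have hcE : ∀ x ∈ Ico c b, x ∉ X.ess := fun x hx => (GInt.mem_pre_compl_ess.1 (hc x hx).1).2
  have hmono : ∀ i, StrictMonoOn (w i) (Icc c b) := fun i => (h.mono i).mono hcV
  have hcont : ∀ i, ContinuousOn (w i) (Icc c b) := fun i => (h.continuousOn i).mono hcV
  have hfix : ∀ x ∈ Ico c b, ∃ i, w i x ≠ x := fun x hx => by
    have := mt (h.fix x (hcV ⟨hx.1, hx.2.le⟩)).2 (hcE x hx)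
    push Not at this
    exact this
  have hev : ∀ᶠ d in 𝓝 b, ∀ i ∈ {i | i < r}, w i c < d ∧ c < w i d := by
    refine (eventually_all_finite (finite_lt_nat r)).2 fun i _ => ?_
    have h1 : w i c < b := by
      have := hmono i ⟨le_rfl, hbc.le⟩ ⟨hbc.le, le_rfl⟩ hbc
      rwa [hfb] at this
    have h2 := (h.germ i b hbV).continuousAt.eventually (Ioi_mem_nhds (by rwa [hfb] : c < w i b))
    filter_upwards [Ioi_mem_nhds h1, h2] with d k1 k2 using ⟨k1, k2⟩
  have := nhdsLT_neBot_of_exists_lt ⟨_, hb1⟩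
  obtain ⟨d, hd, hdI⟩ := ((hev.filter_mono nhdsWithin_le_nhds).and (Ioo_mem_nhdsLT hbc)).exists
  have hd' : ∀ i, w i c < d ∧ c < w i d := fun i => by
    by_cases hi : i < r
    · exact hd i hi
    · rw [h.eq_id i (not_lt.1 hi)]; exact ⟨hdI.1, hdI.1⟩
  refine ⟨Ioi c, Icc c d, isOpen_Ioi, ordConnected_Ioi, Ici_subset_Ioi.2 hbc, isCompact_Icc,
    fun x hx => ?_, fun x hx hbx => ?_⟩
  · have hx' : x ∈ Ico c b := ⟨hx.1, hx.2.trans_lt hdI.2⟩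
    exact ⟨h.subset (hcV ⟨hx'.1, hx'.2.le⟩), hcE x hx'⟩
  · have hx' : x ∈ Ico c b := ⟨le_of_lt hx, hbx⟩
    refine ⟨hcV ⟨hx'.1, hx'.2.le⟩, hcE x hx', ?_⟩
    -- the previous dynamical lemma, for the opposite order
    obtain ⟨y, hy, hdy⟩ := exists_mem_ge_of_invariant (α := Iᵒᵈ) (w := w) (b := b) (c := c) (d := d)
      (S := {y | y ∈ Ico c b ∧ X.orb y = X.orb x})
      (fun i y hy z hz hyz => hmono i ⟨hz.2, hz.1⟩ ⟨hy.2, hy.1⟩ hyz)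
      (fun i => (hcont i).mono fun y hy => ⟨hy.2, hy.1⟩) (fun y hy => hfix y ⟨hy.2, hy.1⟩)
      ⟨hdI.2, hdI.1⟩ (fun i => (hd' i).1) (fun i => (hd' i).2)
      (fun y hy => ⟨hy.1.2, hy.1.1⟩) ⟨x, hx', rfl⟩
      (fun i y hy hy' => ⟨⟨hy'.2, hy'.1⟩, by rw [h.orb_eq i (hcV ⟨hy.1.1, hy.1.2.le⟩), hy.2]⟩)
      (fun i y hy hy' => ⟨⟨hy.2, hy.1⟩, by rw [← h.orb_eq i (hcV ⟨hy.2, hy.1.le⟩), hy'.2]⟩)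
    exact ⟨y, ⟨hy.1.1, hdy⟩, hy.2⟩

/-- A neighbourhood of a core with isolated ends, and a compact set met by all orbits that meet this
neighbourhood outside the core. -/
theorem CommutingSystem.exists_fundamental (h : CommutingSystem X V r w) {a b : I}
    (hab : Icc a b ⊆ V) (hle : a ≤ b) (haE : a ∈ X.ess) (hbE : b ∈ X.ess) (ha : X.LeftIsolated a)
    (hb : X.RightIsolated b) :
    ∃ Ω L : Set I, IsOpen Ω ∧ Ω.OrdConnected ∧ Icc a b ⊆ Ω ∧ Ω ⊆ V ∧ IsCompact L ∧
      L ⊆ X.dom \ X.ess ∧ ∀ x ∈ Ω, x ∉ Icc a b → x ∉ X.ess ∧ ∃ y ∈ L, X.orb y = X.orb x := by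
  obtain ⟨R, L, h1, h2, h3, h4, h5, h6⟩ :=
    h.exists_fundamental_right (hab ⟨hle, le_rfl⟩) hbE hb
  obtain ⟨R', L', k1, k2, k3, k4, k5, k6⟩ :=
    h.exists_fundamental_left (hab ⟨le_rfl, hle⟩) haE ha
  have key : ∀ x ∈ R ∩ R', x ∉ Icc a b → x ∈ V ∧ x ∉ X.ess ∧ ∃ y ∈ L ∪ L', X.orb y = X.orb x := by
    intro x hx hxab
    rcases lt_or_ge b x with hlt | hge
    · obtain ⟨m1, m2, y, hy, m3⟩ := h6 x hx.1 hlt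
      exact ⟨m1, m2, y, Or.inl hy, m3⟩
    · have hlt : x < a := by
        by_contra h'
        exact hxab ⟨not_lt.1 h', hge⟩
      obtain ⟨m1, m2, y, hy, m3⟩ := k6 x hx.2 hlt
      exact ⟨m1, m2, y, Or.inr hy, m3⟩
  refine ⟨R ∩ R', L ∪ L', h1.inter k1, h2.inter k2, fun x hx => ⟨h3 hx.2, k3 hx.1⟩, fun x hx => ?_,
    h4.union k4, union_subset h5 k5, fun x hx hxab => (key x hx hxab).2⟩
  by_cases hxab : x ∈ Icc a b
  · exact hab hxab
  · exact (key x hx hxab).1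

/-- A set of points near a core that is invariant under the commuting maps accumulates at the
core. -/
theorem CommutingSystem.inter_nonempty_of_invariant (h : CommutingSystem X V r w) {a b : I}
    (hab : Icc a b ⊆ V) (hle : a ≤ b) (haE : a ∈ X.ess) (hbE : b ∈ X.ess) {Ω : Set I}
    (hΩc : Ω.OrdConnected) (hΩ : Icc a b ⊆ Ω) (hΩV : Ω ⊆ V)
    (hΩE : ∀ x ∈ Ω, x ∉ Icc a b → x ∉ X.ess) {S : Set I} {x : I} (hxΩ : x ∈ Ω) (hxS : x ∈ S)
    (h1 : ∀ i, ∀ y ∈ Ω, y ∈ S → w i y ∈ Ω → w i y ∈ S)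
    (h2 : ∀ i, ∀ y ∈ Ω, w i y ∈ S → y ∈ S) {N : Set I} (hN : IsOpen N) (hNab : Icc a b ⊆ N) :
    (S ∩ N).Nonempty := by
  have haV := hab ⟨le_rfl, hle⟩
  have hbV := hab ⟨hle, le_rfl⟩
  have hmoved : ∀ y ∈ Ω, y ∉ Icc a b → ∃ i, w i y ≠ y := fun y hy hyab => by
    have := mt (h.fix y (hΩV hy)).2 (hΩE y hy hyab)
    push Not at this
    exact this
  by_cases hxab : x ∈ Icc a b
  · exact ⟨x, hxS, hNab hxab⟩
  rcases lt_or_ge b x with hlt | hge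
  · have hsub : Icc b x ⊆ Ω := hΩc.out (hΩ ⟨hle, le_rfl⟩) hxΩ
    have hsub' : Ioc b x ⊆ Ω := fun y hy => hsub ⟨hy.1.le, hy.2⟩
    have hglb : IsGLB (S ∩ Ioc b x) b := isGLB_of_invariant (c := x)
      (fun i => (h.mono i).mono (hsub.trans hΩV)) (fun i => (h.continuousOn i).mono (hsub.trans hΩV))
      ((h.fix b hbV).1 hbE) (fun y hy => hmoved y (hsub' hy) fun h' => absurd h'.2 (not_le.2 hy.1))
      inter_subset_right ⟨x, hxS, hlt, le_rfl⟩
      (fun i y hy hy' => ⟨h1 i y (hsub' hy.2) hy.1 (hsub' hy'), hy'⟩)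
      (fun i y hy hy' => ⟨h2 i y (hsub' hy) hy'.1, hy⟩)
    have hfr : ∃ᶠ y in 𝓝 b, y ∈ S ∩ Ioc b x :=
      (hglb.frequently_mem ⟨x, hxS, hlt, le_rfl⟩).filter_mono nhdsWithin_le_nhds
    obtain ⟨y, hy, hyN⟩ := (hfr.and_eventually (hN.mem_nhds (hNab ⟨hle, le_rfl⟩))).exists
    exact ⟨y, hy.1, hyN⟩
  · have hlt : x < a := by
      by_contra h'
      exact hxab ⟨not_lt.1 h', hge⟩
    have hsub : Icc x a ⊆ Ω := hΩc.out hxΩ (hΩ ⟨le_rfl, hle⟩)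
    have hsub' : Ico x a ⊆ Ω := fun y hy => hsub ⟨hy.1, hy.2.le⟩
    let S' : Set I := S ∩ Ico x a
    have hglb := isGLB_of_invariant (α := Iᵒᵈ) (w := w) (b := a) (c := x) (S := S')
      (fun i y hy z hz hyz => h.mono i (hΩV (hsub ⟨hz.2, hz.1⟩)) (hΩV (hsub ⟨hy.2, hy.1⟩)) hyz)
      (fun i => (h.continuousOn i).mono fun y hy => hΩV (hsub ⟨hy.2, hy.1⟩))
      ((h.fix a haV).1 haE)
      (fun y hy => hmoved y (hsub' ⟨hy.2, hy.1⟩) fun h' => absurd h'.1 (not_le.2 hy.1))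
      (fun y hy => ⟨hy.2.2, hy.2.1⟩) ⟨x, hxS, le_rfl, hlt⟩
      (fun i y hy hy' => ⟨h1 i y (hsub' hy.2) hy.1 (hsub' ⟨hy'.2, hy'.1⟩), hy'.2, hy'.1⟩)
      (fun i y hy hy' => ⟨h2 i y (hsub' ⟨hy.2, hy.1⟩) hy'.1, hy.2, hy.1⟩)
    have hlub : IsLUB (S ∩ Ico x a) a := hglb
    have hfr : ∃ᶠ y in 𝓝 a, y ∈ S ∩ Ico x a :=
      (hlub.frequently_mem ⟨x, hxS, le_rfl, hlt⟩).filter_mono nhdsWithin_le_nhds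
    obtain ⟨y, hy, hyN⟩ := (hfr.and_eventually (hN.mem_nhds (hNab ⟨le_rfl, hle⟩))).exists
    exact ⟨y, hy.1, hyN⟩

end

/-! ### Hinges -/

section

variable {Z : Type*} [TopologicalSpace Z]

/-- The pseudo-group generated by a set of local homeomorphisms. -/
def generated (S : Set (OpenPartialHomeomorph Z Z)) : StructureGroupoid Z :=
  sInf {K | ClosedUnderRestriction K ∧ ∀ s ∈ S, s ∈ K}

theorem mem_generated {S : Set (OpenPartialHomeomorph Z Z)} {e : OpenPartialHomeomorph Z Z} :
    e ∈ generated S ↔ ∀ K : StructureGroupoid Z, ClosedUnderRestriction K → (∀ s ∈ S, s ∈ K) →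
      e ∈ K := by
  refine ⟨fun h K h1 h2 => ?_, fun h => ?_⟩
  · exact (sInf_le (show K ∈ {K | ClosedUnderRestriction K ∧ ∀ s ∈ S, s ∈ K} from ⟨h1, h2⟩) :
      generated S ≤ K) h
  · exact mem_iInter₂.2 fun K hK => h K hK.1 hK.2

theorem isGeneratedBy_generated (S : Set (OpenPartialHomeomorph Z Z)) :
    IsGeneratedBy (generated S) S := by
  refine ⟨⟨⟨fun {e} he s hs => ?_⟩, fun s hs => ?_⟩, fun K hK e he => ?_⟩
  · refine mem_generated.2 fun K h1 h2 => ?_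
    exact closedUnderRestriction' (mem_generated.1 he K h1 h2) hs
  · exact mem_generated.2 fun K _ h2 => h2 s hs
  · exact mem_generated.1 he K hK.1 hK.2

end

section

variable {T : Type*} [TopologicalSpace T] [ChartedSpace I T] {G : StructureGroupoid T}
  {X : GInt G I} {V : Set I} {r : ℕ} {w : ℕ → I → I}

/-- Each of the commuting maps is a homeomorphism from `V` onto an open set. -/
theorem CommutingSystem.exists_oph (h : CommutingSystem X V r w) (i : ℕ) :
    ∃ e : OpenPartialHomeomorph I I, e.source = V ∧ ∀ x, e x = w i x := by
  let e₀ : PartialEquiv I I := (h.mono i).injOn.toPartialEquiv (w i) V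
  refine ⟨OpenPartialHomeomorph.ofContinuousOpenRestrict e₀ (h.continuousOn i) ?_ h.isOpen, rfl,
    fun _ => rfl⟩
  refine IsOpenMap.of_nhds_le ?_
  rintro ⟨x, hx⟩
  obtain ⟨e, he, hwe, -⟩ := (h.germ i x hx).exists_oph
  have h1 : Filter.map (w i) (𝓝 x) = 𝓝 (w i x) := by
    rw [map_congr hwe, e.map_nhds_eq he, hwe.self_of_nhds]
  have h2 : Filter.map (Subtype.val : V → I) (𝓝 ⟨x, hx⟩) = 𝓝 x :=
    map_nhds_subtype_coe_eq_nhds hx (h.isOpen.mem_nhds hx)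
  change 𝓝 (w i x) ≤ Filter.map (w i ∘ Subtype.val) (𝓝 (⟨x, hx⟩ : V))
  rw [← Filter.map_map, h2, h1]

/-- The commuting maps, restricted to an open interval `Ω ⊆ V` which is parametrized by `j`. -/
theorem CommutingSystem.exists_restrict (h : CommutingSystem X V r w) {Z : Type*}
    [TopologicalSpace Z] {j : Z → I} (hj : IsOpenEmbedding j) (hjV : range j ⊆ V) (i : ℕ) :
    ∃ γ : OpenPartialHomeomorph Z Z, (∀ z, z ∈ γ.source ↔ w i (j z) ∈ range j) ∧
      ∀ z ∈ γ.source, j (γ z) = w i (j z) := by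
  rcases isEmpty_or_nonempty Z with hZ | hZ
  · exact ⟨OpenPartialHomeomorph.refl Z, fun z => isEmptyElim z, fun z => isEmptyElim z⟩
  obtain ⟨e, he, hew⟩ := h.exists_oph i
  let F := hj.toOpenPartialHomeomorph j
  have hFt : ∀ x, x ∈ F.target ↔ x ∈ range j := fun x => by simp [F]
  have hsrc : ∀ z, z ∈ (F ≫ₕ e ≫ₕ F.symm).source ↔ w i (j z) ∈ range j := fun z => by
    simp only [OpenPartialHomeomorph.trans_source, mem_inter_iff, mem_preimage,
      OpenPartialHomeomorph.symm_source, hFt]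
    change z ∈ univ ∧ j z ∈ e.source ∧ e (j z) ∈ range j ↔ _
    rw [he, hew]
    exact ⟨fun h => h.2.2, fun h => ⟨mem_univ z, hjV ⟨z, rfl⟩, h⟩⟩
  refine ⟨F ≫ₕ e ≫ₕ F.symm, hsrc, fun z hz => ?_⟩
  have h1 : F (F.symm (w i (j z))) = w i (j z) := F.right_inv ((hFt _).2 ((hsrc z).1 hz))
  change F (F.symm (e (j z))) = w i (j z)
  rw [hew, h1]

/-- On a copy `Z` of an open interval around `[a, b]` without other essential points, the commuting maps
generate a hinge. They preserve `[a, b]`, whose ends are fixed; the orbits accumulate at the core by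
`CommutingSystem.inter_nonempty_of_invariant`. The hinge is contained in every pseudo-group that
contains the local transformations of `Z` induced by `G`. -/
theorem CommutingSystem.exists_hinge (h : CommutingSystem X V r w) {a b : I} (hle : a ≤ b)
    (haE : a ∈ X.ess) (hbE : b ∈ X.ess) {Z : Type*} [TopologicalSpace Z] {j : Z → I}
    (hj : IsOpenEmbedding j) (hjc : (range j).OrdConnected) (hjV : range j ⊆ V)
    (hab : Icc a b ⊆ range j) (hE : ∀ x ∈ range j, x ∉ Icc a b → x ∉ X.ess) :
    ∃ Γ : StructureGroupoid Z, IsHinge Γ (j ⁻¹' Icc a b) ∧ hingeRank Γ (j ⁻¹' Icc a b) ≤ r ∧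
      ∀ K : StructureGroupoid Z, ClosedUnderRestriction K → (∀ γ : OpenPartialHomeomorph Z Z,
        (∀ z ∈ γ.source, ∃ f, X.Germ X.toGAtlas f (j z) ∧ ∀ᶠ z' in 𝓝 z, j (γ z') = f (j z')) →
          γ ∈ K) → Γ ≤ K := by
  choose γ' hγ's hγ'w using fun i => h.exists_restrict hj hjV i
  let γ : Fin r → OpenPartialHomeomorph Z Z := fun i => γ' i
  have hs : ∀ (i : Fin r) z, z ∈ (γ i).source ↔ w i (j z) ∈ range j := fun i => hγ's i
  have hw : ∀ (i : Fin r), ∀ z ∈ (γ i).source, j (γ i z) = w i (j z) := fun i => hγ'w i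
  have hmemV : ∀ z, j z ∈ V := fun z => hjV ⟨z, rfl⟩
  have haV : a ∈ V := hjV (hab ⟨le_rfl, hle⟩)
  have hbV : b ∈ V := hjV (hab ⟨hle, le_rfl⟩)
  have hfa : ∀ i, w i a = a := (h.fix a haV).1 haE
  have hfb : ∀ i, w i b = b := (h.fix b hbV).1 hbE
  have hcore : ∀ i, ∀ x ∈ V, w i x ∈ Icc a b ↔ x ∈ Icc a b := fun i x hx => by
    have h1 := (h.mono i).le_iff_le haV hx
    have h2 := (h.mono i).le_iff_le hx hbV
    rw [hfa] at h1
    rw [hfb] at h2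
    exact and_congr h1 h2
  have hgen := isGeneratedBy_generated (range γ)
  have hγgen : ∀ i, γ i ∈ generated (range γ) := fun i => hgen.1.2 _ ⟨i, rfl⟩
  have hpre : ∀ {s : Set Z}, (j '' s).OrdConnected → IsPreconnected s := fun {s} hs =>
    hj.isInducing.isPreconnected_image.1 hs.isPreconnected
  have hspre : ∀ i, IsPreconnected (γ i).source := fun i => by
    refine hpre ⟨?_⟩
    rintro _ ⟨x, hx, rfl⟩ _ ⟨y, hy, rfl⟩ z hz
    obtain ⟨z, rfl⟩ := hjc.out ⟨x, rfl⟩ ⟨y, rfl⟩ hz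
    refine ⟨z, (hs i z).2 (hjc.out ((hs i x).1 hx) ((hs i y).1 hy) ⟨?_, ?_⟩), rfl⟩
    · exact (h.mono i).monotoneOn (hmemV x) (hmemV z) hz.1
    · exact (h.mono i).monotoneOn (hmemV z) (hmemV y) hz.2
  -- Two preimages of a point, one by `γ i ∘ γ k` and the other one by `γ k ∘ γ i`, cannot differ:
  -- at the one closer to `[a, b]` both composites are defined and agree, against monotonicity.
  have hno : ∀ i k : Fin r, ∀ y y', j y < j y' → y ∈ (γ k).source → y' ∈ (γ i).source →
      w i (w k (j y)) = w k (w i (j y')) → False := by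
    intro i k y y' hlt hy hy' heq
    have hmi := h.mono i
    have hmk := h.mono k
    by_cases hya : a ≤ j y
    · have h1 : w i (j y) ∈ range j := hjc.out (hab ⟨le_rfl, hle⟩) ((hs i y').1 hy')
        ⟨by rw [← hfa i]; exact hmi.monotoneOn haV (hmemV y) hya,
          (hmi (hmemV y) (hmemV y') hlt).le⟩
      have h2 := hmk (hjV h1) (hjV ((hs i y').1 hy')) (hmi (hmemV y) (hmemV y') hlt)
      rw [← h.comm i k _ (hmemV y), heq] at h2
      exact lt_irrefl _ h2
    · rw [not_le] at hya
      have hyk := (hs k y).1 hy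
      have hya' : j y' < a := by
        by_contra h'
        rw [not_lt] at h'
        have h1 : w k (j y) < a := by rw [← hfa k]; exact hmk (hmemV y) haV hya
        have h2 : w i (w k (j y)) < a := by
          conv_rhs => rw [← hfa i]
          exact hmi (hjV hyk) haV h1
        have h3 : a ≤ w i (j y') := by
          conv_lhs => rw [← hfa i]
          exact hmi.monotoneOn haV (hmemV y') h'
        have h4 : a ≤ w k (w i (j y')) := by
          conv_lhs => rw [← hfa k]
          exact hmk.monotoneOn haV (hjV ((hs i y').1 hy')) h3
        exact absurd (heq ▸ h2) (not_lt.2 h4)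
      have h1 : w k (j y') ∈ range j := hjc.out hyk (hab ⟨le_rfl, hle⟩)
        ⟨(hmk (hmemV y) (hmemV y') hlt).le, by
          conv_rhs => rw [← hfa k]
          exact hmk.monotoneOn (hmemV y') haV hya'.le⟩
      have h2 := hmi (hjV hyk) (hjV h1) (hmk (hmemV y) (hmemV y') hlt)
      rw [h.comm i k _ (hmemV y'), heq] at h2
      exact lt_irrefl _ h2
  have hsys : IsHingeSystem (generated (range γ)) (j ⁻¹' Icc a b) γ := by
    refine ⟨?_, ?_, hgen, fun i => ⟨hspre i, ?_⟩, fun i => ⟨?_, ?_⟩, fun i k => ⟨?_, ?_, ?_⟩, ?_⟩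
    · refine ⟨fun z => (j z : ℝ), IsEmbedding.subtypeVal.comp hj.isEmbedding, ⟨?_⟩, a, ?_, b, ?_, hle,
        rfl⟩
      · rintro _ ⟨x, rfl⟩ _ ⟨y, rfl⟩ z hz
        have hzI : z ∈ I := ⟨(j x).2.1.trans hz.1, hz.2.trans (j y).2.2⟩
        obtain ⟨v, hv⟩ := hjc.out ⟨x, rfl⟩ ⟨y, rfl⟩ (show (⟨z, hzI⟩ : I) ∈ Icc (j x) (j y) from hz)
        exact ⟨v, congrArg Subtype.val hv⟩
      · obtain ⟨v, hv⟩ := hab ⟨le_rfl, hle⟩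
        exact ⟨v, congrArg Subtype.val hv⟩
      · obtain ⟨v, hv⟩ := hab ⟨hle, le_rfl⟩
        exact ⟨v, congrArg Subtype.val hv⟩
    · intro g hg x hx hxg
      have hle : generated (range γ) ≤ preservingGroupoid (j ⁻¹' Icc a b) := by
        refine hgen.2 ⟨inferInstance, ?_⟩
        rintro _ ⟨i, rfl⟩ z hz
        rw [mem_preimage, mem_preimage, hw i z hz]
        exact (hcore i _ (hmemV z)).symm
      exact (hle hg x hxg).1 hx
    · intro z hz
      exact (hs i z).2 (hab ((hcore i _ (hmemV z)).2 hz))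
    · rw [← (γ i).image_source_eq_target]
      exact (hspre i).image _ (γ i).continuousOn
    · intro z hz
      have hsub : Icc a b ⊆ V := hab.trans hjV
      obtain ⟨x, hx, hxz⟩ := intermediate_value_Icc hle ((h.continuousOn i).mono hsub)
        (show j z ∈ Icc (w i a) (w i b) by rw [hfa, hfb]; exact hz)
      obtain ⟨y, rfl⟩ := hab hx
      have hy : y ∈ (γ i).source := (hs i y).2 ⟨z, hxz.symm⟩
      have : γ i y = z := hj.injective (by rw [hw i y hy, hxz])
      rw [← this]
      exact (γ i).map_source hy
    · rintro x ⟨h1, h2⟩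
      simp only [OpenPartialHomeomorph.trans_source, mem_inter_iff, mem_preimage] at h1 h2
      apply hj.injective
      rw [hw k _ h1.2, hw i _ h1.1, hw i _ h2.2, hw k _ h2.1, h.comm i k _ (hmemV x)]
    · rintro x ⟨h1, h2⟩
      simp only [OpenPartialHomeomorph.trans_source, mem_inter_iff, mem_preimage,
        OpenPartialHomeomorph.symm_source] at h1 h2
      set y := (γ i).symm x
      have hy : y ∈ (γ i).source := (γ i).map_target h1.1
      have hyx : γ i y = x := (γ i).right_inv h1.1
      have e1 : w i (j (γ k y)) = j (γ k x) := by
        rw [hw k y h1.2, h.comm i k _ (hmemV y), ← hw i y hy, hyx, hw k x h2.1]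
      have h3 : γ k y ∈ (γ i).source := (hs i _).2 (e1 ▸ ⟨_, rfl⟩)
      have h4 : γ i (γ k y) = γ k x := hj.injective (by rw [hw i _ h3, e1])
      rw [← h4, (γ i).left_inv h3]
    · rintro x ⟨h1, h2⟩
      simp only [OpenPartialHomeomorph.trans_source, mem_inter_iff, mem_preimage,
        OpenPartialHomeomorph.symm_source] at h1 h2
      set y := (γ k).symm ((γ i).symm x) with hydef
      set y' := (γ i).symm ((γ k).symm x) with hydef'
      have hy : y ∈ (γ k).source := (γ k).map_target h1.2
      have hy' : y' ∈ (γ i).source := (γ i).map_target h2.2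
      have e1 : w i (w k (j y)) = j x := by
        rw [← hw k y hy, (γ k).right_inv h1.2, ← hw i _ ((γ i).map_target h1.1),
          (γ i).right_inv h1.1]
      have e2 : w k (w i (j y')) = j x := by
        rw [← hw i y' hy', (γ i).right_inv h2.2, ← hw k _ ((γ k).map_target h2.1),
          (γ k).right_inv h2.1]
      refine hj.injective ?_
      rcases lt_trichotomy (j y) (j y') with hlt | heq | hlt
      · exact (hno i k y y' hlt hy hy' (e1.trans e2.symm)).elim
      · exact heq
      · exact (hno k i y' y hlt hy' hy (e2.trans e1.symm)).elim
    · intro U hU hCU x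
      have hSN := h.inter_nonempty_of_invariant (hab.trans hjV) hle haE hbE hjc hab hjV hE
        (S := j '' orbit (generated (range γ)) x) (x := j x) ⟨x, rfl⟩ ⟨x, mem_orbit_self x, rfl⟩
        ?_ ?_ (N := j '' U) (hj.isOpenMap U hU) ?_
      · obtain ⟨_, ⟨y, hy, rfl⟩, y', hy', hyy'⟩ := hSN
        exact ⟨y, hy, hj.injective hyy' ▸ hy'⟩
      · rintro i _ - ⟨y, hy, rfl⟩ hwy
        by_cases hi : i < r
        · have hys : y ∈ (γ ⟨i, hi⟩).source := (hs ⟨i, hi⟩ y).2 hwy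
          exact ⟨_, mem_orbit_trans (mem_orbit_of_mem (hγgen ⟨i, hi⟩) hys) hy, hw ⟨i, hi⟩ y hys⟩
        · rw [h.eq_id i (not_lt.1 hi)]
          exact ⟨y, hy, rfl⟩
      · rintro i _ ⟨y, rfl⟩ ⟨z, hz, hzw⟩
        by_cases hi : i < r
        · have hys : y ∈ (γ ⟨i, hi⟩).source := (hs ⟨i, hi⟩ y).2 ⟨z, hzw⟩
          have hyz : γ ⟨i, hi⟩ y = z := hj.injective (by rw [hw _ y hys, hzw])
          refine ⟨y, mem_orbit_trans (mem_orbit_symm ?_) hz, rfl⟩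
          rw [← hyz]
          exact mem_orbit_of_mem (hγgen ⟨i, hi⟩) hys
        · rw [h.eq_id i (not_lt.1 hi)] at hzw
          exact ⟨z, hz, hzw⟩
      · intro y hy
        obtain ⟨z, rfl⟩ := hab hy
        exact ⟨z, hCU hy, rfl⟩
  refine ⟨generated (range γ), ⟨hgen.1.1, r, γ, hsys⟩, iInf₂_le r ⟨γ, hsys⟩, fun K hK hmem => ?_⟩
  refine hgen.2 ⟨hK, ?_⟩
  rintro _ ⟨i, rfl⟩
  refine hmem _ fun z hz => ⟨w i, h.germ i _ (hmemV z), ?_⟩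
  filter_upwards [(γ i).open_source.mem_nhds hz] with z' hz' using hw i z' hz'

end

/-! ### The pseudo-group of a `G`-atlas -/

section

variable {T : Type*} [TopologicalSpace T] {G : StructureGroupoid T}
  {Y Z : Type*} [TopologicalSpace Y] [TopologicalSpace Z]

/-- If the germs of `f` and `f ∘ e` belong to `G`, so does the germ of `e`. -/
theorem GAtlas.Germ.of_comp {W : Type*} [TopologicalSpace W] {A : GAtlas G Z} {B : GAtlas G Y}
    {C : GAtlas G W} {f : Y → Z} {e : W → Y} {x : W} (hf : B.Germ A f (e x))
    (he : ContinuousAt e x) (h : C.Germ A (f ∘ e) x) : C.Germ B e x := by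
  obtain ⟨F, h1, h2, h3⟩ := hf.exists_oph
  have h4 := (h3 _ h1).symm h1
  rw [← h2.self_of_nhds] at h4
  refine (GAtlas.Germ.comp (x := x) h4 h).congr ?_
  filter_upwards [he.eventually h2, he.eventually (F.open_source.mem_nhds h1)] with y hy hy'
  simp [hy, F.left_inv hy']

/-- The local transformations that belong to `G` when they are read in the charts of the atlas. -/
def GAtlas.groupoid (A : GAtlas G Z) (hA : A.dom = univ) : StructureGroupoid Z where
  members := {e | ∀ x ∈ e.source, A.Germ A e x}
  trans' := by
    intro e e' he he' x hx
    rw [OpenPartialHomeomorph.trans_source] at hx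
    exact (he' _ hx.2).comp (he x hx.1)
  symm' := by
    intro e he x hx
    have h := (he _ (e.map_target hx)).symm (e.map_target hx)
    rwa [e.right_inv hx] at h
  id_mem' := fun x _ => GAtlas.germ_id (hA ▸ mem_univ x)
  locality' := by
    intro e h x hx
    obtain ⟨s, hs, hxs, hes⟩ := h x hx
    exact hes x (by rw [OpenPartialHomeomorph.restr_source, hs.interior_eq]; exact ⟨hx, hxs⟩)
  mem_of_eqOnSource' := by
    intro e e' he h x hx
    refine (he x (h.1 ▸ hx)).congr ?_
    filter_upwards [e'.open_source.mem_nhds hx] with y hy using h.2 hy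

instance (A : GAtlas G Z) (hA : A.dom = univ) : ClosedUnderRestriction (A.groupoid hA) where
  closedUnderRestriction := by
    intro e he s hs x hx
    rw [OpenPartialHomeomorph.restr_source] at hx
    exact he x hx.1

theorem GAtlas.mem_orbit_groupoid {A : GAtlas G Z} {hA : A.dom = univ} {z z' : Z} :
    z' ∈ orbit (A.groupoid hA) z ↔ A.orb z' = A.orb z := by
  constructor
  · rintro ⟨g, hg, hz, rfl⟩
    exact (hg z hz).orb_eq
  · intro h
    obtain ⟨t, ht⟩ := GAtlas.mem_dom_iff.1 (hA ▸ mem_univ z : z ∈ A.dom)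
    obtain ⟨e, h1, h2, h3⟩ := GAtlas.exists_germ_of_orb_eq ht (h ▸ ht : t ∈ A.orb z')
    exact ⟨e, h3, h1, h2⟩

/-- The pseudo-group of an atlas `A` induces that of an atlas `B` on an open subset, provided that the
inclusion `f` is modelled on `G`. -/
theorem GAtlas.restrictAlong_groupoid (A : GAtlas G Z) (hA : A.dom = univ) (B : GAtlas G Y)
    (hB : B.dom = univ) {f : Y → Z} (hf : IsOpenEmbedding f) (h : ∀ y, B.Germ A f y) :
    restrictAlong (A.groupoid hA) f hf = B.groupoid hB := by
  refine le_antisymm (fun e he x hx => ?_) (fun e he x hx => ?_)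
  · obtain ⟨g, hg, h1, h2⟩ := he x hx
    refine (h (e x)).of_comp (e.continuousAt hx) ?_
    refine (GAtlas.Germ.comp (hg _ h1) (h x)).congr ?_
    filter_upwards [h2] with y hy using hy.symm
  · obtain ⟨F, h1, h2, h3⟩ := (h x).exists_oph
    have h4 := (h3 _ h1).symm h1
    have h5 : B.Germ A (f ∘ e) (F.symm (F x)) := by
      rw [F.left_inv h1]
      exact (h _).comp (he x hx)
    obtain ⟨g, k1, k2, k3⟩ := (h5.comp h4).exists_oph
    have hfx := h2.self_of_nhds
    refine ⟨g, k3, hfx ▸ k1, ?_⟩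
    have hc := hf.continuous.continuousAt (x := x)
    rw [ContinuousAt, hfx] at hc
    filter_upwards [hc.eventually k2, h2, F.open_source.mem_nhds h1] with y hy hy' hy''
    rw [← hy, hy']
    simp [F.left_inv hy'']

/-- The space `T` with its tautological chart. -/
def idAtlas (G : StructureGroupoid T) : GAtlas G T where
  charts := {OpenPartialHomeomorph.refl T}
  compat := by
    rintro _ rfl _ rfl
    simpa using G.id_mem

theorem dom_idAtlas : (idAtlas G).dom = univ :=
  eq_univ_of_forall fun _ => ⟨_, rfl, mem_univ _⟩

theorem orb_idAtlas (t : T) : (idAtlas G).orb t = orbit G t :=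
  (idAtlas G).orb_eq_orbit rfl (mem_univ t)

theorem groupoid_idAtlas [ClosedUnderRestriction G] :
    (idAtlas G).groupoid dom_idAtlas = G := by
  refine le_antisymm (fun e he => ?_) (fun e he x hx => ?_)
  · refine mem_of_germs fun x hx => ?_
    obtain ⟨g, hg, h1, h2⟩ := (he x hx).in_charts (ψ := OpenPartialHomeomorph.refl T)
      rfl (mem_univ _) (ψ' := OpenPartialHomeomorph.refl T) rfl (mem_univ _)
    exact ⟨g, hg, h1, h2.mono fun y hy => hy.2⟩
  · exact ⟨_, rfl, _, rfl, e, he, mem_univ _, mem_univ _, hx,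
      Eventually.of_forall fun y => ⟨mem_univ _, rfl⟩⟩

/-! ### Disjoint unions of spaces with a `G`-atlas -/

/-- A space which is entirely covered by the charts of a `G`-atlas. -/
structure Piece.{v} (G : StructureGroupoid T) where
  carrier : Type v
  [top : TopologicalSpace carrier]
  chart : GAtlas G carrier
  dom_eq : chart.dom = univ

attribute [instance] Piece.top

section Glue

variable [ClosedUnderRestriction G] {ι : Type*} {P : ι → Piece G} {f : ∀ c, (P c).carrier → Z}

/-- The atlas of a disjoint union of pieces. A chart of the union is an extension of a chart of a
piece, seen as an open subset of the union; its values away from its source are irrelevant. -/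
def GAtlas.glue (P : ι → Piece G) (f : ∀ c, (P c).carrier → Z) (hf : ∀ c, IsOpenEmbedding (f c))
    (hd : ∀ c c' y y', f c y = f c' y' → c = c') : GAtlas G Z :=
  .ofGermRel {χ | ∃ c, ∃ ψ ∈ (P c).chart.charts, χ.source = f c '' ψ.source ∧
    ∀ y ∈ ψ.source, χ (f c y) = ψ y} <| by
    rintro χ ⟨c, ψ, hψ, h1, h2⟩ χ' ⟨c', ψ', hψ', h1', h2'⟩ x hx hx'
    rw [h1] at hx
    rw [h1'] at hx'
    obtain ⟨y, hy, rfl⟩ := hx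
    obtain ⟨y', hy', he⟩ := hx'
    obtain rfl := hd _ _ _ _ he
    obtain rfl := (hf _).injective he
    obtain ⟨g, hg, k1, k2⟩ := GermRel.of_compat hψ hψ' hy hy'
    refine ⟨g, hg, by rwa [h2 _ hy], ?_⟩
    rw [← (hf c').map_nhds_eq, Filter.eventually_map]
    filter_upwards [k2, ψ.open_source.mem_nhds hy, ψ'.open_source.mem_nhds hy'] with z hz hz' hz''
    rw [h2 z hz', h2' z hz'', hz]

variable {hf : ∀ c, IsOpenEmbedding (f c)} {hd : ∀ c c' y y', f c y = f c' y' → c = c'}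

theorem GAtlas.exists_glue_chart {c : ι} {ψ : OpenPartialHomeomorph (P c).carrier T}
    (hψ : ψ ∈ (P c).chart.charts) [Nonempty T] :
    ψ.lift_openEmbedding (hf c) ∈ (GAtlas.glue P f hf hd).charts :=
  ⟨c, ψ, hψ, rfl, fun _ _ => ψ.lift_openEmbedding_apply (hf c)⟩

theorem GAtlas.germ_glue (c : ι) (y : (P c).carrier) :
    (P c).chart.Germ (GAtlas.glue P f hf hd) (f c) y := by
  obtain ⟨ψ, hψ, hy⟩ : y ∈ (P c).chart.dom := (P c).dom_eq ▸ mem_univ y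
  have : Nonempty T := ⟨ψ y⟩
  refine ⟨ψ, hψ, _, GAtlas.exists_glue_chart hψ, _, G.id_mem, hy, mem_image_of_mem _ hy, by simp, ?_⟩
  filter_upwards [ψ.open_source.mem_nhds hy] with z hz
  exact ⟨mem_image_of_mem _ hz, (ψ.lift_openEmbedding_apply (hf c)).symm⟩

theorem GAtlas.orb_glue (c : ι) (y : (P c).carrier) :
    (GAtlas.glue P f hf hd).orb (f c y) = (P c).chart.orb y :=
  (GAtlas.germ_glue c y).orb_eq

theorem GAtlas.dom_glue (hcov : ∀ z, ∃ c y, f c y = z) : (GAtlas.glue P f hf hd).dom = univ := by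
  refine eq_univ_of_forall fun z => ?_
  obtain ⟨c, y, rfl⟩ := hcov z
  exact (GAtlas.germ_glue c y).map_mem_dom

end Glue

/-- Composing a chart with another one commutes, up to irrelevant values, with its extension along an
open embedding. -/
theorem lift_openEmbedding_trans_eqOnSource {X Y : Type*} [TopologicalSpace X] [TopologicalSpace Y]
    [Nonempty T] [Nonempty I] {f : X → Y} (hf : IsOpenEmbedding f) (ψ : OpenPartialHomeomorph X T)
    (φ : OpenPartialHomeomorph T I) :
    (ψ ≫ₕ φ).lift_openEmbedding hf ≈ ψ.lift_openEmbedding hf ≫ₕ φ := by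
  refine ⟨?_, ?_⟩
  · ext y
    constructor
    · rintro ⟨x, hx, rfl⟩
      rw [OpenPartialHomeomorph.trans_source] at hx ⊢
      refine ⟨mem_image_of_mem f hx.1, ?_⟩
      rw [mem_preimage, OpenPartialHomeomorph.lift_openEmbedding_apply]
      exact hx.2
    · rw [OpenPartialHomeomorph.trans_source]
      rintro ⟨⟨x, hx, rfl⟩, hx'⟩
      rw [mem_preimage, OpenPartialHomeomorph.lift_openEmbedding_apply] at hx'
      exact ⟨x, by rw [OpenPartialHomeomorph.trans_source]; exact ⟨hx, hx'⟩, rfl⟩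
  · rintro _ ⟨x, hx, rfl⟩
    rw [OpenPartialHomeomorph.lift_openEmbedding_apply, OpenPartialHomeomorph.trans_apply,
      OpenPartialHomeomorph.trans_apply, OpenPartialHomeomorph.lift_openEmbedding_apply]

end

/-! ### Manifold structures -/

section

variable {T : Type*} [TopologicalSpace T] [ChartedSpace I T] {G : StructureGroupoid T}
  {Z : Type*} [TopologicalSpace Z]

theorem IsAdmissible.congr {c : DiffClass} {e e' : OpenPartialHomeomorph I I} (h : IsAdmissible c e)
    (he : e' ≈ e) : IsAdmissible c e' := by
  have hs : e'.source = e.source := he.1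
  have ht : e'.target = e.target := he.target_eq
  have heq : ∀ x ∈ e.source, e' x = e x := fun x hx => he.2 (hs ▸ hx)
  have heq' : ∀ x ∈ e.target, e'.symm x = e.symm x := fun x hx => he.symm_eqOn_target (ht ▸ hx)
  refine ⟨fun x hx => ?_, ?_⟩
  · obtain ⟨u, h1, h2, h3⟩ := h.1 x (hs ▸ hx)
    exact ⟨u, h1, hs ▸ h2, h3.congr fun y hy => (heq y (h2 hy)).symm⟩
  · have h2 := h.2
    cases c with
    | smooth r =>
      refine ⟨?_, ?_⟩
      · rw [hs]
        refine h2.1.congr ?_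
        rintro _ ⟨x, hx, rfl⟩
        simp [heq x hx]
      · rw [ht]
        refine h2.2.congr ?_
        rintro _ ⟨x, hx, rfl⟩
        simp [heq' x hx]
    | pl =>
      intro x hx
      rw [hs] at hx
      have hev : ∀ᶠ y in 𝓝 x, e' y = e y := by
        filter_upwards [e.open_source.mem_nhds hx] with y hy using heq y hy
      obtain ⟨⟨a, ha⟩, b, hb⟩ := h2 x hx
      refine ⟨⟨a, ?_⟩, b, ?_⟩
      · filter_upwards [ha, hev.filter_mono nhdsWithin_le_nhds] with y hy hy'
        rw [hy', heq x hx, hy]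
      · filter_upwards [hb, hev.filter_mono nhdsWithin_le_nhds] with y hy hy'
        rw [hy', heq x hx, hy]

theorem IsAdmissible.of_source_eq_empty (c : DiffClass) {e : OpenPartialHomeomorph I I}
    (h : e.source = ∅) : IsAdmissible c e := by
  have ht : e.target = ∅ := by rw [← e.image_source_eq_target, h, image_empty]
  refine ⟨by simp [h], ?_⟩
  cases c with
  | smooth r => simp [h, ht]
  | pl => simp [h]

/-- A chart with values in `[0,1]` that factors through the `G`-atlas `A` and a chart of `T`. -/
def GAtlas.Factors (A : GAtlas G Z) (χ : OpenPartialHomeomorph Z I) : Prop :=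
  χ.source = ∅ ∨ ∃ α ∈ A.charts, ∃ φ ∈ atlas I T, χ ≈ α ≫ₕ φ

/-- Local transformations that are modelled on `G` are of the given class in charts that factor through
the `G`-atlas, since the elements of `G` are. -/
theorem GAtlas.Factors.isAdmissible {c : DiffClass} (hG : IsPseudoGroup c G) {A : GAtlas G Z}
    {χ χ' : OpenPartialHomeomorph Z I} (hχ : A.Factors χ) (hχ' : A.Factors χ')
    {e : OpenPartialHomeomorph Z Z} (he : ∀ x ∈ e.source, A.Germ A e x) :
    IsAdmissible c (χ.symm ≫ₕ e ≫ₕ χ') := by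
  have := hG.restr
  rcases hχ with hχ | ⟨α, hα, φ, hφ, hχ⟩
  · refine .of_source_eq_empty c ?_
    rw [OpenPartialHomeomorph.trans_source, OpenPartialHomeomorph.symm_source,
      ← χ.image_source_eq_target, hχ, image_empty, empty_inter]
  rcases hχ' with hχ' | ⟨α', hα', φ', hφ', hχ'⟩
  · refine .of_source_eq_empty c ?_
    rw [OpenPartialHomeomorph.trans_source, OpenPartialHomeomorph.trans_source, hχ', preimage_empty,
      inter_empty, preimage_empty, inter_empty]
  have hmid : α.symm ≫ₕ e ≫ₕ α' ∈ G := by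
    refine mem_of_germs fun t ht => ?_
    simp only [OpenPartialHomeomorph.trans_source, OpenPartialHomeomorph.symm_source, mem_inter_iff,
      mem_preimage] at ht
    obtain ⟨g, hg, h1, h2⟩ := (he _ ht.2.1).in_charts hα (α.map_target ht.1) hα' ht.2.2
    rw [α.right_inv ht.1] at h1
    refine ⟨g, hg, h1, ?_⟩
    filter_upwards [(α.symm.continuousAt ht.1).eventually h2, α.open_target.mem_nhds ht.1]
      with y hy hy'
    rw [α.right_inv hy'] at hy
    simpa using hy.2
  refine (hG.transformation _ hmid φ hφ φ' hφ').congr ?_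
  have h1 : χ.symm ≫ₕ e ≫ₕ χ' ≈ (α ≫ₕ φ).symm ≫ₕ e ≫ₕ (α' ≫ₕ φ') :=
    OpenPartialHomeomorph.EqOnSource.trans' hχ.symm'
      (OpenPartialHomeomorph.EqOnSource.trans' (Setoid.refl _) hχ')
  refine Setoid.trans h1 ?_
  rw [OpenPartialHomeomorph.trans_symm_eq_symm_trans_symm]
  simp only [OpenPartialHomeomorph.trans_assoc]
  exact Setoid.refl _

theorem GAtlas.isPseudoGroup {c : DiffClass} (hG : IsPseudoGroup c G) [ChartedSpace I Z]
    (A : GAtlas G Z) (hA : A.dom = univ) (h : ∀ χ ∈ atlas I Z, A.Factors χ) :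
    IsPseudoGroup c (A.groupoid hA) where
  restr := inferInstance
  transformation _ hg χ hχ χ' hχ' := (h χ hχ).isAdmissible hG (h χ' hχ') hg

theorem GAtlas.isOrientedOneManifold {c : DiffClass} (hG : IsPseudoGroup c G) [ChartedSpace I Z]
    [T2Space Z] [SecondCountableTopology Z]
    (A : GAtlas G Z) (hA : A.dom = univ) (h : ∀ χ ∈ atlas I Z, A.Factors χ) :
    IsOrientedOneManifold c Z where
  t2 := inferInstance
  secondCountable := inferInstance
  compatible χ hχ χ' hχ' := by
    have h1 := (h χ hχ).isAdmissible hG (h χ' hχ') (e := OpenPartialHomeomorph.refl Z)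
      (fun x _ => GAtlas.germ_id (hA ▸ mem_univ x))
    rwa [OpenPartialHomeomorph.refl_trans] at h1

/-- The charts obtained by composing those of a `G`-atlas with those of `T`. -/
@[reducible]
noncomputable def GAtlas.chartedSpace (A : GAtlas G Z) (hA : A.dom = univ) : ChartedSpace I Z where
  atlas := {χ | ∃ α ∈ A.charts, ∃ φ ∈ atlas I T, χ = α ≫ₕ φ}
  chartAt z :=
    let α := Classical.choose (hA ▸ mem_univ z : z ∈ A.dom)
    α ≫ₕ chartAt I (α z)
  mem_chart_source z := by
    have h := Classical.choose_spec (hA ▸ mem_univ z : z ∈ A.dom)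
    simp [h.2]
  chart_mem_atlas z :=
    ⟨_, (Classical.choose_spec (hA ▸ mem_univ z : z ∈ A.dom)).1, _, chart_mem_atlas I _, rfl⟩

/-- A space with an atlas modelled on `(G, T)` that meets every orbit is Haefliger-equivalent to
`(G, T)`. -/
theorem GAtlas.haefligerEquivalent {T : Type u} [TopologicalSpace T] [ChartedSpace I T]
    {G : StructureGroupoid T} {Z : Type u} [TopologicalSpace Z] {c : DiffClass}
    (hG : IsPseudoGroup c G) (A : GAtlas G Z) (hA : A.dom = univ) (hex : ∀ t, ∃ z, t ∈ A.orb z) :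
    let _ := A.chartedSpace hA
    HaefligerEquivalent c G (A.groupoid hA) := by
  have := hG.restr
  let _ := A.chartedSpace hA
  -- the disjoint union of `T` and `Z` also carries a `G`-atlas, whose pseudo-group is the equivalence
  let P : Bool → Piece.{_, u} G := fun b => match b with
    | true => ⟨T, idAtlas G, dom_idAtlas⟩
    | false => ⟨Z, A, hA⟩
  let f : ∀ b, (P b).carrier → T ⊕ Z := fun b => match b with
    | true => Sum.inl
    | false => Sum.inr
  have hf : ∀ b, IsOpenEmbedding (f b) := fun b => match b with
    | true => IsOpenEmbedding.inl
    | false => IsOpenEmbedding.inr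
  have hd : ∀ b b' y y', f b y = f b' y' → b = b' := by
    rintro (_ | _) (_ | _) y y' h
    · rfl
    · exact absurd h Sum.inr_ne_inl
    · exact absurd h Sum.inl_ne_inr
    · rfl
  let B := GAtlas.glue P f hf hd
  have hB : B.dom = univ := GAtlas.dom_glue <| by
    rintro (t | z)
    · exact ⟨true, t, rfl⟩
    · exact ⟨false, z, rfl⟩
  have horbl : ∀ t, B.orb (Sum.inl t) = orbit G t := fun t =>
    (GAtlas.orb_glue (P := P) (hf := hf) (hd := hd) true t).trans (orb_idAtlas t)
  have horbr : ∀ z, B.orb (Sum.inr z) = A.orb z := fun z =>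
    GAtlas.orb_glue (P := P) (hf := hf) (hd := hd) false z
  refine ⟨B.groupoid hB, B.isPseudoGroup hG hB ?_, ?_, ?_, ?_⟩
  · intro χ hχ
    have : Nonempty I := ⟨0⟩
    rcases isEmpty_or_nonempty T with hT | hT
    · refine Or.inl (eq_empty_of_forall_notMem fun x hx => ?_)
      obtain ⟨α, -, -⟩ : x ∈ B.dom := hB ▸ mem_univ x
      exact isEmptyElim (α x)
    rcases ChartedSpace.mem_atlas_sum hχ with ⟨φ, hφ, rfl⟩ | ⟨_, ⟨α, hα, φ, hφ, rfl⟩, rfl⟩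
    · refine Or.inr ⟨_, GAtlas.exists_glue_chart (P := P) (c := true)
        (ψ := OpenPartialHomeomorph.refl T) rfl, φ, hφ, ?_⟩
      have h := lift_openEmbedding_trans_eqOnSource (IsOpenEmbedding.inl (X := T) (Y := Z))
        (OpenPartialHomeomorph.refl T) φ
      rwa [OpenPartialHomeomorph.refl_trans] at h
    · exact Or.inr ⟨_, GAtlas.exists_glue_chart (P := P) (c := false) hα, φ, hφ,
        lift_openEmbedding_trans_eqOnSource IsOpenEmbedding.inr α φ⟩
  · rw [B.restrictAlong_groupoid hB (idAtlas G) dom_idAtlas, groupoid_idAtlas]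
    exact GAtlas.germ_glue (P := P) (hf := hf) (hd := hd) true
  · rw [B.restrictAlong_groupoid hB A hA]
    exact GAtlas.germ_glue (P := P) (hf := hf) (hd := hd) false
  · rintro (t | z)
    · refine ⟨⟨_, mem_orbit_self _, t, rfl⟩, ?_⟩
      obtain ⟨z, hz⟩ := hex t
      refine ⟨Sum.inr z, GAtlas.mem_orbit_groupoid.2 ?_, z, rfl⟩
      rw [horbl, horbr, GAtlas.orb_eq_of_mem hz]
    · refine ⟨?_, ⟨_, mem_orbit_self _, z, rfl⟩⟩
      obtain ⟨t, ht⟩ := GAtlas.mem_dom_iff.1 (hA ▸ mem_univ z : z ∈ A.dom)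
      refine ⟨Sum.inl t, GAtlas.mem_orbit_groupoid.2 ?_, t, rfl⟩
      rw [horbl, horbr, GAtlas.orb_eq_of_mem ht]

end

/-! ### The circles, intervals and hinges that represent all orbits -/

variable {T : Type*} [TopologicalSpace T] [ChartedSpace I T] {G : StructureGroupoid T}

/-- A connected space cannot enter a core, nor leave it, without meeting an essential orbit of this
core, since the ends of the core are essential. -/
theorem GInt.notMem_pre_sat_of_isPreconnected {Z : Type*} [TopologicalSpace Z] {X : GInt G I}
    {a b : I} (haE : a ∈ X.ess) (hbE : b ∈ X.ess) (hc : IsClosed (X.sat (Icc a b)))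
    {A : GAtlas G Z} {D : Set Z} (hD : IsPreconnected D) (hDA : D ⊆ A.dom) {x₀ : Z} (hx₀ : x₀ ∈ D)
    (hx₀' : x₀ ∉ A.pre (X.sat (Icc a b)))
    (h : ∀ x ∈ D, x ∈ A.pre {t | Ess G t} → x ∉ A.pre (X.sat (Icc a b))) {x : Z} (hx : x ∈ D) :
    x ∉ A.pre (X.sat (Icc a b)) := by
  have hs := X.isSaturated_sat (Icc a b)
  have hcover : D ⊆ A.pre (X.sat (Ioo a b)) ∪ A.pre (X.sat (Icc a b))ᶜ := by
    intro z hz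
    by_cases hzC : z ∈ A.pre (X.sat (Icc a b))
    · have hzE : z ∉ A.pre {t | Ess G t} := fun hE => h z hz hE hzC
      obtain ⟨t, ht, y, hy, hty⟩ := hzC
      have hyE : y ∉ X.ess := fun ⟨s, hs, hsE⟩ =>
        hzE ⟨s, by rwa [GAtlas.orb_eq_orb_of_mem ht hty], hsE⟩
      refine Or.inl ⟨t, ht, y, ⟨lt_of_le_of_ne hy.1 ?_, lt_of_le_of_ne hy.2 ?_⟩, hty⟩
      · rintro rfl
        exact hyE haE
      · rintro rfl
        exact hyE hbE
    · rw [A.pre_compl hs]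
      exact Or.inr ⟨hDA hz, hzC⟩
  intro hxC
  have hxu : x ∈ A.pre (X.sat (Ioo a b)) := by
    refine (hcover hx).resolve_right fun h' => ?_
    rw [A.pre_compl hs] at h'
    exact h'.2 hxC
  have hxv : x₀ ∈ A.pre (X.sat (Icc a b))ᶜ := by
    rw [A.pre_compl hs]
    exact ⟨hDA hx₀, hx₀'⟩
  obtain ⟨z, -, ⟨t, ht, y, hy, hty⟩, hzv⟩ := hD _ _
    (A.isOpen_pre (X.isSaturated_sat _) (X.isOpen_sat isOpen_Ioo))
    (A.isOpen_pre hs.compl hc.isOpen_compl) hcover ⟨x, hx, hxu⟩ ⟨x₀, hx₀, hxv⟩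
  rw [A.pre_compl hs] at hzv
  exact hzv.2 ⟨t, ht, y, Ioo_subset_Icc_self hy, hty⟩

theorem GCurve.isPreconnected (B : GCurve G) : IsPreconnected (univ : Set B.carrier) := by
  rcases B.shape with ⟨⟨e⟩⟩ | ⟨⟨e⟩⟩
  · rw [← e.symm.range_eq_univ]
    exact isPreconnected_range e.symm.continuous
  · rw [← e.symm.range_eq_univ]
    exact isPreconnected_range e.symm.continuous

theorem GCurve.notMem_pre_ess (B : GCurve G) (x : B.carrier) : x ∉ B.chart.pre {t | Ess G t} :=
  fun ⟨t, ht, hE⟩ => B.not_ess x t ht hE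

/-- Finitely many curves meet all the orbits that correspond to a compact set. -/
theorem exists_finite_gcurves {Z : Type*} [TopologicalSpace Z] (A : GAtlas G Z) {K : Set Z}
    (hK : IsCompact K) (hKA : K ⊆ A.dom) {p : GCurve G → Prop}
    (h : ∀ y ∈ K, ∃ B : GCurve G, p B ∧ ∃ x, A.orb y = B.chart.orb x) :
    ∃ S : Set (GCurve G), S.Finite ∧ (∀ B ∈ S, p B) ∧
      ∀ y ∈ K, ∃ B ∈ S, ∃ x, B.chart.orb x = A.orb y := by
  choose B hB x hx using h
  obtain ⟨F, hFK⟩ := hK.elim_nhds_subcover' (fun y hy => A.pre ((B y hy).chart.sat univ))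
    fun y hy => (A.isOpen_pre ((B y hy).chart.isSaturated_sat _)
      ((B y hy).chart.isOpen_sat isOpen_univ)).mem_nhds <| by
        obtain ⟨t, ht⟩ := GAtlas.mem_dom_iff.1 (hKA hy)
        exact ⟨t, ht, x y hy, mem_univ _, hx y hy ▸ ht⟩
  refine ⟨(fun y : K => B y y.2) '' F, F.finite_toSet.image _, ?_, fun y hy => ?_⟩
  · rintro _ ⟨y, -, rfl⟩
    exact hB y y.2
  · obtain ⟨y', hy', t, ht, z, -, htz⟩ := mem_iUnion₂.1 (hFK hy)
    exact ⟨_, mem_image_of_mem _ hy', z, GAtlas.orb_eq_orb_of_mem htz ht⟩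

/-- An open interval `Ω` around a core `[a, b]` which carries a commuting system, of at most `R` maps,
and contains no essential point outside the core. -/
structure HingeData (G : StructureGroupoid T) (R : ℕ∞) where
  X : GInt G I
  a : I
  b : I
  V : Set I
  r : ℕ
  w : ℕ → I → I
  Ω : Set I
  le : a ≤ b
  left_mem : a ∈ X.ess
  right_mem : b ∈ X.ess
  rank_le : (r : ℕ∞) ≤ R
  system : CommutingSystem X V r w
  isOpen : IsOpen Ω
  ordConnected : Ω.OrdConnected
  subset : Ω ⊆ V
  core_subset : Icc a b ⊆ Ω
  notMem_ess : ∀ x ∈ Ω, x ∉ Icc a b → x ∉ X.ess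

theorem HingeData.subset_dom {R : ℕ∞} (D : HingeData G R) : D.Ω ⊆ D.X.dom :=
  D.subset.trans D.system.subset

variable [Oriented G] [ClosedUnderRestriction G]

/-- Since the ends of the core are essential, no orbit is met both in the core and outside it. -/
theorem HingeData.mem_core_of_orb_eq {R : ℕ∞} (D : HingeData G R) {x y : I}
    (hy : y ∈ Icc D.a D.b) (h : D.X.orb x = D.X.orb y) : x ∈ Icc D.a D.b := by
  obtain ⟨s, hs⟩ := GAtlas.mem_dom_iff.1 (D.subset_dom (D.core_subset hy))
  by_contra hx
  rcases lt_or_ge x D.a with hlt | hge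
  · obtain ⟨t, ht, hE⟩ := D.left_mem
    exact Ess.not_prec_of_between hE ht (h ▸ hs) hs hlt.le hy.1 (hlt.trans_le hy.1)
  · have hlt : D.b < x := not_le.1 fun h' => hx ⟨hge, h'⟩
    obtain ⟨t, ht, hE⟩ := D.right_mem
    exact Ess.not_prec_of_between hE ht hs (h ▸ hs) hy.2 hlt.le (hy.2.trans_lt hlt)

/-- All orbits are represented by finitely many curves without essential points and finitely many
hinges, whose cores are pairwise disjoint and disjoint from the curves modulo the pseudo-group. -/
theorem exists_decomposition [T2Space T] {U : Set T} (hU : IsExhaustive G U)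
    (hUc : IsCompact (closure U)) {P : Set (OpenPartialHomeomorph T T × Set T)}
    (hP : IsFiniteSystem G U P)
    (hcomm : ∀ t, IsEssential G t → ∀ a b : Isotropy G t, a * b = b * a) :
    ∃ (m l : ℕ) (B : Fin m → GCurve G) (D : Fin l → HingeData G (essentialRank G)),
      (∀ i k z, ∀ x ∈ Icc (D k).a (D k).b, (B i).chart.orb z ≠ (D k).X.orb x) ∧
      (∀ j k, ∀ x ∈ (D j).Ω, ∀ y ∈ Icc (D k).a (D k).b, (D j).X.orb x = (D k).X.orb y → j = k) ∧
      (∀ k, ∀ x ∈ (D k).Ω, x ∉ Icc (D k).a (D k).b → ∃ i z, (B i).chart.orb z = (D k).X.orb x) ∧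
      ∀ t, (∃ i z, t ∈ (B i).chart.orb z) ∨ ∃ k, ∃ x ∈ (D k).Ω, t ∈ (D k).X.orb x := by
  obtain ⟨n, Y, p, q, hY⟩ := exists_coreFamily hU hUc hP hcomm
  obtain ⟨Y', p', q', h1, h2, h3, h4⟩ := hY.exists_isolated
  obtain ⟨l, X, a, b, hX, ha, hb, hcov, hdisj⟩ := exists_disjoint_cores h1 h2 h3 h4
  choose V r w hV hr hw using fun k => (hX k).system
  choose Ω L hΩo hΩc habΩ hΩV hLc hLX hΩ using fun k => (hw k).exists_fundamental (hV k) (hX k).le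
    (hX k).left_mem (hX k).right_mem (ha k) (hb k)
  let D : Fin l → HingeData G (essentialRank G) := fun k =>
    { X := X k, a := a k, b := b k, V := V k, r := r k, w := w k, Ω := Ω k
      le := (hX k).le
      left_mem := (hX k).left_mem
      right_mem := (hX k).right_mem
      rank_le := hr k
      system := hw k
      isOpen := hΩo k
      ordConnected := hΩc k
      subset := hΩV k
      core_subset := habΩ k
      notMem_ess := fun x hx hx' => (hΩ k x hx hx').1 }
  let C : Fin l → Set T := fun k => (X k).sat (Icc (a k) (b k))
  have hCs : ∀ k, IsSaturated G (C k) := fun k => (X k).isSaturated_sat _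
  have hCc : ∀ k, IsClosed (C k) := fun k => (hX k).isClosed_sat _ ⟨(hX k).left_mem, le_rfl, (hX k).le⟩
    _ ⟨(hX k).right_mem, (hX k).le, le_rfl⟩ (hX k).le
  -- a curve that contains a point outside a core avoids this core
  have hcurve : ∀ t, ¬ Ess G t → (∀ k, t ∉ C k) →
      ∃ B : GCurve G, (∀ k x, x ∉ B.chart.pre (C k)) ∧ ∃ x, t ∈ B.chart.orb x := by
    intro t htE htC
    obtain ⟨B, x, hx⟩ := exists_gcurve htE
    refine ⟨B, fun k z => ?_, x, hx⟩
    refine GInt.notMem_pre_sat_of_isPreconnected (hX k).left_mem (hX k).right_mem (hCc k)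
      B.isPreconnected B.dom_eq.ge (mem_univ x) (fun h => htC k ?_)
      (fun z _ hz => absurd hz (B.notMem_pre_ess z)) (mem_univ z)
    exact GAtlas.mem_of_mem_pre (hCs k) h hx
  -- the hinges avoid the cores of the other hinges
  have hΩC : ∀ j k, ∀ x ∈ Ω j, x ∈ (X j).pre (C k) → j = k := by
    intro j k x hx hxC
    by_contra hjk
    have hcore : ∀ y ∈ Icc (a j) (b j), y ∈ (X j).ess → y ∉ (X j).pre (C k) := by
      rintro y hy hyE ⟨t, ht, z, hz, htz⟩
      exact hjk (hdisj j k y hy z hz hyE (GAtlas.orb_eq_orb_of_mem ht htz))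
    refine GInt.notMem_pre_sat_of_isPreconnected (hX k).left_mem (hX k).right_mem (hCc k)
      (hΩc j).isPreconnected (D j).subset_dom (habΩ j ⟨le_rfl, (hX j).le⟩)
      (hcore _ ⟨le_rfl, (hX j).le⟩ (hX j).left_mem) (fun y hy hyE => ?_) hx hxC
    by_cases hy' : y ∈ Icc (a j) (b j)
    · exact hcore y hy' hyE
    · exact absurd hyE (hΩ j y hy hy').1
  -- the part of `closure U` which is not covered by the hinges
  obtain ⟨S, hSf, hSC, hS⟩ := exists_finite_gcurves (idAtlas G)
    (K := closure U \ ⋃ k, (X k).sat (Ω k))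
    (hUc.diff (isOpen_iUnion fun k => (X k).isOpen_sat (hΩo k)))
    (dom_idAtlas (G := G) ▸ subset_univ _) (p := fun B => ∀ k x, x ∉ B.chart.pre (C k)) <| by
      rintro t ⟨-, ht⟩
      have htC : ∀ k, t ∉ C k := fun k ⟨x, hx, hxt⟩ => ht (mem_iUnion.2 ⟨k, x, habΩ k hx, hxt⟩)
      have htE : ¬ Ess G t := fun hE => by
        obtain ⟨k, x, hx, hxt⟩ := hcov t hE
        exact htC k ⟨x, hx, hxt⟩
      obtain ⟨B, hB, x, hx⟩ := hcurve t htE htC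
      exact ⟨B, hB, x, by rw [orb_idAtlas, GAtlas.orb_eq_of_mem hx]⟩
  -- the part of `L k` outside the cores, which is compact because `L k` has no essential point
  choose S' hSf' hSC' hS' using fun k => exists_finite_gcurves (X k).toGAtlas
    (K := L k \ ⋃ j, (X k).pre ((X j).sat (Ioo (a j) (b j))))
    ((hLc k).diff (isOpen_iUnion fun j => (X k).isOpen_pre ((X j).isSaturated_sat _)
      ((X j).isOpen_sat isOpen_Ioo)))
    (sdiff_subset.trans fun x hx => (hLX k hx).1) (p := fun B => ∀ k x, x ∉ B.chart.pre (C k)) <| by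
      rintro y ⟨hy, hyC⟩
      obtain ⟨hyd, hyE⟩ := hLX k hy
      obtain ⟨t, ht⟩ := GAtlas.mem_dom_iff.1 hyd
      have htE : ¬ Ess G t := fun hE => hyE ⟨t, ht, hE⟩
      have htC : ∀ j, t ∉ C j := by
        rintro j ⟨x, hx, hxt⟩
        have hxE : x ∉ (X j).ess := fun ⟨s, hs, hsE⟩ =>
          hyE ⟨s, by rwa [GAtlas.orb_eq_orb_of_mem ht hxt], hsE⟩
        refine hyC (mem_iUnion.2 ⟨j, t, ht, x, ⟨lt_of_le_of_ne hx.1 ?_, lt_of_le_of_ne hx.2 ?_⟩, hxt⟩)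
        · rintro rfl
          exact hxE (hX j).left_mem
        · rintro rfl
          exact hxE (hX j).right_mem
      obtain ⟨B, hB, x, hx⟩ := hcurve t htE htC
      exact ⟨B, hB, x, GAtlas.orb_eq_orb_of_mem ht hx⟩
  have hfin : (S ∪ ⋃ k, S' k).Finite := hSf.union (finite_iUnion hSf')
  let e := hfin.toFinset.equivFin.symm
  have he : ∀ B ∈ S ∪ ⋃ k, S' k, ∃ i, (e i : GCurve G) = B := fun B hB =>
    ⟨e.symm ⟨B, hfin.mem_toFinset.2 hB⟩, by simp⟩
  have hBC : ∀ i k x, x ∉ (e i : GCurve G).chart.pre (C k) := by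
    intro i
    rcases hfin.mem_toFinset.1 (e i).2 with h | h
    · exact hSC _ h
    · obtain ⟨k, hk⟩ := mem_iUnion.1 h
      exact hSC' k _ hk
  refine ⟨_, l, fun i => e i, D, ?_, ?_, ?_, ?_⟩
  · intro i k z x hx h
    obtain ⟨t, ht⟩ := GAtlas.mem_dom_iff.1 ((D k).subset_dom (habΩ k hx))
    exact hBC i k z ⟨t, h ▸ ht, x, hx, ht⟩
  · intro j k x hx y hy h
    obtain ⟨t, ht⟩ := GAtlas.mem_dom_iff.1 ((D k).subset_dom (habΩ k hy))
    exact hΩC j k x hx ⟨t, h ▸ ht, y, hy, ht⟩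
  · intro k x hx hxab
    obtain ⟨-, y, hy, hyx⟩ := hΩ k x hx hxab
    obtain ⟨B, hB, z, hz⟩ := hS' k y ⟨hy, fun h => by
      obtain ⟨j, t, ht, u, hu, htu⟩ := mem_iUnion.1 h
      rw [hyx] at ht
      have hu' := Ioo_subset_Icc_self hu
      obtain rfl := hΩC k j x hx ⟨t, ht, u, hu', htu⟩
      exact hxab ((D k).mem_core_of_orb_eq hu' (GAtlas.orb_eq_orb_of_mem ht htu))⟩
    obtain ⟨i, rfl⟩ := he B (Or.inr (mem_iUnion.2 ⟨k, hB⟩))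
    exact ⟨i, z, hz.trans hyx⟩
  · intro t
    obtain ⟨t', ht', ht'U⟩ := hU.2 t
    by_cases h : t' ∈ ⋃ k, (X k).sat (Ω k)
    · obtain ⟨k, x, hx, hxt⟩ := mem_iUnion.1 h
      exact Or.inr ⟨k, x, hx, GAtlas.orb_eq_of_mem hxt ▸ mem_orbit_symm ht'⟩
    · obtain ⟨B, hB, z, hz⟩ := hS t' ⟨subset_closure ht'U, h⟩
      obtain ⟨i, rfl⟩ := he B (Or.inl hB)
      refine Or.inl ⟨i, z, ?_⟩
      rw [hz, orb_idAtlas]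
      exact mem_orbit_symm ht'

/-! ### Assembling the pieces -/

theorem closedUnderRestriction_restrictAlong {X Y : Type*} [TopologicalSpace X] [TopologicalSpace Y]
    (G : StructureGroupoid Y) (f : X → Y) (hf : IsOpenEmbedding f) :
    ClosedUnderRestriction (restrictAlong G f hf) where
  closedUnderRestriction := by
    intro e he s hs x hx
    rw [OpenPartialHomeomorph.restr_source] at hx
    exact he x hx.1

variable {T : Type*} [TopologicalSpace T] [ChartedSpace I T] {G : StructureGroupoid T}
  [ClosedUnderRestriction G] {R : ℕ∞}

/-- A curve, as a piece of the model. -/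
def GCurve.piece (B : GCurve G) : Piece.{_, 0} G := ⟨B.carrier, B.chart, B.dom_eq⟩

instance (D : HingeData G R) : Nonempty D.Ω := ⟨⟨D.a, D.core_subset ⟨le_rfl, D.le⟩⟩⟩

/-- The domain of a hinge, as a piece of the model. -/
noncomputable def HingeData.piece (D : HingeData G R) : Piece.{_, 0} G where
  carrier := D.Ω
  chart := D.X.toGAtlas.comap
    (D.isOpen.isOpenEmbedding_subtypeVal.toOpenPartialHomeomorph (Subtype.val : D.Ω → I))
  dom_eq := by
    rw [GAtlas.dom_comap]
    exact eq_univ_of_forall fun x => ⟨by simp, D.subset_dom x.2⟩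

theorem HingeData.germ_val (D : HingeData G R) (x : D.Ω) :
    D.piece.chart.Germ D.X.toGAtlas (Subtype.val : D.Ω → I) x :=
  GAtlas.germ_comap (e := D.isOpen.isOpenEmbedding_subtypeVal.toOpenPartialHomeomorph
    (Subtype.val : D.Ω → I)) _ (by simp) (D.subset_dom x.2)

theorem HingeData.orb_piece (D : HingeData G R) (x : D.Ω) :
    D.piece.chart.orb x = D.X.orb x :=
  (D.germ_val x).orb_eq.symm

/-- The hinge on a copy `Z` of the interval `Ω`. It is contained in every pseudo-group obtained by
gluing `Z` into a space modelled on `(G, T)`. -/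
theorem HingeData.exists_hinge [Oriented G] (D : HingeData G R) {Z : Type*} [TopologicalSpace Z]
    (h : D.Ω ≃ₜ Z) :
    ∃ Γ : StructureGroupoid Z, IsHinge Γ ((fun z => (h.symm z : I)) ⁻¹' Icc D.a D.b) ∧
      hingeRank Γ ((fun z => (h.symm z : I)) ⁻¹' Icc D.a D.b) ≤ R ∧
      ∀ {W : Type _} [TopologicalSpace W] (A : GAtlas G W) (hA : A.dom = univ) (f : Z → W)
        (hf : IsOpenEmbedding f), (∀ y, D.piece.chart.Germ A (f ∘ h : D.Ω → W) y) →
        Γ ≤ restrictAlong (A.groupoid hA) f hf := by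
  have hj : IsOpenEmbedding (fun z => (h.symm z : I)) :=
    D.isOpen.isOpenEmbedding_subtypeVal.comp h.symm.isOpenEmbedding
  have hr : range (fun z => (h.symm z : I)) = D.Ω := by
    rw [show (fun z => (h.symm z : I)) = Subtype.val ∘ h.symm from rfl, h.symm.surjective.range_comp,
      Subtype.range_val]
  obtain ⟨Γ, h1, h2, h3⟩ := D.system.exists_hinge D.le D.left_mem D.right_mem hj
    (by rw [hr]; exact D.ordConnected) (by rw [hr]; exact D.subset)
    (by rw [hr]; exact D.core_subset) (by rw [hr]; exact D.notMem_ess)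
  refine ⟨Γ, h1, h2.trans D.rank_le, fun {W} _ A hA f hf hfA => ?_⟩
  let B : GAtlas G Z := GAtlas.comap (Y := D.Ω) D.piece.chart h.symm.toOpenPartialHomeomorph
  have hB1 : ∀ z, B.Germ D.piece.chart (h.symm : Z → D.Ω) z := fun z =>
    GAtlas.germ_comap (Y := D.Ω) (e := h.symm.toOpenPartialHomeomorph) _ (by simp)
      (D.piece.dom_eq ▸ mem_univ _)
  have hB : B.dom = univ := eq_univ_of_forall fun z => (hB1 z).mem_dom
  have hB2 : ∀ z, B.Germ D.X.toGAtlas (fun z => (h.symm z : I)) z := fun z =>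
    GAtlas.Germ.comp (Y := D.Ω) (D.germ_val _) (hB1 z)
  have hB3 : ∀ z, B.Germ A f z := fun z => by
    have h4 := GAtlas.Germ.comp (Y := D.Ω) (hfA _) (hB1 z)
    refine h4.congr (Eventually.of_forall fun z' => ?_)
    simp
  refine h3 _ (closedUnderRestriction_restrictAlong _ _ _) fun γ hγ => ?_
  rw [A.restrictAlong_groupoid hA B hB hf hB3]
  intro z hz
  obtain ⟨g, hg, hgz⟩ := hγ z hz
  refine (hB2 (γ z)).of_comp (γ.continuousAt hz) ?_
  exact (GAtlas.Germ.comp (f := fun z => (h.symm z : I)) hg (hB2 z)).congr hgz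

end OneDimPseudo


theorem mainTheorem7 (c : OneDimPseudo.DiffClass) (T : Type u) [TopologicalSpace T]
    [ChartedSpace unitInterval T] (hT : OneDimPseudo.IsOrientedOneManifold c T)
    (G : StructureGroupoid T) (hG : OneDimPseudo.IsPseudoGroup c G)
    (hcg : OneDimPseudo.IsCompactlyGenerated G)
    (hcomm : ∀ t : T, OneDimPseudo.IsEssential G t →
      ∀ a b : OneDimPseudo.Isotropy G t, a * b = b * a) :
    ∃ (T' : Type u) (_ : TopologicalSpace T') (_ : ChartedSpace unitInterval T')
      (G' : StructureGroupoid T'),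
      OneDimPseudo.IsOrientedOneManifold c T' ∧ OneDimPseudo.IsPseudoGroup c G' ∧
      OneDimPseudo.HaefligerEquivalent c G G' ∧
      ∃ (T₀ : Opens T') (l : ℕ) (Ω : Fin l → Opens T') (Γ : ∀ k, StructureGroupoid (Ω k))
        (C : ∀ k, Set (Ω k)),
        -- the splitting of `T'`
        (∀ k, Disjoint (T₀ : Set T') (Ω k)) ∧
        Pairwise (fun j k => Disjoint (Ω j : Set T') (Ω k)) ∧
        (T₀ : Set T') ∪ (⋃ k, (Ω k : Set T')) = univ ∧
        -- the shape of `T₀`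
        OneDimPseudo.IsFiniteUnionOfCirclesAndIntervals T₀ ∧
        -- the hinges and their ranks
        (∀ k, OneDimPseudo.IsHinge (Γ k) (C k) ∧
          Γ k ≤ OneDimPseudo.restrictTo G' (Ω k) ∧
          OneDimPseudo.hingeRank (Γ k) (C k) ≤ OneDimPseudo.essentialRank G) ∧
        -- the cores are saturated
        (∀ k, ∀ t ∈ C k, OneDimPseudo.orbit G' (t : T') ⊆ Subtype.val '' C k) ∧
        -- orbits outside the cores meet `T₀`
        (∀ k, ∀ t ∉ C k, (OneDimPseudo.orbit G' (t : T') ∩ T₀).Nonempty) := by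
  have := hG.restr
  have := hG.oriented
  have := hT.t2
  obtain ⟨U, hU, hUc, S, hS, hext, hgen⟩ := hcg
  obtain ⟨P₀, hP₀⟩ := OneDimPseudo.exists_finiteSystem hS hext hgen
  obtain ⟨m, l, B, D, h1, h2, h3, h4⟩ := OneDimPseudo.exists_decomposition hU hUc hP₀ hcomm
  -- the pieces live in `Type`; the index type is lifted so that their disjoint union lives in `Type u`
  let P : ULift.{u} (Fin m ⊕ Fin l) → OneDimPseudo.Piece.{_, 0} G := fun c =>
    Sum.elim (fun i => (B i).piece) (fun k => (D k).piece) c.down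
  let T' : Type u := Σ c, (P c).carrier
  let f : ∀ c, (P c).carrier → T' := fun c y => ⟨c, y⟩
  have hf : ∀ c, IsOpenEmbedding (f c) := fun c => @IsOpenEmbedding.sigmaMk _ (fun c => (P c).carrier) _ c
  have hd : ∀ c c' y y', f c y = f c' y' → c = c' := fun c c' y y' h => congrArg Sigma.fst h
  have hP : ∀ c, T2Space (P c).carrier ∧ SecondCountableTopology (P c).carrier := by
    rintro ⟨i | k⟩
    · rcases (B i).shape with ⟨⟨e⟩⟩ | ⟨⟨e⟩⟩
      · exact ⟨e.isEmbedding.t2Space, e.isEmbedding.secondCountableTopology⟩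
      · exact ⟨e.isEmbedding.t2Space, e.isEmbedding.secondCountableTopology⟩
    · exact ⟨inferInstanceAs (T2Space (D k).Ω),
        inferInstanceAs (SecondCountableTopology (D k).Ω)⟩
  have := fun c => (hP c).1
  have := fun c => (hP c).2
  let A : OneDimPseudo.GAtlas G T' := OneDimPseudo.GAtlas.glue P f hf hd
  have hA : A.dom = univ := OneDimPseudo.GAtlas.dom_glue fun z => ⟨z.1, z.2, rfl⟩
  have horb : ∀ c y, A.orb (f c y) = (P c).chart.orb y := fun c y =>
    OneDimPseudo.GAtlas.orb_glue c y
  have horbB : ∀ i (y : (B i).carrier), A.orb (f ⟨Sum.inl i⟩ y) = (B i).chart.orb y := fun i y =>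
    horb ⟨Sum.inl i⟩ y
  have horbD : ∀ k (y : (D k).Ω), A.orb (f ⟨Sum.inr k⟩ y) = (D k).X.orb y := fun k y =>
    (horb ⟨Sum.inr k⟩ y).trans ((D k).orb_piece y)
  let _ : ChartedSpace unitInterval T' := A.chartedSpace hA
  have hfac : ∀ χ ∈ atlas unitInterval T', A.Factors χ := fun χ ⟨α, hα, φ, hφ, h⟩ =>
    Or.inr ⟨α, hα, φ, hφ, h ▸ Setoid.refl _⟩
  -- the pieces meet all the orbits, hence the Haefliger equivalence
  have hex : ∀ t, ∃ z, t ∈ A.orb z := by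
    intro t
    rcases h4 t with ⟨i, z, hz⟩ | ⟨k, x, hx, hxt⟩
    · exact ⟨f ⟨Sum.inl i⟩ z, by rwa [horbB]⟩
    · exact ⟨f ⟨Sum.inr k⟩ (⟨x, hx⟩ : (D k).Ω), by rwa [horbD]⟩
  let J : Fin m → Opens T' := fun i => ⟨range (f ⟨Sum.inl i⟩), (hf _).isOpen_range⟩
  let Ω : Fin l → Opens T' := fun k => ⟨range (f ⟨Sum.inr k⟩), (hf _).isOpen_range⟩
  let h : ∀ k, (D k).Ω ≃ₜ Ω k := fun k => (hf ⟨Sum.inr k⟩).isEmbedding.toHomeomorph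
  have hh : ∀ k x, ((h k x : Ω k) : T') = f ⟨Sum.inr k⟩ x := fun k x => rfl
  have hval : ∀ k (t : Ω k), (t : T') = f ⟨Sum.inr k⟩ ((h k).symm t) := fun k t => by
    rw [← hh, Homeomorph.apply_symm_apply]
  choose Γ hΓ hΓr hΓG using fun k => (D k).exists_hinge (h k)
  refine ⟨T', inferInstance, inferInstance, A.groupoid hA,
    A.isOrientedOneManifold hG hA hfac, A.isPseudoGroup hG hA hfac,
    A.haefligerEquivalent hG hA hex, ⨆ i, J i, l, Ω, Γ,
    fun k => (fun z => ((h k).symm z : unitInterval)) ⁻¹' Icc (D k).a (D k).b,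
    ?_, ?_, ?_, ⟨m, J, ?_, ?_, ?_⟩, ?_, ?_, ?_⟩
  · intro k
    rw [Set.disjoint_left]
    rintro _ h₀ ⟨y, rfl⟩
    simp only [Opens.coe_iSup, mem_iUnion] at h₀
    obtain ⟨i, y', hy'⟩ := h₀
    cases hd _ _ _ _ hy'
  · intro j k hjk
    refine Set.disjoint_left.2 ?_
    rintro _ ⟨y, rfl⟩ ⟨y', hy'⟩
    cases hd _ _ _ _ hy'
    exact hjk rfl
  · refine eq_univ_of_forall fun z => ?_
    obtain ⟨⟨i | k⟩, y⟩ := z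
    · refine Or.inl ?_
      simp only [Opens.coe_iSup, mem_iUnion]
      exact ⟨i, y, rfl⟩
    · exact Or.inr (mem_iUnion.2 ⟨k, y, rfl⟩)
  · intro i j hij
    refine Set.disjoint_left.2 ?_
    rintro _ ⟨y, rfl⟩ ⟨y', hy'⟩
    cases hd _ _ _ _ hy'
    exact hij rfl
  · rw [Opens.coe_iSup]
  · intro i
    have e : J i ≃ₜ (B i).carrier := (hf ⟨Sum.inl i⟩).isEmbedding.toHomeomorph.symm
    rcases (B i).shape with ⟨⟨e'⟩⟩ | ⟨⟨e'⟩⟩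
    · exact Or.inl ⟨e.trans e'⟩
    · exact Or.inr ⟨e.trans e'⟩
  · exact fun k => ⟨hΓ k, hΓG k A hA _ (Ω k).isOpenEmbedding' fun y =>
      OneDimPseudo.GAtlas.germ_glue (P := P) (f := f) (hf := hf) (hd := hd) ⟨Sum.inr k⟩ y, hΓr k⟩
  · -- an orbit that meets the core `k` meets no curve and no other hinge, and stays in the core
    intro k t ht z hz
    rw [OneDimPseudo.GAtlas.mem_orbit_groupoid, hval, horbD] at hz
    obtain ⟨⟨i | j⟩, y⟩ := z
    · exact absurd ((horbB i y).symm.trans hz) (h1 i k y _ ht)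
    · obtain ⟨x, hx⟩ : ∃ x : (D j).Ω, f ⟨Sum.inr j⟩ x = ⟨⟨Sum.inr j⟩, y⟩ := ⟨y, rfl⟩
      rw [← hx, horbD] at hz
      rw [← hx]
      obtain rfl := h2 j k x x.2 _ ht hz
      refine ⟨h j x, ?_, rfl⟩
      change ((h j).symm (h j x) : unitInterval) ∈ Icc (D j).a (D j).b
      rw [Homeomorph.symm_apply_apply]
      exact (D j).mem_core_of_orb_eq ht hz
  · intro k t ht
    obtain ⟨i, z, hz⟩ := h3 k _ ((h k).symm t).2 ht
    refine ⟨f ⟨Sum.inl i⟩ z, ?_, ?_⟩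
    · rw [OneDimPseudo.GAtlas.mem_orbit_groupoid, hval, horbD, horbB, hz]
    · exact Opens.mem_iSup.2 ⟨i, mem_range_self z⟩
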